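/- A knot is a smooth embedding (of class $C^\infty$, with nowhere vanishing velocity) or a polygonal embedding $K:S^1\hookrightarrow\mathbb{R}^3$, and $[K]$ denotes its ambient isotopy class in $\mathbb{R}^3$. The knot is nontrivial if it is not ambient isotopic to a round circle. For a unit vector $\vec v\in S^2$ let $b_{\vec v}(K)$ be the number of local maxima of the function $t\mapsto\langle \vec v,K(t)\rangle$ on $S^1$, where a connected plateau of the function off which all nearby values are strictly smaller counts as one local maximum. The superbridge index of $K$ is $$sb(K)=\min_{K'\in[K]}\ \max_{\vec v\in S^2} b_{\vec v}(K').$$ A petal projection of $K$ is the projection to the $xy$-plane of some $K'\in[K]$ such that (i) there is exactly one crossing point $o$, that is, the curve passes through $o$ and the projection is injective away from $o$; (ii) every strand passes through $o$ with nonzero velocity and any two strands cross transversally there (so every strand bisects the crossing); and (iii) no loop is nested: cutting the projected curve at its passages through $o$ gives finitely many closed loops based at $o$, and no loop lies in the closed region enclosed by another one (the loop together with the bounded components of its complement). A single strand through $o$, hence a single loop, is allowed. The petal number $p(K)$ is the smallest number of loops among all petal projections of $K$. Theorem. For every nontrivial knot $K$, $$2\,sb(K)\le p(K)+1.$$ 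-/

import Mathlib

open Set Topology

/-- Euclidean three-space. -/
abbrev E3 : Type := EuclideanSpace ℝ (Fin 3)

/-- A smooth closed curve with nowhere vanishing velocity, parametrized by the circle `ℝ / ℤ`. -/
def IsSmoothCurve (f : UnitAddCircle → E3) : Prop :=
  ContDiff ℝ (⊤ : ℕ∞) (fun t : ℝ => f (t : UnitAddCircle)) ∧
    ∀ t : ℝ, deriv (fun t : ℝ => f (t : UnitAddCircle)) t ≠ 0

/-- A polygonal closed curve: `[0, 1]` is cut into finitely many intervals, on each of which
the curve is an affine function of the parameter. -/
def IsPolygonalCurve (f : UnitAddCircle → E3) : Prop :=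
  ∃ (n : ℕ) (τ : Fin (n + 1) → ℝ), Monotone τ ∧ τ 0 = 0 ∧ τ (Fin.last n) = 1 ∧
    ∀ i : Fin n, ∃ a b : E3, ∀ t ∈ Icc (τ i.castSucc) (τ i.succ),
      f (t : UnitAddCircle) = a + t • b

/-- A knot: a smooth or polygonal embedding of the circle in three-space. -/
structure Knot where
  toFun : UnitAddCircle → E3
  continuous_toFun : Continuous toFun
  injective_toFun : Function.Injective toFun
  smooth_or_polygonal : IsSmoothCurve toFun ∨ IsPolygonalCurve toFun

/-- Two subsets of three-space are ambient isotopic: some isotopy of homeomorphisms of the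
space, starting at the identity, carries one onto the other at time one. -/
def AmbientIsotopic (A B : Set E3) : Prop :=
  ∃ H : unitInterval → (E3 ≃ₜ E3),
    Continuous (fun p : unitInterval × E3 => H p.1 p.2) ∧
      (∀ x, H 0 x = x) ∧ H 1 '' A = B

namespace Knot

/-- `L` belongs to the ambient isotopy class of `K`. -/
def Equivalent (K L : Knot) : Prop :=
  AmbientIsotopic (range K.toFun) (range L.toFun)

/-- A knot is trivial if it is ambient isotopic to the round unit circle in the `xy`-plane. -/
def IsTrivial (K : Knot) : Prop :=
  AmbientIsotopic (range K.toFun) {x : E3 | x 0 ^ 2 + x 1 ^ 2 = 1 ∧ x 2 = 0}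

end Knot

/-! ### The superbridge index -/

/-- The local maxima of a function on the circle. A local maximum is a plateau (a connected
component of a level set, usually one point) such that all points near the plateau and off it
have a strictly smaller value. Each plateau counts once. -/
def localMaxima (f : UnitAddCircle → ℝ) : Set (Set UnitAddCircle) :=
  {C | ∃ t, C = connectedComponentIn (f ⁻¹' {f t}) t ∧ ∀ᶠ s in 𝓝ˢ C, s ∉ C → f s < f t}

namespace Knot

/-- The number of local maxima of the knot in the direction `v`. -/
noncomputable def numLocalMaxima (K : Knot) (v : E3) : ℕ∞ :=
  (localMaxima fun t => inner ℝ v (K.toFun t)).encard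

/-- The superbridge index. -/
noncomputable def superbridgeIndex (K : Knot) : ℕ∞ :=
  ⨅ (L : Knot) (_ : K.Equivalent L), ⨆ v ∈ Metric.sphere (0 : E3) 1, L.numLocalMaxima v

end Knot

/-! ### Petal projections and the petal number -/

/-- The closed region enclosed by a planar loop `l`: the loop together with all bounded
connected components of its complement. -/
def enclosedRegion (l : Set ℂ) : Set ℂ :=
  l ∪ {p | p ∉ l ∧ Bornology.IsBounded (connectedComponentIn lᶜ p)}

namespace Knot

/-- The projection of the knot to the `xy`-plane (identified with `ℂ`), as a curve of period
one on the real line. -/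
def proj (K : Knot) (t : ℝ) : ℂ :=
  ⟨K.toFun (t : UnitAddCircle) 0, K.toFun (t : UnitAddCircle) 1⟩

/-- The loops of the projection at the point `o`: the closed curves traced between two
consecutive passages through `o`. -/
def loops (K : Knot) (o : ℂ) : Set (Set ℂ) :=
  {l | ∃ a b : ℝ, a < b ∧ K.proj a = o ∧ K.proj b = o ∧ (∀ t ∈ Ioo a b, K.proj t ≠ o) ∧
    l = K.proj '' Icc a b}

/-- The projection to the `xy`-plane is a petal projection with crossing point `o`. -/
structure IsPetalProjection (K : Knot) (o : ℂ) : Prop where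
  /-- The curve passes through the crossing point. -/
  mem_range : o ∈ range K.proj
  /-- There is no crossing apart from `o`. -/
  single_crossing : ∀ s t : ℝ, K.proj s = K.proj t → K.proj s ≠ o →
    (s : UnitAddCircle) = (t : UnitAddCircle)
  /-- Every strand passes through `o` with a nonzero velocity. -/
  strand : ∀ t : ℝ, K.proj t = o → DifferentiableAt ℝ K.proj t ∧ deriv K.proj t ≠ 0
  /-- Any two strands cross transversally at `o`; so each strand has half of the ends of the
  other strands on either side, that is, it bisects the crossing. -/
  transversal : ∀ s t : ℝ, K.proj s = o → K.proj t = o →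
    (s : UnitAddCircle) ≠ (t : UnitAddCircle) →
      LinearIndependent ℝ ![deriv K.proj s, deriv K.proj t]
  /-- There is no nesting loop: no loop contains another loop. -/
  not_nested : ∀ l ∈ K.loops o, ∀ l' ∈ K.loops o, l' ≠ l → ¬ l' ⊆ enclosedRegion l

/-- The petal number: the smallest number of loops among all petal projections of knots in
the ambient isotopy class. -/
noncomputable def petalNumber (K : Knot) : ℕ∞ :=
  ⨅ (L : Knot) (_ : K.Equivalent L) (o : ℂ) (_ : L.IsPetalProjection o), (L.loops o).encard

end Knot

/-!
The proof brings a knot with a petal projection into a position in which it is a polygon, and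
counts the local maxima of this polygon in every direction.

In a petal projection with `p` loops, let `d i` be the velocity of the `i`-th strand at the
crossing point, where `i` is an integer modulo `p`. Since no loop encloses another one, the two
ends of each loop, which leave in the directions `d i` and `-d (i + 1)`, are neighbours among the
`2 * p` branches at the crossing point: if there were a branch between them, then there would be
branches in both of the sectors that they bound, and the loop winds around the points near the
crossing point in one of the two sectors (`IsPetalCurve.ne_add_of_not_nested`). The proof of this
needs no Jordan curve theorem; winding is expressed by the absence of a closed logarithm
(`HasClosedLog`).

The isotopy type of the knot depends only on the strands and their heights. More precisely, a
planar isotopy makes the strands straight near the crossing point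
(`IsPetalCurve.exists_normal_form`), and after that each loop can be replaced by a straight segment
from the end `u i` of a strand to the start `-u (i + 1)` of the next one
(`IsNormalPetalCurve.isotopicSets_petalPolygon`). No isotopy of the plane is needed for this: a
loop without crossings may be raised over the rest of the knot, moved there by a twist of each
horizontal plane, and lowered again (`isotopicSets_of_replace_arc`). The neighbour property shows
that the segments have no crossings either, if `p ≥ 3`.

The result is a polygon with the horizontal strands from `-u i` to `u i`. In a direction with the
horizontal part `q` the polygon rises along the strand `i` if `⟪q, u i⟫ > 0` and falls along it if
`⟪q, u i⟫ < 0`. Between a rising and a falling strand, in this order, there is one maximum, and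
between a falling and a rising strand there is none; two consecutive strands with the same sign
contribute one maximum at most. The latter happens only if the line orthogonal to `q` passes
through the cone between `u i` and `-u (i + 1)`, and these cones together with their opposites are
disjoint (`IsNormalPetalCurve.dvd_of_same_sign`). Hence there is at most one such `i`, and the
number `b` of maxima satisfies `2 * b ≤ p + 1` (`two_mul_card_le`).

If `p ≤ 2`, then the part of the knot other than the lower strand can be raised and contracted to
two sides of a triangle, so the knot is isotopic to a triangle, which has one maximum in each
direction (`IsNormalPetalCurve.exists_equivalent_of_le_two`).
-/

/-! ### Ambient isotopies -/

/-- Two subsets of a topological space are ambient isotopic. For `E3` this is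
`AmbientIsotopic`; the constructions below take place in `ℂ × ℝ`. -/
def IsotopicSets {X : Type*} [TopologicalSpace X] (A B : Set X) : Prop :=
  ∃ H : unitInterval → (X ≃ₜ X),
    Continuous (fun p : unitInterval × X => H p.1 p.2) ∧
      (∀ x, H 0 x = x) ∧ H 1 '' A = B

namespace IsotopicSets

variable {X Y : Type*} [TopologicalSpace X] [TopologicalSpace Y] {A B C : Set X}

theorem refl (A : Set X) : IsotopicSets A A :=
  ⟨fun _ => Homeomorph.refl X, continuous_snd, fun _ => rfl, by simp⟩

theorem trans (h₁ : IsotopicSets A B) (h₂ : IsotopicSets B C) : IsotopicSets A C := by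
  obtain ⟨F, hF, hF0, hF1⟩ := h₁
  obtain ⟨G, hG, hG0, hG1⟩ := h₂
  refine ⟨fun t => (F t).trans (G t), ?_, fun x => by simp [hF0, hG0], ?_⟩
  · exact hG.comp (continuous_fst.prodMk hF)
  · rw [← hG1, ← hF1, ← image_comp]
    rfl

/-- The reversed isotopy is `t ↦ H (1 - t) ∘ (H 1)⁻¹`. -/
theorem symm (h : IsotopicSets A B) : IsotopicSets B A := by
  obtain ⟨F, hF, hF0, hF1⟩ := h
  refine ⟨fun t => (F 1).symm.trans (F (unitInterval.symm t)), ?_, fun x => by simp, ?_⟩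
  · exact hF.comp ((unitInterval.continuous_symm.comp continuous_fst).prodMk
      ((F 1).symm.continuous.comp continuous_snd))
  · rw [← hF1, ← image_comp]
    simp [hF0]

theorem image_homeomorph (e : X ≃ₜ Y) (h : IsotopicSets A B) :
    IsotopicSets (e '' A) (e '' B) := by
  obtain ⟨F, hF, hF0, hF1⟩ := h
  refine ⟨fun t => (e.symm.trans (F t)).trans e, ?_, fun x => by simp [hF0], ?_⟩
  · exact e.continuous.comp
      (hF.comp (continuous_fst.prodMk (e.symm.continuous.comp continuous_snd)))
  · rw [← hF1, ← image_comp, ← image_comp]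
    simp [Function.comp_def]

end IsotopicSets

/-- An isotopy of the plane moves curves in `ℂ × ℝ`, without changing their heights. -/
theorem isotopicSets_of_planar_isotopy {T : Type*} {γ : T → ℂ} {z : T → ℝ}
    (H : unitInterval → (ℂ ≃ₜ ℂ)) (hH : Continuous (fun p : unitInterval × ℂ => H p.1 p.2))
    (h0 : ∀ x, H 0 x = x) :
    IsotopicSets (range fun t => (γ t, z t)) (range fun t => (H 1 (γ t), z t)) := by
  refine ⟨fun t => (H t).prodCongr (Homeomorph.refl ℝ), ?_,
    fun x => Prod.ext (h0 x.1) rfl, ?_⟩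
  · exact (hH.comp (continuous_fst.prodMk (continuous_fst.comp continuous_snd))).prodMk
      (continuous_snd.comp continuous_snd)
  · rw [← range_comp]
    rfl

/-- The heights of a curve may be changed by any amount that depends only on the projection. -/
theorem isotopicSets_of_forall_sub_eq {T : Type*} [TopologicalSpace T] [CompactSpace T]
    {γ : T → ℂ} {z z' : T → ℝ} (hγ : Continuous γ) (hz : Continuous z) (hz' : Continuous z')
    (h : ∀ s t, γ s = γ t → z' s - z s = z' t - z t) :
    IsotopicSets (range fun t => (γ t, z t)) (range fun t => (γ t, z' t)) := by
  have hcl : IsClosed (range γ) := (isCompact_range hγ).isClosed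
  have hq : IsQuotientMap (rangeFactorization γ) := by
    apply IsClosedMap.isQuotientMap _ hγ.rangeFactorization rangeFactorization_surjective
    exact hγ.rangeFactorization.isClosedMap
  choose g hg using fun p : range γ => p.2
  have hgγ : ∀ t, z' (g (rangeFactorization γ t)) - z (g (rangeFactorization γ t)) =
      z' t - z t := fun t => h _ _ (hg (rangeFactorization γ t))
  have hδ : Continuous fun p : range γ => z' (g p) - z (g p) := by
    rw [hq.continuous_iff]
    have : ((fun p : range γ => z' (g p) - z (g p)) ∘ rangeFactorization γ) =
      fun t => z' t - z t := funext hgγ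
    rw [this]
    exact hz'.sub hz
  obtain ⟨Φ, hΦ⟩ := ContinuousMap.exists_restrict_eq hcl ⟨_, hδ⟩
  have hΦγ : ∀ t, Φ (γ t) = z' t - z t := fun t => by
    rw [← hgγ t]
    exact congrArg (fun F => F (rangeFactorization γ t)) hΦ
  refine ⟨fun τ =>
    { toFun := fun p => (p.1, p.2 + τ * Φ p.1)
      invFun := fun p => (p.1, p.2 - τ * Φ p.1)
      left_inv := fun p => by simp
      right_inv := fun p => by simp
      continuous_toFun := by fun_prop
      continuous_invFun := by fun_prop }, ?_, fun x => by simp, ?_⟩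
  · change Continuous fun p : unitInterval × (ℂ × ℝ) =>
      (p.2.1, p.2.2 + (p.1 : ℝ) * Φ p.2.1)
    fun_prop
  · rw [← range_comp]
    congr 1
    ext1 t
    simp [hΦγ]

/-- The heights of a curve may be changed by an increasing affine map. -/
theorem isotopicSets_of_affine_height {T : Type*} (γ : T → ℂ) (z : T → ℝ) {κ z₀ : ℝ}
    (hκ : 0 < κ) :
    IsotopicSets (range fun t => (γ t, z t)) (range fun t => (γ t, z₀ + κ * (z t - z₀))) := by
  have hpos : ∀ τ : unitInterval, 0 < 1 - (τ : ℝ) + τ * κ := fun τ => by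
    rcases eq_or_lt_of_le τ.2.1 with h | h
    · rw [← h]; norm_num
    · nlinarith [τ.2.2, mul_pos h hκ]
  refine ⟨fun τ =>
    { toFun := fun p => (p.1, z₀ + (1 - (τ : ℝ) + τ * κ) * (p.2 - z₀))
      invFun := fun p => (p.1, z₀ + (p.2 - z₀) / (1 - (τ : ℝ) + τ * κ))
      left_inv := fun p => by ext <;> simp; field_simp [(hpos τ).ne']; ring
      right_inv := fun p => by ext <;> simp; field_simp [(hpos τ).ne']; ring
      continuous_toFun := by fun_prop
      continuous_invFun := by fun_prop }, ?_, fun x => by simp, ?_⟩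
  · change Continuous fun p : unitInterval × (ℂ × ℝ) =>
      (p.2.1, z₀ + (1 - (p.1 : ℝ) + p.1 * κ) * (p.2.2 - z₀))
    fun_prop
  · rw [← range_comp]
    congr 1
    ext1 t
    simp

/-- A level-preserving isotopy that rotates and scales the plane at height `ζ` about the centre
`Q ζ`, by the factor `exp (Λ ζ)`. -/
theorem isotopicSets_of_twist {T : Type*} {γ γ' : T → ℂ} {z : T → ℝ} {Q Λ : ℝ → ℂ}
    (hQ : Continuous Q) (hΛ : Continuous Λ)
    (h : ∀ t, γ' t = Q (z t) + (γ t - Q (z t)) * Complex.exp (Λ (z t))) :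
    IsotopicSets (range fun t => (γ t, z t)) (range fun t => (γ' t, z t)) := by
  refine ⟨fun τ =>
    { toFun := fun p => (Q p.2 + (p.1 - Q p.2) * Complex.exp ((τ : ℝ) * Λ p.2), p.2)
      invFun := fun p => (Q p.2 + (p.1 - Q p.2) * Complex.exp (-((τ : ℝ) * Λ p.2)), p.2)
      left_inv := fun p => by simp [mul_assoc, ← Complex.exp_add]
      right_inv := fun p => by simp [mul_assoc, ← Complex.exp_add]
      continuous_toFun := by fun_prop
      continuous_invFun := by fun_prop }, ?_, fun x => by simp, ?_⟩
  · change Continuous fun p : unitInterval × (ℂ × ℝ) =>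
      (Q p.2.2 + (p.2.1 - Q p.2.2) * Complex.exp (((p.1 : ℝ) : ℂ) * Λ p.2.2), p.2.2)
    fun_prop
  · rw [← range_comp]
    congr 1
    ext1 t
    simp [h]

/-- Euclidean three-space as the product of the `xy`-plane and the `z`-axis. -/
noncomputable def planeHeight : E3 ≃ₜ ℂ × ℝ where
  toFun x := (⟨x 0, x 1⟩, x 2)
  invFun p := !₂[p.1.re, p.1.im, p.2]
  left_inv x := by ext i; fin_cases i <;> simp
  right_inv p := by simp
  continuous_toFun := by
    refine Continuous.prodMk ?_ (by fun_prop)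
    have : (fun x : E3 => (⟨x 0, x 1⟩ : ℂ)) =
        fun x : E3 => ((x 0 : ℝ) : ℂ) + (x 1 : ℝ) * Complex.I := by
      funext x
      exact Complex.mk_eq_add_mul_I _ _
    rw [this]
    fun_prop
  continuous_invFun := by
    apply (PiLp.continuous_toLp 2 _).comp
    refine continuous_pi fun i => ?_
    fin_cases i <;> simp <;> fun_prop

theorem ambientIsotopic_iff_isotopicSets {A B : Set E3} :
    AmbientIsotopic A B ↔ IsotopicSets (planeHeight '' A) (planeHeight '' B) := by
  refine ⟨fun h => IsotopicSets.image_homeomorph (X := E3) planeHeight h, fun h => ?_⟩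
  have := h.image_homeomorph planeHeight.symm
  simp only [← image_comp, Homeomorph.symm_comp_self, image_id] at this
  exact this

/-! ### Replacing an arc that lies over the rest of the curve -/

/-- A nowhere vanishing complex function on the line has a continuous logarithm. -/
theorem exists_continuous_log {r : ℝ → ℂ} (hr : Continuous r) (h0 : ∀ x, r x ≠ 0) :
    ∃ Λ : ℝ → ℂ, Continuous Λ ∧ (∀ x, Complex.exp (Λ x) = r x) ∧ Λ 0 = Complex.log (r 0) := by
  obtain ⟨f, ⟨hf0, hf⟩, -⟩ := Complex.isCoveringMapOn_exp.existsUnique_continuousMap_lifts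
    (⟨r, hr⟩ : C(ℝ, ℂ)) (a₀ := 0) (Complex.exp_log (h0 0)) (fun x => h0 x)
  exact ⟨f, f.continuous, fun x => congrFun hf x, hf0⟩

/-- The height profile of an arc over `[0, 5/4]`: a tent that rises with slope `1` on `[0, 9/8]`,
falls with slope `-9` on `[9/8, 5/4]`, and vanishes elsewhere. -/
noncomputable def tent (t : ℝ) : ℝ := max 0 (min t (9 * (5 / 4 - t)))

theorem continuous_tent : Continuous tent := by unfold tent; fun_prop

theorem tent_of_le_one {t : ℝ} (h0 : 0 ≤ t) (h1 : t ≤ 1) : tent t = t := by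
  rw [tent, min_eq_left (by linarith), max_eq_right h0]

theorem one_le_tent {t : ℝ} (h0 : 1 ≤ t) (h1 : t ≤ 9 / 8) : 1 ≤ tent t :=
  le_max_of_le_right (le_min h0 (by linarith))

theorem tent_of_ge {t : ℝ} (h0 : 9 / 8 ≤ t) (h1 : t ≤ 5 / 4) : tent t = 9 * (5 / 4 - t) := by
  rw [tent, min_eq_right (by linarith), max_eq_right (by linarith)]

theorem tent_eq_zero {t : ℝ} (h : 5 / 4 ≤ t) : tent t = 0 :=
  max_eq_left ((min_le_right _ _).trans (by linarith))

/-- An arc may be replaced by any other arc with the same ends once it has been raised over the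
rest of the curve. At the height `M + u` with `u ≤ 1` the raised part of the curve consists of the
point `γ u` of the arc and of the point `γ (5 / 4 - u / 9)` of the descending leg. A twist about
the latter point carries `γ u` to `γ' u`; above the height `M + 1` its factor is `1`, although its
logarithm need not be `0`. -/
theorem isotopicSets_of_raised {γ γ' : ℝ → ℂ} {z : ℝ → ℝ} {M m : ℝ} (hγ : Continuous γ)
    (hγ' : Continuous γ') (hz : ∀ t ∈ Icc 0 (5 / 4), z t = M + tent t)
    (hzM : ∀ t ∈ Icc (5 / 4) m, z t ≤ M) (h0 : γ' 0 = γ 0) (h1 : ∀ t ∈ Icc 1 m, γ' t = γ t)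
    (hm : 5 / 4 ≤ m)
    (hne : ∀ s ∈ Icc (0 : ℝ) 1, ∀ t ∈ Icc (9 / 8 : ℝ) (5 / 4), γ s ≠ γ t ∧ γ' s ≠ γ t) :
    IsotopicSets (range fun t : Icc 0 m => (γ t, z t))
      (range fun t : Icc 0 m => (γ' t, z t)) := by
  let cl : ℝ → ℝ := fun u => max 0 (min u 1)
  have hcl : Continuous cl := by fun_prop
  have hcl01 : ∀ u, cl u ∈ Icc (0 : ℝ) 1 := fun u =>
    ⟨le_max_left _ _, max_le zero_le_one (min_le_right _ _)⟩
  have hcl_mem : ∀ u ∈ Icc (0 : ℝ) 1, cl u = u := fun u hu => by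
    simp only [cl]; rw [min_eq_left hu.2, max_eq_right hu.1]
  have hcl_ge : ∀ u, 1 ≤ u → cl u = 1 := fun u hu => by
    simp only [cl]; rw [min_eq_right hu, max_eq_right zero_le_one]
  have hcl_le : ∀ u, u ≤ 0 → cl u = 0 := fun u hu =>
    max_eq_left ((min_le_left _ _).trans hu)
  let q : ℝ → ℂ := fun u => γ (5 / 4 - u / 9)
  have hq : Continuous q := by fun_prop
  have hqne : ∀ u, γ (cl u) - q (cl u) ≠ 0 ∧ γ' (cl u) - q (cl u) ≠ 0 := fun u => by
    obtain ⟨ha, hb⟩ := hcl01 u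
    have := hne (cl u) ⟨ha, hb⟩ (5 / 4 - cl u / 9) ⟨by linarith, by linarith⟩
    exact ⟨sub_ne_zero.2 this.1, sub_ne_zero.2 this.2⟩
  obtain ⟨Λ, hΛ, hexp, hΛ0⟩ := exists_continuous_log
    (r := fun u => (γ' (cl u) - q (cl u)) / (γ (cl u) - q (cl u)))
    (Continuous.div (by fun_prop) (by fun_prop) fun u => (hqne u).1)
    (fun u => div_ne_zero (hqne u).2 (hqne u).1)
  have hΛ0' : Λ 0 = 0 := by
    rw [hΛ0, hcl_le 0 le_rfl, h0, div_self, Complex.log_one]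
    have := (hqne 0).1
    rwa [hcl_le 0 le_rfl] at this
  have hΛ1 : Complex.exp (Λ 1) = 1 := by
    rw [hexp, hcl_ge 1 le_rfl, h1 1 ⟨le_rfl, by linarith⟩, div_self]
    have := (hqne 1).1
    rwa [hcl_ge 1 le_rfl] at this
  refine isotopicSets_of_twist (Q := fun ζ => q (cl (ζ - M))) (Λ := fun ζ => Λ (cl (ζ - M)))
    (by fun_prop) (by fun_prop) ?_
  rintro ⟨t, ht0, htm⟩
  dsimp only
  rcases le_total t 1 with ht1 | ht1
  · rw [hz t ⟨ht0, by linarith⟩, tent_of_le_one ht0 ht1, add_sub_cancel_left,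
      hcl_mem t ⟨ht0, ht1⟩, hexp, hcl_mem t ⟨ht0, ht1⟩, mul_div_cancel₀, add_sub_cancel]
    have := (hqne t).1
    rwa [hcl_mem t ⟨ht0, ht1⟩] at this
  have hγt : γ' t = γ t := h1 t ⟨ht1, htm⟩
  rcases le_total t (5 / 4) with ht2 | ht2
  · rw [hz t ⟨ht0, ht2⟩, add_sub_cancel_left, hγt]
    rcases le_or_gt 1 (tent t) with h | h
    · rw [hcl_ge _ h, hΛ1]; ring
    · have ht3 : 9 / 8 ≤ t := by
        by_contra! hlt
        exact absurd (one_le_tent ht1 hlt.le) (not_le.2 h)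
      rw [tent_of_ge ht3 ht2] at h ⊢
      rw [hcl_mem _ ⟨by linarith, h.le⟩]
      have : q (9 * (5 / 4 - t)) = γ t := by simp only [q]; congr 1; ring
      rw [this]; ring
  · have : z t ≤ M := hzM t ⟨ht2, htm⟩
    rw [hcl_le _ (by linarith), hΛ0', hγt, Complex.exp_zero]; ring

/-- Every height function can be changed near the arc `[0, 5/4]` of the circle `[0, m]` so that
the arc is raised over the rest of the curve. -/
theorem exists_raised_height {z : ℝ → ℝ} {m : ℝ} (hm : 2 ≤ m) (hz : Continuous z) :
    ∃ (z' : ℝ → ℝ) (M : ℝ), Continuous z' ∧ (∀ t ∈ Icc 0 m, z t < M) ∧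
      (∀ t ∈ Icc 0 (5 / 4), z' t = M + tent t) ∧ (∀ t ∈ Icc (5 / 4) m, z' t ≤ M) ∧
      (∀ t ∈ Icc (3 / 2) (m - 1 / 2), z' t = z t) ∧ z' m = z' 0 := by
  obtain ⟨M, hM⟩ := (isCompact_Icc (a := (0 : ℝ)) (b := m)).bddAbove_image hz.continuousOn
  have hM' : ∀ t ∈ Icc 0 m, z t < M + 1 := fun t ht =>
    (hM (mem_image_of_mem z ht)).trans_lt (lt_add_one M)
  let χ : ℝ → ℝ := fun t => max 0 (min 1 (max (6 - 4 * t) (1 - 2 * (m - t))))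
  have hχ : Continuous χ := by fun_prop
  have hχ0 : ∀ t, 0 ≤ χ t := fun t => le_max_left _ _
  have hχ1 : ∀ t, χ t ≤ 1 := fun t => max_le zero_le_one (min_le_left _ _)
  have hχ_one : ∀ t, t ≤ 5 / 4 ∨ t = m → χ t = 1 := fun t ht => by
    have : 1 ≤ max (6 - 4 * t) (1 - 2 * (m - t)) := by
      rcases ht with ht | ht
      · exact le_max_of_le_left (by linarith)
      · exact le_max_of_le_right (by linarith)
    simp only [χ]
    rw [min_eq_left this, max_eq_right zero_le_one]
  have hχ_zero : ∀ t ∈ Icc (3 / 2) (m - 1 / 2), χ t = 0 := fun t ht =>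
    max_eq_left ((min_le_right _ _).trans (max_le (by linarith [ht.1]) (by linarith [ht.2])))
  refine ⟨fun t => (1 - χ t) * z t + χ t * (M + 1) + tent t, M + 1, ?_, hM', ?_, ?_, ?_, ?_⟩
  · have := continuous_tent
    fun_prop
  · intro t ht
    dsimp only
    rw [hχ_one t (Or.inl ht.2)]; ring
  · intro t ht
    have := hM' t ⟨by linarith [ht.1], ht.2⟩
    dsimp only
    rw [tent_eq_zero ht.1]
    nlinarith [hχ0 t, hχ1 t]
  · intro t ht
    dsimp only
    rw [tent_eq_zero (by linarith [ht.1]), hχ_zero t ht]; ring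
  · dsimp only
    rw [hχ_one m (Or.inr rfl), hχ_one 0 (Or.inl (by norm_num)), tent_eq_zero (by linarith),
      tent_of_le_one le_rfl zero_le_one]
    ring

theorem forall_Icc_of_forall_Ico {γ : ℝ → ℂ} {f : ℝ → ℝ} {m : ℝ} (hm : 0 < m)
    (hγm : γ m = γ 0) (hf : f m = f 0)
    (h : ∀ s ∈ Ico 0 m, ∀ t ∈ Ico 0 m, γ s = γ t → s ≠ t → f s = f t)
    (s t : Icc 0 m) (hst : γ s = γ t) : f s = f t := by
  obtain ⟨s, hs0, hsm⟩ := s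
  obtain ⟨t, ht0, htm⟩ := t
  dsimp only at *
  have key : ∀ x, 0 ≤ x → x ≤ m → ∃ y ∈ Ico 0 m, γ x = γ y ∧ f x = f y := fun x h0 h1 => by
    rcases eq_or_lt_of_le h1 with rfl | h1
    · exact ⟨0, ⟨le_rfl, hm⟩, hγm, hf⟩
    · exact ⟨x, ⟨h0, h1⟩, rfl, rfl⟩
  obtain ⟨s', hs', hγs, hfs⟩ := key s hs0 hsm
  obtain ⟨t', ht', hγt, hft⟩ := key t ht0 htm
  rw [hfs, hft]
  by_cases h' : s' = t'
  · rw [h']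
  · exact h s' hs' t' ht' (by rw [← hγs, hst, hγt]) h'

/-- A curve on the circle `[0, m]` may be changed on the arc `[0, 1]`, if the arc `[0, 1]` contains
no crossings before and after the change. -/
theorem isotopicSets_of_replace_arc {γ γ' : ℝ → ℂ} {z : ℝ → ℝ} {m : ℝ} (hm : 2 ≤ m)
    (hγ : Continuous γ) (hγ' : Continuous γ') (hz : Continuous z)
    (hγm : γ m = γ 0) (hγm' : γ' m = γ' 0) (hzm : z m = z 0) (h1 : ∀ t ∈ Icc 1 m, γ' t = γ t)
    (hc : ∀ s ∈ Ico 0 m, ∀ t ∈ Ico 0 m, γ s = γ t → s ≠ t → s ∈ Icc (3 / 2) (m - 1 / 2))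
    (hc' : ∀ s ∈ Ico 0 m, ∀ t ∈ Ico 0 m, γ' s = γ' t → s ≠ t → s ∈ Icc (3 / 2) (m - 1 / 2)) :
    IsotopicSets (range fun t : Icc 0 m => (γ t, z t))
      (range fun t : Icc 0 m => (γ' t, z t)) := by
  obtain ⟨z', M, hz', -, hz1, hz2, hz3, hzm'⟩ := exists_raised_height hm hz
  have h0 : γ' 0 = γ 0 := by rw [← hγm', ← hγm, h1 m ⟨by linarith, le_rfl⟩]
  have key : ∀ δ : ℝ → ℂ, Continuous δ → δ m = δ 0 →
      (∀ s ∈ Ico 0 m, ∀ t ∈ Ico 0 m, δ s = δ t → s ≠ t → s ∈ Icc (3 / 2) (m - 1 / 2)) →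
      IsotopicSets (range fun t : Icc 0 m => (δ t, z t))
        (range fun t : Icc 0 m => (δ t, z' t)) := fun δ hδ hδm hδc => by
    refine isotopicSets_of_forall_sub_eq (γ := fun t : Icc 0 m => δ t) (by fun_prop)
      (by fun_prop) (by fun_prop) ?_
    refine forall_Icc_of_forall_Ico (f := fun t => z' t - z t) (by linarith) hδm
      (by simp [hzm, hzm']) ?_
    intro s hs t ht hst hne
    simp only [hz3 s (hδc s hs t ht hst hne), hz3 t (hδc t ht s hs hst.symm hne.symm), sub_self]
  refine (key γ hγ hγm hc).trans (IsotopicSets.trans ?_ (key γ' hγ' hγm' hc').symm)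
  refine isotopicSets_of_raised hγ hγ' hz1 hz2 h0 h1 (by linarith) ?_
  intro s hs t ht
  have hs' : s ∈ Ico 0 m := ⟨hs.1, by linarith [hs.2]⟩
  have ht' : t ∈ Ico 0 m := ⟨by linarith [ht.1], by linarith [ht.2]⟩
  have hlt : s < t := by linarith [hs.2, ht.1]
  have hne : s ≠ t := hlt.ne
  refine ⟨fun h => ?_, fun h => ?_⟩
  · linarith [(hc s hs' t ht' h hne).1, hs.2]
  · rw [← h1 t ⟨by linarith [ht.1], ht'.2.le⟩] at h
    linarith [(hc' s hs' t ht' h hne).1, hs.2]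

/-- A curve on the circle `[0, 2]` whose only crossings are between the point `3 / 2` and points
of the arc `(0, 1)` that lie over it is isotopic to a planar curve. -/
theorem isotopicSets_planar_of_over {γ γ' : ℝ → ℂ} {z : ℝ → ℝ}
    (hγ : Continuous γ) (hγ' : Continuous γ') (hz : Continuous z)
    (hγm : γ 2 = γ 0) (hγm' : γ' 2 = γ' 0) (hzm : z 2 = z 0) (h1 : ∀ t ∈ Icc 1 2, γ' t = γ t)
    (a : ℝ) (ha : a ∈ Ioo (0 : ℝ) 1)
    (hc : ∀ s ∈ Ico (0 : ℝ) 2, ∀ t ∈ Ico (0 : ℝ) 2, γ s = γ t → s < t →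
      s = a ∧ t = 3 / 2 ∧ z t < z s)
    (hc' : ∀ s ∈ Ico (0 : ℝ) 2, ∀ t ∈ Ico (0 : ℝ) 2, γ' s = γ' t → s = t) :
    IsotopicSets (range fun t : Icc (0 : ℝ) 2 => (γ t, z t))
      (range fun t : Icc (0 : ℝ) 2 => (γ' t, (0 : ℝ))) := by
  obtain ⟨z', M, hz', hzM, hz1, hz2, hz3, hzm'⟩ := exists_raised_height le_rfl hz
  have h0 : γ' 0 = γ 0 := by rw [← hγm', ← hγm, h1 2 ⟨by linarith, le_rfl⟩]
  -- the affine map that fixes the height of the lower strand and lifts the other one as required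
  obtain ⟨κ, hκ, hκa⟩ : ∃ κ : ℝ, 0 < κ ∧ (z (3 / 2) < z a →
      z (3 / 2) + κ * (z a - z (3 / 2)) = z' a) := by
    by_cases h : z (3 / 2) < z a
    · have h' : z (3 / 2) < z' a := by
        rw [hz1 a ⟨ha.1.le, by linarith [ha.2]⟩, tent_of_le_one ha.1.le ha.2.le]
        linarith [hzM (3 / 2) ⟨by norm_num, by norm_num⟩, ha.1]
      refine ⟨(z' a - z (3 / 2)) / (z a - z (3 / 2)), div_pos (by linarith) (by linarith),
        fun _ => ?_⟩
      rw [div_mul_cancel₀ _ (sub_ne_zero.2 h.ne')]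
      ring
    · exact ⟨1, one_pos, fun h' => absurd h' h⟩
  have e1 := isotopicSets_of_affine_height (fun t : Icc (0 : ℝ) 2 => γ t) (fun t => z t)
    (z₀ := z (3 / 2)) hκ
  have e2 : IsotopicSets
      (range fun t : Icc (0 : ℝ) 2 => (γ t, z (3 / 2) + κ * (z t - z (3 / 2))))
      (range fun t : Icc (0 : ℝ) 2 => (γ t, z' t)) := by
    refine isotopicSets_of_forall_sub_eq (γ := fun t : Icc (0 : ℝ) 2 => γ t) (by fun_prop)
      (by fun_prop) (by fun_prop) ?_
    refine forall_Icc_of_forall_Ico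
      (f := fun t => z' t - (z (3 / 2) + κ * (z t - z (3 / 2)))) two_pos hγm
      (by simp [hzm, hzm']) ?_
    have key : ∀ s ∈ Ico (0 : ℝ) 2, ∀ t ∈ Ico (0 : ℝ) 2, γ s = γ t → s < t →
        z' s - (z (3 / 2) + κ * (z s - z (3 / 2))) =
          z' t - (z (3 / 2) + κ * (z t - z (3 / 2))) := by
      intro s hs t ht hst hlt
      obtain ⟨rfl, rfl, h⟩ := hc s hs t ht hst hlt
      rw [hκa h, hz3 (3 / 2) ⟨by norm_num, by norm_num⟩]
      ring
    intro s hs t ht hst hne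
    rcases lt_or_gt_of_ne hne with h | h
    · exact key s hs t ht hst h
    · exact (key t ht s hs hst.symm h).symm
  have e3 : IsotopicSets (range fun t : Icc (0 : ℝ) 2 => (γ t, z' t))
      (range fun t : Icc (0 : ℝ) 2 => (γ' t, z' t)) := by
    refine isotopicSets_of_raised hγ hγ' hz1 hz2 h0 h1 (by norm_num) ?_
    intro s hs t ht
    have hs' : s ∈ Ico (0 : ℝ) 2 := ⟨hs.1, by linarith [hs.2]⟩
    have ht' : t ∈ Ico (0 : ℝ) 2 := ⟨by linarith [ht.1], by linarith [ht.2]⟩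
    have hlt : s < t := by linarith [hs.2, ht.1]
    refine ⟨fun h => ?_, fun h => ?_⟩
    · linarith [(hc s hs' t ht' h hlt).2.1, ht.2]
    · rw [← h1 t ⟨by linarith [ht.1], ht'.2.le⟩] at h
      exact hlt.ne (hc' s hs' t ht' h)
  have e4 : IsotopicSets (range fun t : Icc (0 : ℝ) 2 => (γ' t, z' t))
      (range fun t : Icc (0 : ℝ) 2 => (γ' t, (0 : ℝ))) := by
    refine isotopicSets_of_forall_sub_eq (γ := fun t : Icc (0 : ℝ) 2 => γ' t) (by fun_prop)
      (by fun_prop) (by fun_prop) ?_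
    refine forall_Icc_of_forall_Ico (f := fun t => 0 - z' t) two_pos hγm' (by simp [hzm']) ?_
    exact fun s hs t ht hst hne => absurd (hc' s hs t ht hst) hne
  exact e1.trans (e2.trans (e3.trans e4))

/-! ### Loops in the plane and their enclosed regions -/

/-- The loop `γ` on `[a, b]` does not wind around the point `q`: the function `γ - q` has a
continuous logarithm with equal values at `a` and `b`. -/
def HasClosedLog (γ : ℝ → ℂ) (a b : ℝ) (q : ℂ) : Prop :=
  ∃ ℓ : ℝ → ℂ, ContinuousOn ℓ (Icc a b) ∧ (∀ t ∈ Icc a b, Complex.exp (ℓ t) = γ t - q) ∧ ℓ a = ℓ b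

section ClosedLog

variable {γ : ℝ → ℂ} {a b : ℝ}

theorem mem_slitPlane_of_norm_sub_one_lt {w : ℂ} (h : ‖w - 1‖ < 1) : w ∈ Complex.slitPlane := by
  left
  have := (Complex.abs_re_le_norm (w - 1)).trans_lt h
  rw [Complex.sub_re, Complex.one_re, abs_lt] at this
  linarith

/-- Close to a point, the winding of a loop does not change: the quotient of `γ - q'` and `γ - q`
has values in the slit plane, where the principal logarithm is continuous. -/
theorem HasClosedLog.of_norm_sub_lt (hγ : Continuous γ) (hγab : γ a = γ b) {q q' : ℂ}
    (h : HasClosedLog γ a b q) (hq : ∀ t ∈ Icc a b, ‖q' - q‖ < ‖γ t - q‖) :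
    HasClosedLog γ a b q' := by
  obtain ⟨ℓ, hℓ, hexp, hℓab⟩ := h
  have hne : ∀ t ∈ Icc a b, γ t - q ≠ 0 := fun t ht => by
    have := (norm_nonneg _).trans_lt (hq t ht)
    exact norm_pos_iff.1 this
  have hslit : ∀ t ∈ Icc a b, (γ t - q') / (γ t - q) ∈ Complex.slitPlane := fun t ht => by
    apply mem_slitPlane_of_norm_sub_one_lt
    rw [div_sub_one (hne t ht), norm_div, div_lt_one (norm_pos_iff.2 (hne t ht))]
    have : γ t - q' - (γ t - q) = -(q' - q) := by ring
    rw [this, norm_neg]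
    exact hq t ht
  refine ⟨fun t => ℓ t + Complex.log ((γ t - q') / (γ t - q)), ?_, fun t ht => ?_, ?_⟩
  · refine hℓ.add (ContinuousOn.clog ?_ hslit)
    exact ContinuousOn.div (by fun_prop) (by fun_prop) hne
  · rw [Complex.exp_add, hexp t ht, Complex.exp_log (Complex.slitPlane_ne_zero (hslit t ht)),
      mul_div_cancel₀ _ (hne t ht)]
  · dsimp only
    rw [hℓab, hγab]

/-- A loop does not wind around distant points. -/
theorem HasClosedLog.of_norm_lt (hγ : Continuous γ) (hγab : γ a = γ b) {q : ℂ} (hq0 : q ≠ 0)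
    (hq : ∀ t ∈ Icc a b, ‖γ t‖ < ‖q‖) : HasClosedLog γ a b q := by
  have hslit : ∀ t ∈ Icc a b, 1 - γ t / q ∈ Complex.slitPlane := fun t ht => by
    apply mem_slitPlane_of_norm_sub_one_lt
    rw [sub_sub_cancel_left, norm_neg, norm_div, div_lt_one (norm_pos_iff.2 hq0)]
    exact hq t ht
  refine ⟨fun t => Complex.log (-q) + Complex.log (1 - γ t / q), ?_, fun t ht => ?_, ?_⟩
  · exact continuousOn_const.add (ContinuousOn.clog (by fun_prop) hslit)
  · rw [Complex.exp_add, Complex.exp_log (neg_ne_zero.2 hq0),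
      Complex.exp_log (Complex.slitPlane_ne_zero (hslit t ht))]
    field_simp
    ring
  · simp [hγab]

theorem exists_pos_forall_le_norm_sub (hγ : Continuous γ) {q : ℂ} (hq : q ∉ γ '' Icc a b) :
    ∃ ε > 0, ∀ t ∈ Icc a b, ε ≤ ‖γ t - q‖ := by
  have hcl : IsClosed (γ '' Icc a b) := (isCompact_Icc.image hγ).isClosed
  obtain ⟨ε, hε, h⟩ := Metric.isOpen_iff.1 hcl.isOpen_compl q hq
  refine ⟨ε, hε, fun t ht => ?_⟩
  by_contra! hlt
  exact h (mem_ball_iff_norm.2 hlt) (mem_image_of_mem γ ht)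

/-- Whether a loop winds around a point does not change along connected sets that avoid it. -/
theorem HasClosedLog.of_isPreconnected (hγ : Continuous γ) (hγab : γ a = γ b)
    {S : Set ℂ} (hS : IsPreconnected S) (hSγ : Disjoint S (γ '' Icc a b)) {q q' : ℂ} (hq : q ∈ S)
    (hq' : q' ∈ S) (h : HasClosedLog γ a b q) : HasClosedLog γ a b q' := by
  by_contra hn
  have key : ∀ p ∉ γ '' Icc a b, ∃ ε > 0, ∀ p' ∈ Metric.ball p ε, p' ∉ γ '' Icc a b ∧
      (HasClosedLog γ a b p ↔ HasClosedLog γ a b p') := by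
    intro p hp
    obtain ⟨ε, hε, hle⟩ := exists_pos_forall_le_norm_sub hγ hp
    refine ⟨ε / 2, half_pos hε, fun p' hp' => ?_⟩
    rw [mem_ball_iff_norm] at hp'
    have hle' : ∀ t ∈ Icc a b, ε / 2 < ‖γ t - p'‖ := fun t ht => by
      have := norm_sub_norm_le (γ t - p) (p' - p)
      rw [sub_sub_sub_cancel_right] at this
      linarith [hle t ht]
    refine ⟨?_, fun h => h.of_norm_sub_lt hγ hγab fun t ht => ?_,
      fun h => h.of_norm_sub_lt hγ hγab fun t ht => ?_⟩
    · rintro ⟨t, ht, rfl⟩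
      have := hle' t ht
      simp only [sub_self, norm_zero] at this
      linarith
    · linarith [hle t ht]
    · rw [norm_sub_rev]
      linarith [hle' t ht]
  have hU : IsOpen {p | p ∉ γ '' Icc a b ∧ HasClosedLog γ a b p} := by
    refine Metric.isOpen_iff.2 fun p hp => ?_
    obtain ⟨ε, hε, hb⟩ := key p hp.1
    exact ⟨ε, hε, fun p' hp' => ⟨(hb p' hp').1, (hb p' hp').2.1 hp.2⟩⟩
  have hV : IsOpen {p | p ∉ γ '' Icc a b ∧ ¬ HasClosedLog γ a b p} := by
    refine Metric.isOpen_iff.2 fun p hp => ?_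
    obtain ⟨ε, hε, hb⟩ := key p hp.1
    exact ⟨ε, hε, fun p' hp' => ⟨(hb p' hp').1, fun h => hp.2 ((hb p' hp').2.2 h)⟩⟩
  have hav : ∀ p ∈ S, p ∉ γ '' Icc a b := fun p hp => Set.disjoint_left.1 hSγ hp
  obtain ⟨p, -, hp1, hp2⟩ := hS _ _ hU hV
    (fun p hp => (em (HasClosedLog γ a b p)).imp (fun h => ⟨hav p hp, h⟩) fun h => ⟨hav p hp, h⟩)
    ⟨q, hq, hav q hq, h⟩ ⟨q', hq', hav q' hq', hn⟩
  exact hp2.2 hp1.2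

/-- A point around which the loop winds lies in a bounded component of the complement. -/
theorem isBounded_connectedComponentIn_of_not_hasClosedLog (hγ : Continuous γ) (hab : a ≤ b)
    (hγab : γ a = γ b) {q : ℂ} (hq : q ∉ γ '' Icc a b) (h : ¬ HasClosedLog γ a b q) :
    Bornology.IsBounded (connectedComponentIn (γ '' Icc a b)ᶜ q) := by
  obtain ⟨R, hR⟩ :=
    (isCompact_Icc.image hγ : IsCompact (γ '' Icc a b)).isBounded.subset_closedBall 0
  refine (Metric.isBounded_closedBall (x := (0 : ℂ)) (r := R)).subset fun p hp => ?_
  by_contra hpR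
  rw [mem_closedBall_zero_iff, not_le] at hpR
  have hR' : ∀ t ∈ Icc a b, ‖γ t‖ < ‖p‖ := fun t ht =>
    (mem_closedBall_zero_iff.1 (hR (mem_image_of_mem γ ht))).trans_lt hpR
  have hp0 : p ≠ 0 := norm_pos_iff.1 ((norm_nonneg _).trans_lt (hR' a ⟨le_rfl, hab⟩))
  refine h ((HasClosedLog.of_norm_lt hγ hγab hp0 hR').of_isPreconnected hγ hγab
    isPreconnected_connectedComponentIn ?_ hp (mem_connectedComponentIn hq))
  exact Set.disjoint_left.2 fun x hx => connectedComponentIn_subset _ _ hx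

end ClosedLog

/-! ### Branches of a curve at a point -/

/-- Two plane vectors are linearly independent when the imaginary part of `x * conj y` does not
vanish. -/
theorem eq_zero_of_smul_add_smul_eq_zero {x y : ℂ} (hD : (x * (starRingEnd ℂ) y).im ≠ 0)
    {α β : ℝ} (h : (α : ℂ) * x + β * y = 0) : α = 0 ∧ β = 0 := by
  have hre := congrArg Complex.re h
  have him := congrArg Complex.im h
  simp at hre him hD
  constructor
  · apply mul_left_cancel₀ hD; linear_combination him * y.re - hre * y.im
  · apply mul_left_cancel₀ hD; linear_combination hre * x.im - him * x.re

/-- A point near a multiple of `x` is different from a point near a multiple of an element of a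
compact set that avoids the ray of `x`. -/
theorem exists_pos_forall_ne_of_disjoint_ray {x : ℂ} (hx : x ≠ 0) {K : Set ℂ} (hK : IsCompact K)
    (hKx : ∀ w ∈ K, ∀ r : ℝ, 0 ≤ r → w ≠ r * x) :
    ∃ ε > 0, ∀ s : ℝ, 0 < s → ∀ τ : ℝ, 0 ≤ τ → ∀ w ∈ K, ∀ g p : ℂ, ‖g - τ * x‖ ≤ ε * τ →
      ‖p - s * w‖ ≤ ε * s → g ≠ p := by
  have hF : IsClosed ((fun r : ℝ => r • x) '' Ici 0) :=
    (isClosedEmbedding_smul_left hx).isClosedMap _ isClosed_Ici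
  obtain ⟨c, hc, hcK⟩ := Metric.exists_pos_forall_lt_edist hK hF (Set.disjoint_left.2 (by
    rintro w hw ⟨r, hr, rfl⟩
    exact hKx _ hw r hr (by simp)))
  have hc' : ∀ w ∈ K, ∀ r : ℝ, 0 ≤ r → c ≤ ‖w - r * x‖ := fun w hw r hr => by
    have := (hcK w hw _ (mem_image_of_mem _ hr)).le
    rw [edist_nndist, ENNReal.coe_le_coe, ← NNReal.coe_le_coe, coe_nndist, dist_eq_norm] at this
    simpa using this
  obtain ⟨W, hW⟩ := hK.isBounded.subset_closedBall 0
  have hW' : ∀ w ∈ K, ‖w‖ ≤ |W| := fun w hw =>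
    (mem_closedBall_zero_iff.1 (hW hw)).trans (le_abs_self W)
  have hx' : 0 < ‖x‖ := norm_pos_iff.2 hx
  have hc0 : (0 : ℝ) < c := hc
  set B : ℝ := 1 + 2 * (|W| + 1) / ‖x‖ with hB
  have hB1 : 1 ≤ B := by rw [hB]; have := abs_nonneg W; simp; positivity
  refine ⟨min (min (‖x‖ / 2) 1) (c / (2 * B)), by positivity, ?_⟩
  intro s hs τ hτ w hw g p hg hp hgp
  set ε := min (min (‖x‖ / 2) 1) (c / (2 * B))
  have hε0 : 0 < ε := by positivity
  have hε1 : ε ≤ ‖x‖ / 2 := (min_le_left _ _).trans (min_le_left _ _)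
  have hε2 : ε ≤ 1 := (min_le_left _ _).trans (min_le_right _ _)
  have hε3 : ε * (2 * B) ≤ c := (le_div_iff₀ (by positivity)).1 (min_le_right _ _)
  subst hgp
  have h1 : τ * ‖x‖ ≤ ε * τ + ε * s + s * |W| := by
    have e : (τ : ℂ) * x = -(g - τ * x) + (g - s * w) + s * w := by ring
    have n1 : ‖(τ : ℂ) * x‖ = τ * ‖x‖ := by
      rw [norm_mul, Complex.norm_real, Real.norm_of_nonneg hτ]
    have n2 : ‖(s : ℂ) * w‖ = s * ‖w‖ := by
      rw [norm_mul, Complex.norm_real, Real.norm_of_nonneg hs.le]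
    rw [← n1, e]
    refine (norm_add₃_le).trans ?_
    rw [norm_neg, n2]
    have := mul_le_mul_of_nonneg_left (hW' w hw) hs.le
    linarith
  have h2 : τ ≤ s * (B - 1) := by
    have : s * (B - 1) = 2 * (s * (|W| + 1)) / ‖x‖ := by rw [hB]; ring
    rw [this, le_div_iff₀ hx']
    nlinarith
  have h3 : s * c ≤ ε * τ + ε * s := by
    have e : (s : ℂ) * (w - (τ / s : ℝ) * x) = (g - τ * x) - (g - s * w) := by
      have : (s : ℂ) ≠ 0 := Complex.ofReal_ne_zero.2 hs.ne'
      push_cast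
      field_simp
      ring
    have n1 := congrArg norm e
    rw [norm_mul, Complex.norm_real, Real.norm_of_nonneg hs.le] at n1
    have := mul_le_mul_of_nonneg_left (hc' w hw (τ / s) (by positivity)) hs.le
    have := norm_sub_le (g - τ * x) (g - s * w)
    linarith
  have h4 : ε * τ ≤ ε * (s * (B - 1)) := mul_le_mul_of_nonneg_left h2 hε0.le
  have h5 : s * (ε * (2 * B)) ≤ s * c := mul_le_mul_of_nonneg_left hε3 hs.le
  have h6 : 0 < s * (ε * B) := by positivity
  nlinarith

open Filter

/-- A differentiable function of one variable stays close to its tangent. -/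
theorem exists_pos_forall_norm_sub_le {σ : ℝ → ℂ} {e : ℂ} {a : ℝ} (hσ : HasDerivAt σ e a) {ε : ℝ}
    (hε : 0 < ε) : ∃ δ > 0, ∀ s, |s| < δ → ‖σ (a + s) - σ a - s * e‖ ≤ ε * |s| := by
  have := (hasDerivAt_iff_isLittleO_nhds_zero.1 hσ).def hε
  obtain ⟨δ, hδ, h⟩ := Metric.eventually_nhds_iff.1 this
  exact ⟨δ, hδ, fun s hs => by simpa using h (by simpa using hs)⟩

section Sector

variable {γ : ℝ → ℂ} {a b : ℝ} {o x y : ℂ}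

/-- Near its base point, a loop stays away from segments between branches of directions other
than those of its own ends. -/
theorem eventually_disjoint_segment_loop (hγ : Continuous γ) (hγa : γ a = o)
    (hγb : γ b = o) (hγo : ∀ t ∈ Ioo a b, γ t ≠ o) (hx : HasDerivAt γ x a)
    (hy : HasDerivAt γ (-y) b) (hx0 : x ≠ 0) (hy0 : y ≠ 0) {σ : ℝ → ℂ} {e v : ℂ} (hσ0 : σ 0 = o)
    (hσ : HasDerivAt σ e 0) (hKx : ∀ w ∈ segment ℝ e v, ∀ r : ℝ, 0 ≤ r → w ≠ r * x)
    (hKy : ∀ w ∈ segment ℝ e v, ∀ r : ℝ, 0 ≤ r → w ≠ r * y) :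
    ∀ᶠ s : ℝ in 𝓝[>] 0, Disjoint (segment ℝ (σ s) (o + s * v)) (γ '' Icc a b) := by
  have hK : IsCompact (segment ℝ e v) := by
    rw [segment_eq_image]
    exact isCompact_Icc.image (by fun_prop)
  obtain ⟨ε₁, hε₁, h₁⟩ := exists_pos_forall_ne_of_disjoint_ray hx0 hK hKx
  obtain ⟨ε₂, hε₂, h₂⟩ := exists_pos_forall_ne_of_disjoint_ray hy0 hK hKy
  obtain ⟨δ₁, hδ₁, hd₁⟩ := exists_pos_forall_norm_sub_le hx hε₁
  obtain ⟨δ₂, hδ₂, hd₂⟩ := exists_pos_forall_norm_sub_le hy hε₂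
  obtain ⟨δ, hδ, hd⟩ := exists_pos_forall_norm_sub_le hσ (lt_min hε₁ hε₂)
  have hmid : o ∉ γ '' Icc (a + δ₁ / 2) (b - δ₂ / 2) := by
    rintro ⟨t, ht, hto⟩
    exact hγo t ⟨by linarith [ht.1], by linarith [ht.2]⟩ hto
  obtain ⟨r, hr, hrmid⟩ := exists_pos_forall_le_norm_sub hγ hmid
  obtain ⟨W, hW⟩ := hK.isBounded.subset_closedBall 0
  have hW' : ∀ w ∈ segment ℝ e v, ‖w‖ ≤ |W| := fun w hw =>
    (mem_closedBall_zero_iff.1 (hW hw)).trans (le_abs_self W)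
  have hlim : ∀ᶠ s : ℝ in 𝓝[>] 0, s * (|W| + min ε₁ ε₂) < r := by
    have : Tendsto (fun s : ℝ => s * (|W| + min ε₁ ε₂)) (𝓝[>] 0) (𝓝 (0 * (|W| + min ε₁ ε₂))) :=
      ((continuous_id.mul continuous_const).tendsto 0).mono_left nhdsWithin_le_nhds
    rw [zero_mul] at this
    exact this.eventually (gt_mem_nhds hr)
  filter_upwards [hlim, Ioo_mem_nhdsGT hδ] with s hs1 hs2
  obtain ⟨hs0, hsδ⟩ := hs2
  refine Set.disjoint_left.2 ?_
  rintro p ⟨α, β, hα, hβ, hαβ, rfl⟩ ⟨t, ht, htp⟩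
  have hds := hd s (by rwa [abs_of_pos hs0])
  rw [zero_add, abs_of_pos hs0, hσ0] at hds
  set w : ℂ := α • e + β • v with hw
  have hwK : w ∈ segment ℝ e v := ⟨α, β, hα, hβ, hαβ, rfl⟩
  have hα1 : α ≤ 1 := by linarith
  have hpw : ‖γ t - o - s * w‖ ≤ min ε₁ ε₂ * s := by
    have e1 : γ t - o - s * w = α * (σ s - o - s * e) := by
      have : (α : ℂ) + β = 1 := by exact_mod_cast hαβ
      rw [htp, hw]
      simp only [Complex.real_smul]
      linear_combination o * this
    rw [e1, norm_mul, Complex.norm_real, Real.norm_of_nonneg hα]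
    exact (mul_le_of_le_one_left (norm_nonneg _) hα1).trans hds
  have hpo : ‖γ t - o‖ < r := by
    have : γ t - o = (γ t - o - s * w) + s * w := by ring
    rw [this]
    refine (norm_add_le _ _).trans_lt (lt_of_le_of_lt ?_ hs1)
    rw [norm_mul, Complex.norm_real, Real.norm_of_nonneg hs0.le]
    nlinarith [hW' w hwK]
  rcases lt_or_ge (t - a) δ₁ with hta | hta
  · have h := hd₁ (t - a) (by rwa [abs_of_nonneg (sub_nonneg.2 ht.1)])
    rw [add_sub_cancel, abs_of_nonneg (sub_nonneg.2 ht.1), hγa] at h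
    exact h₁ s hs0 (t - a) (sub_nonneg.2 ht.1) w hwK _ _ h
      (hpw.trans (mul_le_mul_of_nonneg_right (min_le_left _ _) hs0.le)) rfl
  rcases lt_or_ge (b - t) δ₂ with htb | htb
  · have h := hd₂ (t - b) (by rw [abs_sub_comm, abs_of_nonneg (sub_nonneg.2 ht.2)]; exact htb)
    rw [add_sub_cancel, abs_sub_comm, abs_of_nonneg (sub_nonneg.2 ht.2), hγb] at h
    have e1 : γ t - o - ((t - b : ℝ) : ℂ) * -y = γ t - o - ((b - t : ℝ) : ℂ) * y := by
      push_cast; ring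
    rw [e1] at h
    exact h₂ s hs0 (b - t) (sub_nonneg.2 ht.2) w hwK _ _ h
      (hpw.trans (mul_le_mul_of_nonneg_right (min_le_right _ _) hs0.le)) rfl
  · linarith [hrmid t ⟨by linarith, by linarith⟩]

/-- A loop winds around at least one of two points close to its base point that lie in the two
sectors bounded by its ends. Otherwise the quotient of `γ - (o + s m)` and `γ - (o - s m)`, where
`m` points into the sector between the ends, would have a logarithm with equal values at both
ends. This quotient is `-1` at the base point, it leaves and returns to `-1` through opposite
half-planes, and it meets the negative real axis only at the base point. -/
theorem eventually_not_hasClosedLog (hab : a < b) (hγ : Continuous γ) (hγa : γ a = o)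
    (hγb : γ b = o) (hγo : ∀ t ∈ Ioo a b, γ t ≠ o) (hx : HasDerivAt γ x a)
    (hy : HasDerivAt γ (-y) b) (hD : (x * (starRingEnd ℂ) y).im ≠ 0) :
    ∀ᶠ s : ℝ in 𝓝[>] 0,
      ¬ (HasClosedLog γ a b (o + s * (x + y)) ∧ HasClosedLog γ a b (o + s * (-(x + y)))) := by
  set m := x + y with hm
  -- `I t` vanishes when `γ t - o` is a real multiple of `m`
  let I : ℝ → ℝ := fun t => ((γ t - o) * (starRingEnd ℂ) m).im
  have hI : Continuous I := by
    have : Continuous fun t => (γ t - o) * (starRingEnd ℂ) m := by fun_prop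
    exact Complex.continuous_im.comp this
  have hIderiv : ∀ {c : ℝ} {d : ℂ}, HasDerivAt γ d c →
      HasDerivAt I ((d * (starRingEnd ℂ) m).im) c := fun h =>
    (Complex.imCLM.hasFDerivAt.comp_hasDerivAt _ ((h.sub_const o).mul_const _))
  set D := (x * (starRingEnd ℂ) y).im with hDdef
  have hIa : HasDerivAt I D a := by
    convert hIderiv hx using 1
    simp [hDdef, hm]; ring
  have hIb : HasDerivAt I D b := by
    convert hIderiv hy using 1
    simp [hDdef, hm]; ring
  have hIa0 : I a = 0 := by simp [I, hγa]
  have hIb0 : I b = 0 := by simp [I, hγb]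
  -- the sign of `I` near the ends
  have hsgn : ∀ᶠ τ : ℝ in 𝓝[>] 0, 0 < D * I (a + τ) ∧ D * I (b - τ) < 0 := by
    have key : ∀ c, HasDerivAt I D c → I c = 0 → ∃ δ > 0, ∀ τ, τ ≠ 0 → |τ| < δ →
        0 < τ * (D * I (c + τ)) := by
      intro c hc hc0
      have := (hasDerivAt_iff_isLittleO_nhds_zero.1 hc).def (half_pos (abs_pos.2 hD))
      obtain ⟨δ, hδ, h⟩ := Metric.eventually_nhds_iff.1 this
      refine ⟨δ, hδ, fun τ hτ hτδ => ?_⟩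
      have h' := h (y := τ) (by simpa using hτδ)
      simp only [hc0, sub_zero, smul_eq_mul, Real.norm_eq_abs] at h'
      have h1 : -(|D| / 2 * |τ|) ≤ I (c + τ) - τ * D ∧ I (c + τ) - τ * D ≤ |D| / 2 * |τ| :=
        abs_le.1 h'
      have h2 : |τ * D| * |I (c + τ) - τ * D| ≤ |τ * D| * (|D| / 2 * |τ|) :=
        mul_le_mul_of_nonneg_left h' (abs_nonneg _)
      have h3 : -(|τ * D| * |I (c + τ) - τ * D|) ≤ (τ * D) * (I (c + τ) - τ * D) := by
        rw [← abs_mul]; exact neg_abs_le _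
      have h4 : |τ * D| * (|D| / 2 * |τ|) = (τ * D) ^ 2 / 2 := by
        rw [← sq_abs (τ * D), abs_mul]; ring
      have h5 : 0 < (τ * D) ^ 2 := by positivity
      nlinarith
    obtain ⟨δ₁, hδ₁, h₁⟩ := key a hIa hIa0
    obtain ⟨δ₂, hδ₂, h₂⟩ := key b hIb hIb0
    filter_upwards [Ioo_mem_nhdsGT (lt_min hδ₁ hδ₂)] with τ hτ
    have hτ1 := h₁ τ hτ.1.ne' (by rw [abs_of_pos hτ.1]; exact hτ.2.trans_le (min_le_left _ _))
    have hτ2 := h₂ (-τ) (neg_ne_zero.2 hτ.1.ne')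
      (by rw [abs_neg, abs_of_pos hτ.1]; exact hτ.2.trans_le (min_le_right _ _))
    refine ⟨pos_of_mul_pos_right hτ1 hτ.1.le, ?_⟩
    rw [← sub_eq_add_neg] at hτ2
    nlinarith [hτ.1]
  obtain ⟨δ, hδ0, hδ⟩ := mem_nhdsGT_iff_exists_Ioo_subset.1 hsgn
  replace hδ0 : 0 < δ := hδ0
  have hmid : o ∉ γ '' Icc (a + δ / 2) (b - δ / 2) := by
    rintro ⟨t, ht, hto⟩
    exact hγo t ⟨by linarith [ht.1], by linarith [ht.2]⟩ hto
  obtain ⟨r, hr, hrmid⟩ := exists_pos_forall_le_norm_sub hγ hmid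
  have hm0 : m ≠ 0 := fun h => by
    apply hD
    rw [hDdef, eq_neg_of_add_eq_zero_left (hm.symm.trans h)]
    simp; ring
  have hlim : ∀ᶠ s : ℝ in 𝓝[>] 0, s * ‖m‖ < r := by
    have : Tendsto (fun s : ℝ => s * ‖m‖) (𝓝[>] 0) (𝓝 (0 * ‖m‖)) :=
      ((continuous_id.mul continuous_const).tendsto 0).mono_left nhdsWithin_le_nhds
    rw [zero_mul] at this
    exact this.eventually (gt_mem_nhds hr)
  filter_upwards [hlim, self_mem_nhdsWithin] with s hsr hs
  replace hs : 0 < s := hs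
  rintro ⟨⟨ℓ₁, hℓ₁, hexp₁, h₁ab⟩, ⟨ℓ₂, hℓ₂, hexp₂, h₂ab⟩⟩
  let k : ℝ → ℝ := fun t => (ℓ₁ t - ℓ₂ t).im
  have hk : ContinuousOn k (Icc a b) := Complex.continuous_im.comp_continuousOn (hℓ₁.sub hℓ₂)
  have hkab : k b = k a := by simp only [k, h₁ab, h₂ab]
  have hexp : ∀ t ∈ Icc a b, Complex.exp (ℓ₁ t - ℓ₂ t) * (γ t - o + s * m) = γ t - o - s * m := by
    intro t ht
    have h2 : γ t - o + s * m ≠ 0 := by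
      have := Complex.exp_ne_zero (ℓ₂ t)
      rw [hexp₂ t ht] at this
      convert this using 1
      ring
    rw [Complex.exp_sub, hexp₁ t ht, hexp₂ t ht]
    have e2 : γ t - (o + s * -m) = γ t - o + s * m := by ring
    rw [e2, div_mul_cancel₀ _ h2]
    ring
  set θ := k a with hθ
  have hE : ∀ t, Complex.exp (ℓ₁ t - ℓ₂ t) =
      Real.exp (ℓ₁ t - ℓ₂ t).re * (Real.cos (k t) + Real.sin (k t) * Complex.I) := fun t => by
    rw [Complex.exp_eq_exp_re_mul_sin_add_cos]
    push_cast
    rfl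
  have hsin : ∀ t ∈ Icc a b, ∃ ρ : ℝ, 0 ≤ ρ ∧ Real.sin (k t) * ρ = I t := by
    intro t ht
    refine ⟨Real.exp (ℓ₁ t - ℓ₂ t).re * Complex.normSq (γ t - o + s * m) / (2 * s),
      by have := Complex.normSq_nonneg (γ t - o + s * m); positivity, ?_⟩
    have h1 := congrArg (fun w => (w * (starRingEnd ℂ) (γ t - o + s * m)).im) (hexp t ht)
    rw [mul_assoc, Complex.mul_conj, hE] at h1
    have h2 : ((γ t - o - s * m) * (starRingEnd ℂ) (γ t - o + s * m)).im = 2 * s * I t := by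
      simp [I]; ring
    rw [h2] at h1
    generalize Complex.normSq (γ t - o + s * m) = n at h1 ⊢
    generalize Real.exp (ℓ₁ t - ℓ₂ t).re = E at h1 ⊢
    generalize Real.cos (k t) = c at h1
    generalize Real.sin (k t) = d at h1 ⊢
    simp at h1
    field_simp
    linarith
  have hcosθ : Real.cos θ < 0 ∧ Real.sin θ = 0 := by
    have h1 := hexp a ⟨le_rfl, hab.le⟩
    have hsm : (s : ℂ) * m ≠ 0 := mul_ne_zero (Complex.ofReal_ne_zero.2 hs.ne') hm0
    rw [hγa, sub_self, zero_add, zero_sub, ← neg_one_mul] at h1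
    have h2 := mul_right_cancel₀ hsm h1
    rw [hE] at h2
    have hpos := Real.exp_pos (ℓ₁ a - ℓ₂ a).re
    generalize Real.exp (ℓ₁ a - ℓ₂ a).re = ρ at h2 hpos
    rw [← hθ] at h2
    generalize Real.cos θ = c at h2 ⊢
    generalize Real.sin θ = d at h2 ⊢
    have hre := congrArg Complex.re h2
    have him := congrArg Complex.im h2
    simp at hre him
    refine ⟨?_, him.resolve_left hpos.ne'⟩
    by_contra! h
    nlinarith [mul_nonneg hpos.le h]
  have hside : ∀ t ∈ Icc a b, |k t - θ| < Real.pi →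
      (0 < D * I t → D * (k t - θ) < 0) ∧ (D * I t < 0 → 0 < D * (k t - θ)) := by
    intro t ht hlt
    obtain ⟨ρ, hρ, hρI⟩ := hsin t ht
    have e1 : Real.sin (k t) = Real.cos θ * Real.sin (k t - θ) := by
      conv_lhs => rw [← add_sub_cancel θ (k t), Real.sin_add, hcosθ.2, zero_mul, zero_add]
    rw [abs_lt] at hlt
    rw [← hρI, e1]
    rcases lt_trichotomy (k t - θ) 0 with h | h | h
    · have hs' := Real.sin_neg_of_neg_of_neg_pi_lt h hlt.1
      have h7 : 0 < Real.cos θ * Real.sin (k t - θ) := mul_pos_of_neg_of_neg hcosθ.1 hs'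
      have h8 : 0 ≤ Real.cos θ * Real.sin (k t - θ) * ρ := mul_nonneg h7.le hρ
      refine ⟨fun h9 => ?_, fun h9 => ?_⟩
      · have := pos_of_mul_pos_left h9 h8
        exact mul_neg_of_pos_of_neg this h
      · have : D < 0 := by by_contra! hD0; linarith [mul_nonneg hD0 h8]
        exact mul_pos_of_neg_of_neg this h
    · rw [h]; simp
    · have hs' := Real.sin_pos_of_pos_of_lt_pi h hlt.2
      have h7 : Real.cos θ * Real.sin (k t - θ) < 0 := mul_neg_of_neg_of_pos hcosθ.1 hs'
      have h8 : Real.cos θ * Real.sin (k t - θ) * ρ ≤ 0 := mul_nonpos_of_nonpos_of_nonneg h7.le hρ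
      refine ⟨fun h9 => ?_, fun h9 => ?_⟩
      · have : D < 0 := by by_contra! hD0; linarith [mul_nonpos_of_nonneg_of_nonpos hD0 h8]
        exact mul_neg_of_neg_of_pos this h
      · have : 0 < D := by by_contra! hD0; linarith [mul_nonneg_of_nonpos_of_nonpos hD0 h8]
        exact mul_pos this h
  -- points near the two ends, where `k` lies on different sides of its value at the ends
  have hclose : ∀ c ∈ Icc a b, k c = θ → ∃ η > 0, ∀ t ∈ Icc a b, |t - c| < η →
      |k t - θ| < Real.pi := by
    intro c hc hkc
    obtain ⟨η, hη, h⟩ := Metric.continuousWithinAt_iff.1 (hk c hc) Real.pi Real.pi_pos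
    exact ⟨η, hη, fun t ht htc => by simpa [Real.dist_eq, hkc] using h ht htc⟩
  obtain ⟨η₁, hη₁, hc₁⟩ := hclose a ⟨le_rfl, hab.le⟩ rfl
  obtain ⟨η₂, hη₂, hc₂⟩ := hclose b ⟨hab.le, le_rfl⟩ hkab
  obtain ⟨τ, hτ0, hτ⟩ : ∃ τ : ℝ, 0 < τ ∧ τ < min (min δ ((b - a) / 2)) (min η₁ η₂) :=
    exists_between (by have : 0 < b - a := sub_pos.2 hab; positivity)
  simp only [lt_min_iff] at hτ
  obtain ⟨⟨hτδ, hτab⟩, hτ1, hτ2⟩ := hτ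
  have hIτ : 0 < D * I (a + τ) ∧ D * I (b - τ) < 0 := hδ ⟨hτ0, hτδ⟩
  have ht1 : a + τ ∈ Icc a b := ⟨by linarith, by linarith⟩
  have ht2 : b - τ ∈ Icc a b := ⟨by linarith, by linarith⟩
  have hs1 := (hside _ ht1 (hc₁ _ ht1 (by simpa [abs_of_pos hτ0] using hτ1))).1 hIτ.1
  have hs2 := (hside _ ht2 (hc₂ _ ht2 (by simpa [abs_of_pos hτ0] using hτ2))).2 hIτ.2
  have hsub : Icc (a + τ) (b - τ) ⊆ Icc a b := Icc_subset_Icc ht1.1 ht2.2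
  obtain ⟨t, ht, htk⟩ : (0 : ℝ) ∈ (fun t => D * (k t - θ)) '' Icc (a + τ) (b - τ) := by
    apply intermediate_value_Icc (by linarith)
    · exact continuousOn_const.mul ((hk.mono hsub).sub continuousOn_const)
    · exact ⟨hs1.le, hs2.le⟩
  have hkt : k t = θ := sub_eq_zero.1 ((mul_eq_zero.1 htk).resolve_left hD)
  have hIt : I t = 0 := by
    obtain ⟨ρ, -, hρ⟩ := hsin t (hsub ht)
    rw [← hρ, hkt, hcosθ.2, zero_mul]
  have hvr : ‖γ t - o‖ < r := by
    have h1 := hexp t (hsub ht)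
    rw [hE, hkt, hcosθ.2, Complex.ofReal_zero, zero_mul, add_zero, ← Complex.ofReal_mul] at h1
    set ρ := Real.exp (ℓ₁ t - ℓ₂ t).re * Real.cos θ
    have hρ : ρ < 0 := mul_neg_of_pos_of_neg (Real.exp_pos _) hcosθ.1
    have h2 : ((1 - ρ : ℝ) : ℂ) * (γ t - o) = ((1 + ρ : ℝ) : ℂ) * (s * m) := by
      push_cast
      linear_combination -h1
    have h3 := congrArg norm h2
    rw [norm_mul, norm_mul, norm_mul, Complex.norm_real, Complex.norm_real, Complex.norm_real,
      Real.norm_of_nonneg hs.le, Real.norm_of_nonneg (by linarith : 0 ≤ 1 - ρ)] at h3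
    have h4 : ‖1 + ρ‖ ≤ 1 - ρ := by rw [Real.norm_eq_abs, abs_le]; constructor <;> linarith
    have h5 : (1 - ρ) * ‖γ t - o‖ ≤ (1 - ρ) * (s * ‖m‖) := by
      rw [h3]; exact mul_le_mul_of_nonneg_right h4 (by positivity)
    exact (le_of_mul_le_mul_left h5 (by linarith)).trans_lt hsr
  have hIne : ∀ τ ∈ Ioo 0 δ, I (a + τ) ≠ 0 ∧ I (b - τ) ≠ 0 := fun τ hτ => by
    obtain ⟨h1, h2⟩ := hδ hτ
    refine ⟨fun h => ?_, fun h => ?_⟩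
    · rw [h, mul_zero] at h1; exact lt_irrefl _ h1
    · rw [h, mul_zero] at h2; exact lt_irrefl _ h2
  rcases lt_or_ge t (a + δ / 2) with h | h
  · have := (hIne (t - a) ⟨by linarith [ht.1], by linarith⟩).1
    rw [add_sub_cancel] at this
    exact this hIt
  rcases lt_or_ge (b - δ / 2) t with h' | h'
  · have := (hIne (b - t) ⟨by linarith [ht.2], by linarith⟩).2
    rw [sub_sub_cancel] at this
    exact this hIt
  · linarith [hrmid t ⟨h, h'⟩]

end Sector

/-! ### Passages of a curve through its crossing point -/

/-- A periodic locally finite set of reals is enumerated by the integers in increasing order. -/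
theorem exists_strictMono_enumeration {Z : Set ℝ} (hne : Z.Nonempty)
    (hfin : ∀ a b, (Z ∩ Icc a b).Finite) (hper : ∀ x, x + 1 ∈ Z ↔ x ∈ Z) :
    ∃ (t : ℤ → ℝ) (p : ℕ), 0 < p ∧ StrictMono t ∧ (∀ x, x ∈ Z ↔ ∃ i, t i = x) ∧
      ∀ i, t (i + p) = t i + 1 := by
  classical
  have : Nonempty Z := hne.to_subtype
  have : NoMaxOrder Z := ⟨fun x => ⟨⟨x + 1, (hper x).2 x.2⟩, by
    rw [← Subtype.coe_lt_coe]; exact lt_add_one _⟩⟩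
  have : NoMinOrder Z := ⟨fun x => ⟨⟨x - 1, (hper _).1 (by simp)⟩, by
    rw [← Subtype.coe_lt_coe]; exact sub_one_lt _⟩⟩
  let _ : LocallyFiniteOrder Z := LocallyFiniteOrder.ofFiniteIcc fun a b => by
    refine Set.Finite.of_finite_image ((hfin a b).subset ?_) Subtype.val_injective.injOn
    rintro _ ⟨x, hx, rfl⟩
    exact ⟨x.2, hx⟩
  let _ : SuccOrder Z := LinearLocallyFiniteOrder.succOrder Z
  let _ : PredOrder Z := LinearLocallyFiniteOrder.predOrder Z
  let e : Z ≃o ℤ := orderIsoIntOfLinearSuccPredArch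
  let shift : Z ≃o Z :=
    { toFun := fun x => ⟨x + 1, (hper x).2 x.2⟩
      invFun := fun x => ⟨x - 1, (hper _).1 (by simp)⟩
      left_inv := fun x => by simp
      right_inv := fun x => by simp
      map_rel_iff' := by
        intro x y
        rw [← Subtype.coe_le_coe, ← Subtype.coe_le_coe]
        simp }
  let σ : ℤ ≃o ℤ := (e.symm.trans shift).trans e
  have hσ1 : ∀ i, σ (i + 1) = σ i + 1 := fun i => by
    have := σ.map_succ i
    simpa using this
  have hσ : ∀ i, σ i = i + σ 0 := fun i => by
    induction i using Int.induction_on with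
    | zero => simp
    | succ i ih => rw [hσ1, ih]; ring
    | pred i ih =>
      have := hσ1 (-(i : ℤ) - 1)
      rw [sub_add_cancel, ih] at this
      linarith
  have hesymm : ∀ i, e.symm (σ i) = shift (e.symm i) := fun i => by simp [σ]
  have hσ0 : 0 < σ 0 := by
    have h : e.symm 0 < e.symm (σ 0) := by
      rw [hesymm, ← Subtype.coe_lt_coe]
      exact lt_add_one _
    simpa using h
  refine ⟨fun i => e.symm i, (σ 0).toNat, by omega, fun i j hij => ?_, fun x => ?_, fun i => ?_⟩
  · exact e.symm.strictMono hij
  · exact ⟨fun hx => ⟨e ⟨x, hx⟩, by simp⟩, by rintro ⟨i, rfl⟩; exact (e.symm i).2⟩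
  · rw [Int.toNat_of_nonneg hσ0.le, ← hσ]
    dsimp only
    rw [hesymm]
    rfl

/-- A closed planar curve `γ` of period `1` that passes through `o` at the times `t i`, `i : ℤ`,
with velocities `d i`, and has no other crossings. There are `p` passages in a period; any two of
them have linearly independent velocities. -/
structure IsPetalCurve (γ : ℝ → ℂ) (o : ℂ) (p : ℕ) (t : ℤ → ℝ) (d : ℤ → ℂ) : Prop where
  continuous : Continuous γ
  periodic : Function.Periodic γ 1
  pos : 0 < p
  strictMono : StrictMono t
  eq_iff : ∀ x, γ x = o ↔ ∃ i, t i = x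
  t_add : ∀ i, t (i + p) = t i + 1
  injective : ∀ s x, γ s = γ x → γ s ≠ o → ∃ n : ℤ, x = s + n
  hasDerivAt : ∀ i, HasDerivAt γ (d i) (t i)
  d_ne_zero : ∀ i, d i ≠ 0
  d_periodic : Function.Periodic d p
  transversal : ∀ i j, ¬ (p : ℤ) ∣ j - i → (d i * (starRingEnd ℂ) (d j)).im ≠ 0

theorem Function.Periodic.eq_of_dvd {X : Type*} {f : ℤ → X} {p : ℤ} (hf : Function.Periodic f p)
    {i j : ℤ} (h : p ∣ j - i) : f j = f i := by
  obtain ⟨k, hk⟩ := h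
  have := hf.int_mul k i
  rw [← this]
  congr 1
  push_cast
  linarith

namespace IsPetalCurve

variable {γ : ℝ → ℂ} {o : ℂ} {p : ℕ} {t : ℤ → ℝ} {d : ℤ → ℂ} (h : IsPetalCurve γ o p t d)
include h

theorem apply_t (i : ℤ) : γ (t i) = o := (h.eq_iff _).2 ⟨i, rfl⟩

theorem t_add_mul (i k : ℤ) : t (i + k * p) = t i + k := by
  induction k using Int.induction_on with
  | zero => simp
  | succ k ih =>
    have := h.t_add (i + k * p)
    rw [ih] at this
    rw [add_mul, one_mul, ← add_assoc, this]
    push_cast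
    ring
  | pred k ih =>
    have := h.t_add (i + (-(k : ℤ) - 1) * p)
    have e : i + (-(k : ℤ) - 1) * p + p = i + -(k : ℤ) * p := by ring
    rw [e, ih] at this
    push_cast at this ⊢
    linarith

theorem apply_ne {i : ℤ} {x : ℝ} (hx : x ∈ Ioo (t i) (t (i + 1))) : γ x ≠ o := by
  rw [Ne, h.eq_iff]
  rintro ⟨j, rfl⟩
  have h1 := h.strictMono.lt_iff_lt.1 hx.1
  have h2 := h.strictMono.lt_iff_lt.1 hx.2
  omega

/-- Different loops meet only at the crossing point. -/
theorem apply_notMem_loop {i j : ℤ} (hij : ¬ (p : ℤ) ∣ j - i) {x : ℝ}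
    (hx : x ∈ Ioo (t j) (t (j + 1))) : γ x ∉ γ '' Icc (t i) (t (i + 1)) := by
  rintro ⟨y, hy, hyx⟩
  obtain ⟨n, rfl⟩ := h.injective x y hyx.symm (h.apply_ne hx)
  have h1 : t (j + n * p) < t (i + 1) := by
    rw [h.t_add_mul]; linarith [hx.1, hy.2]
  have h2 : t i < t (j + 1 + n * p) := by
    rw [h.t_add_mul]; linarith [hx.2, hy.1]
  have h1' := h.strictMono.lt_iff_lt.1 h1
  have h2' := h.strictMono.lt_iff_lt.1 h2
  exact hij ⟨-n, by linarith [mul_comm n (p : ℤ)]⟩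

/-- If a loop winds around a point of another one, it encloses it. -/
theorem loop_subset_enclosedRegion {i j : ℤ} (hij : ¬ (p : ℤ) ∣ j - i) {x : ℝ}
    (hx : x ∈ Ioo (t j) (t (j + 1))) (hlog : ¬ HasClosedLog γ (t i) (t (i + 1)) (γ x)) :
    γ '' Icc (t j) (t (j + 1)) ⊆ enclosedRegion (γ '' Icc (t i) (t (i + 1))) := by
  have hlt : t i < t (i + 1) := h.strictMono (lt_add_one i)
  have hγi : γ (t i) = γ (t (i + 1)) := by rw [h.apply_t, h.apply_t]
  rintro _ ⟨y, hy, rfl⟩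
  by_cases hyo : γ y = o
  · left
    rw [hyo, ← h.apply_t i]
    exact mem_image_of_mem γ ⟨le_rfl, hlt.le⟩
  have hyI : y ∈ Ioo (t j) (t (j + 1)) := by
    refine ⟨lt_of_le_of_ne hy.1 ?_, lt_of_le_of_ne hy.2 ?_⟩
    · rintro rfl; exact hyo (h.apply_t _)
    · rintro rfl; exact hyo (h.apply_t _)
  refine Or.inr ⟨h.apply_notMem_loop hij hyI, ?_⟩
  have hdisj : Disjoint (γ '' Ioo (t j) (t (j + 1))) (γ '' Icc (t i) (t (i + 1))) :=
    Set.disjoint_left.2 (by rintro _ ⟨w, hw, rfl⟩; exact h.apply_notMem_loop hij hw)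
  refine isBounded_connectedComponentIn_of_not_hasClosedLog h.continuous hlt.le hγi
    (h.apply_notMem_loop hij hyI) fun hy' => hlog ?_
  exact hy'.of_isPreconnected h.continuous hγi
    (isPreconnected_Ioo.image γ h.continuous.continuousOn) hdisj (mem_image_of_mem γ hyI)
    (mem_image_of_mem γ hx)

/-- If no loop encloses another one, then the two ends of a loop are adjacent among the branches at
the crossing point: the convex cone between them contains no direction `± d j`. A branch in this
cone belongs to a second loop, and the branch opposite to the start of the loop belongs to a third
loop on the other side; the loop winds around one of these. -/
theorem ne_add_of_not_nested (hp : 2 ≤ p)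
    (hn : ∀ i j, ¬ (p : ℤ) ∣ j - i →
      ¬ γ '' Icc (t j) (t (j + 1)) ⊆ enclosedRegion (γ '' Icc (t i) (t (i + 1))))
    (i j : ℤ) {ε : ℝ} (hε : ε = 1 ∨ ε = -1) {α β : ℝ} (hα : 0 < α) (hβ : 0 < β) :
    (ε : ℂ) * d j ≠ α * d i + β * -d (i + 1) := by
  intro he
  have hlt : ∀ k, t k < t (k + 1) := fun k => h.strictMono (lt_add_one k)
  have hγi : γ (t i) = γ (t (i + 1)) := by rw [h.apply_t, h.apply_t]
  have hD : (d i * (starRingEnd ℂ) (-d (i + 1))).im ≠ 0 := by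
    have := h.transversal i (i + 1) (by
      rw [add_sub_cancel_left]
      intro hdvd
      have := Int.le_of_dvd one_pos hdvd
      omega)
    rw [map_neg, mul_neg, Complex.neg_im]
    exact neg_ne_zero.2 this
  have hind : ∀ {α β : ℝ}, (α : ℂ) * d i + β * -d (i + 1) = 0 → α = 0 ∧ β = 0 :=
    fun h => eq_zero_of_smul_add_smul_eq_zero hD h
  have hj0 : ¬ (p : ℤ) ∣ j - i := fun hdvd => by
    rw [h.d_periodic.eq_of_dvd hdvd] at he
    have := @hind (ε - α) (-β) (by push_cast; linear_combination he)
    linarith [this.2]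
  have hj1 : ¬ (p : ℤ) ∣ j - 1 - i := fun hdvd => by
    have : d j = d (i + 1) := h.d_periodic.eq_of_dvd (by convert hdvd using 1; ring)
    rw [this] at he
    have := @hind (-α) (-ε - β) (by push_cast; linear_combination he)
    linarith [this.1]
  have hi1 : ¬ (p : ℤ) ∣ i - 1 - i := fun hdvd => by
    rw [sub_sub_cancel_left, dvd_neg] at hdvd
    have := Int.le_of_dvd one_pos hdvd
    omega
  -- no loop other than the `i`-th is wound around
  have hlog : ∀ k, ¬ (p : ℤ) ∣ k - i → ∀ x ∈ Ioo (t k) (t (k + 1)),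
      HasClosedLog γ (t i) (t (i + 1)) (γ x) := fun k hk x hx => by
    by_contra hx'
    exact hn i k hk (h.loop_subset_enclosedRegion hk hx hx')
  have hder : ∀ (k : ℤ) (ε : ℝ), HasDerivAt (fun s : ℝ => γ (t k + ε * s)) (ε * d k) 0 := by
    intro k ε
    have h1 : HasDerivAt (fun s : ℝ => t k + ε * s) ε 0 := by
      simpa using ((hasDerivAt_id (0 : ℝ)).const_mul ε).const_add (t k)
    have h2 : HasDerivAt γ (d k) (t k + ε * 0) := by simpa using h.hasDerivAt k
    have h3 := h2.scomp 0 h1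
    rw [Complex.real_smul] at h3
    exact h3
  have hx0 := h.d_ne_zero i
  have hy0 : -d (i + 1) ≠ 0 := neg_ne_zero.2 (h.d_ne_zero _)
  have hσ : ∀ (k : ℤ) (ε : ℝ), (fun s : ℝ => γ (t k + ε * s)) 0 = o := fun k ε => by
    simp [h.apply_t]
  have evA := eventually_disjoint_segment_loop (v := d i + -d (i + 1)) h.continuous (h.apply_t i)
    (h.apply_t (i + 1)) (fun x hx => h.apply_ne hx) (h.hasDerivAt i)
    (by simpa using h.hasDerivAt (i + 1)) hx0 hy0 (hσ j ε) (hder j ε) (by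
      rintro w ⟨a, b, ha, hb, hab, rfl⟩ r hr hw
      rw [he] at hw
      have := @hind (a * α + b - r) (a * β + b)
        (by simp only [Complex.real_smul] at hw; push_cast; linear_combination hw)
      nlinarith [this.2, mul_nonneg ha hβ.le]) (by
      rintro w ⟨a, b, ha, hb, hab, rfl⟩ r hr hw
      rw [he] at hw
      have := @hind (a * α + b) (a * β + b - r)
        (by simp only [Complex.real_smul] at hw; push_cast; linear_combination hw)
      nlinarith [this.1, mul_nonneg ha hα.le])
  have evB := eventually_disjoint_segment_loop (v := -(d i + -d (i + 1))) h.continuous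
    (h.apply_t i) (h.apply_t (i + 1)) (fun x hx => h.apply_ne hx) (h.hasDerivAt i)
    (by simpa using h.hasDerivAt (i + 1)) hx0 hy0 (hσ i (-1)) (hder i (-1)) (by
      rintro w ⟨a, b, ha, hb, hab, rfl⟩ r hr hw
      have := @hind (-a - b - r) (-b)
        (by simp only [Complex.real_smul] at hw; push_cast at hw ⊢; linear_combination hw)
      linarith [this.1, this.2]) (by
      rintro w ⟨a, b, ha, hb, hab, rfl⟩ r hr hw
      have := @hind (-a - b) (-b - r)
        (by simp only [Complex.real_smul] at hw; push_cast at hw ⊢; linear_combination hw)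
      linarith [this.1, this.2])
  have evC := eventually_not_hasClosedLog (hlt i) h.continuous (h.apply_t i)
    (h.apply_t (i + 1)) (fun x hx => h.apply_ne hx) (h.hasDerivAt i)
    (by simpa using h.hasDerivAt (i + 1)) hD
  have evS : ∀ k, ∀ᶠ s : ℝ in 𝓝[>] 0, s < t (k + 1) - t k := fun k =>
    Filter.mem_of_superset (Ioo_mem_nhdsGT (sub_pos.2 (hlt k))) fun s hs => hs.2
  obtain ⟨s, hA, hB, hC, hsj, hsj', hsi, hs⟩ := (evA.and (evB.and (evC.and ((evS j).and
    ((evS (j - 1)).and ((evS (i - 1)).and self_mem_nhdsWithin)))))).exists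
  replace hs : 0 < s := hs
  rw [sub_add_cancel] at hsj' hsi
  have hmem : ∀ k, s < t k - t (k - 1) → t k + (-1 : ℝ) * s ∈ Ioo (t (k - 1)) (t (k - 1 + 1)) :=
    fun k hk => ⟨by linarith, by rw [sub_add_cancel]; linarith⟩
  refine hC ⟨?_, ?_⟩
  · have h1 : HasClosedLog γ (t i) (t (i + 1)) (γ (t j + ε * s)) := by
      rcases hε with rfl | rfl
      · exact hlog j hj0 _ ⟨by linarith, by linarith⟩
      · exact hlog (j - 1) hj1 _ (hmem j hsj')
    exact h1.of_isPreconnected h.continuous hγi (convex_segment _ _).isPreconnected hA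
      (left_mem_segment _ _ _) (right_mem_segment _ _ _)
  · have h1 := hlog (i - 1) hi1 _ (hmem i hsi)
    exact h1.of_isPreconnected h.continuous hγi (convex_segment _ _).isPreconnected hB
      (left_mem_segment _ _ _) (right_mem_segment _ _ _)

end IsPetalCurve

/-! ### Piecewise linear interpolation -/

theorem continuous_of_continuousOn_Icc_int {X : Type*} [TopologicalSpace X] {f : ℝ → X}
    (h : ∀ n : ℤ, ContinuousOn f (Icc (n : ℝ) (n + 1))) : Continuous f := by
  have hlf : LocallyFinite fun n : ℤ => Icc (n : ℝ) (n + 1) := by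
    intro x
    refine ⟨Ioo (x - 1) (x + 1), Ioo_mem_nhds (by linarith) (by linarith), ?_⟩
    refine (finite_Icc (⌊x⌋ - 2) (⌊x⌋ + 2)).subset ?_
    rintro n ⟨y, hy1, hy2⟩
    have h1 := Int.floor_le x
    have h2 := Int.lt_floor_add_one x
    constructor
    · have : (⌊x⌋ : ℝ) - 2 < n + 1 := by linarith [hy1.2, hy2.1]
      have : ⌊x⌋ - 2 < n + 1 := by exact_mod_cast this
      omega
    · have : (n : ℝ) < ⌊x⌋ + 2 := by linarith [hy1.1, hy2.2]
      have : n < ⌊x⌋ + 2 := by exact_mod_cast this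
      omega
  refine hlf.continuous ?_ (fun _ => isClosed_Icc) h
  refine eq_univ_of_forall fun x => mem_iUnion.2 ⟨⌊x⌋, Int.floor_le x, (Int.lt_floor_add_one x).le⟩

/-- The piecewise linear function with the values `V n` at the integers `n`. -/
noncomputable def polyline {E : Type*} [AddCommGroup E] [Module ℝ E] (V : ℤ → E) (x : ℝ) : E :=
  V ⌊x⌋ + (x - ⌊x⌋) • (V (⌊x⌋ + 1) - V ⌊x⌋)

section Polyline

variable {E : Type*} [AddCommGroup E] [Module ℝ E]

theorem polyline_apply (V : ℤ → E) {n : ℤ} {x : ℝ} (hx : x ∈ Icc (n : ℝ) (n + 1)) :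
    polyline V x = V n + (x - n) • (V (n + 1) - V n) := by
  rcases eq_or_lt_of_le hx.2 with rfl | hlt
  · have : ⌊(n : ℝ) + 1⌋ = n + 1 := by
      rw [Int.floor_add_one, Int.floor_intCast]
    simp [polyline, this]
  · rw [polyline, Int.floor_eq_iff.2 ⟨hx.1, hlt⟩]

theorem polyline_intCast (V : ℤ → E) (n : ℤ) : polyline V n = V n := by
  rw [polyline_apply V (n := n) ⟨le_rfl, by linarith⟩]
  simp

theorem polyline_add_intCast {V W : ℤ → E} {k : ℤ} (h : ∀ n, V (n + k) = W n) (x : ℝ) :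
    polyline V (x + k) = polyline W x := by
  have := h (⌊x⌋ + 1)
  rw [add_right_comm] at this
  simp [polyline, Int.floor_add_intCast, h, this]

theorem periodic_polyline {V : ℤ → E} {m : ℤ} (hV : Function.Periodic V m) :
    Function.Periodic (polyline V) m := fun x => polyline_add_intCast hV x

theorem map_polyline {F : Type*} [AddCommGroup F] [Module ℝ F] (L : E →ₗ[ℝ] F) (V : ℤ → E)
    (x : ℝ) : L (polyline V x) = polyline (fun n => L (V n)) x := by
  simp [polyline]

theorem continuous_polyline [TopologicalSpace E] [IsTopologicalAddGroup E] [ContinuousSMul ℝ E]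
    (V : ℤ → E) : Continuous (polyline V) := by
  refine continuous_of_continuousOn_Icc_int fun n => ?_
  refine ContinuousOn.congr (f := fun x : ℝ => V n + (x - n) • (V (n + 1) - V n)) ?_
    fun x hx => polyline_apply V hx
  fun_prop

end Polyline

theorem strictMono_polyline {V : ℤ → ℝ} (hV : StrictMono V) : StrictMono (polyline V) := by
  have key : ∀ x y : ℝ, x < y → y ≤ ⌊x⌋ + 1 → polyline V x < polyline V y := fun x y hxy hy => by
    have h1 := hV (lt_add_one ⌊x⌋)
    rw [polyline_apply V ⟨Int.floor_le x, by linarith⟩,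
      polyline_apply V ⟨(Int.floor_le x).trans hxy.le, hy⟩]
    simp only [smul_eq_mul]
    nlinarith
  intro x y hxy
  rcases le_or_gt y (⌊x⌋ + 1) with h | h
  · exact key x y hxy h
  · have h1 : polyline V x < V (⌊x⌋ + 1) := by
      have := key x (⌊x⌋ + 1) (Int.lt_floor_add_one x) le_rfl
      have e := polyline_intCast V (⌊x⌋ + 1)
      push_cast at e
      rwa [e] at this
    have h2 : V (⌊x⌋ + 1) ≤ V ⌊y⌋ := hV.monotone (Int.le_floor.2 (by push_cast; exact h.le))
    have h3 : V ⌊y⌋ ≤ polyline V y := by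
      have h4 := hV (lt_add_one ⌊y⌋)
      have h5 := Int.floor_le y
      rw [polyline, smul_eq_mul]
      nlinarith
    linarith

/-! ### Straightening the strands -/

/-- A displacement of the plane with a Lipschitz constant less than `1` is the final map of an
isotopy. -/
theorem exists_isotopy_of_lipschitzWith {f : ℂ → ℂ} {k : NNReal} (hk : k < 1)
    (hf : LipschitzWith k f) : ∃ H : unitInterval → (ℂ ≃ₜ ℂ),
      Continuous (fun p : unitInterval × ℂ => H p.1 p.2) ∧ (∀ w, H 0 w = w) ∧
        ∀ w, H 1 w = w + f w := by
  have hap : ∀ τ : unitInterval, ApproximatesLinearOn (fun w => w + (τ : ℝ) * f w)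
      ((ContinuousLinearEquiv.refl ℝ ℂ : ℂ ≃L[ℝ] ℂ) : ℂ →L[ℝ] ℂ) univ k := by
    intro τ x _ y _
    have e : x + (τ : ℝ) * f x - (y + (τ : ℝ) * f y) -
        ((ContinuousLinearEquiv.refl ℝ ℂ : ℂ ≃L[ℝ] ℂ) : ℂ →L[ℝ] ℂ) (x - y) =
          (τ : ℝ) * (f x - f y) := by
      simp; ring
    rw [e, norm_mul, Complex.norm_real, Real.norm_of_nonneg τ.2.1]
    exact (mul_le_of_le_one_left (norm_nonneg _) τ.2.2).trans (hf.norm_sub_le x y)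
  have hc : Subsingleton ℂ ∨ k < ‖((ContinuousLinearEquiv.refl ℝ ℂ : ℂ ≃L[ℝ] ℂ).symm :
      ℂ →L[ℝ] ℂ)‖₊⁻¹ := by
    right
    have : ((ContinuousLinearEquiv.refl ℝ ℂ : ℂ ≃L[ℝ] ℂ).symm : ℂ →L[ℝ] ℂ) =
      ContinuousLinearMap.id ℝ ℂ := rfl
    rw [this]
    simpa using hk
  refine ⟨fun τ => (hap τ).toHomeomorph _ hc, ?_, fun w => ?_, fun w => ?_⟩
  · change Continuous fun p : unitInterval × ℂ => p.2 + ((p.1 : ℝ) : ℂ) * f p.2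
    have := hf.continuous
    fun_prop
  · change w + ((0 : unitInterval) : ℝ) * f w = w
    simp
  · change w + ((1 : unitInterval) : ℝ) * f w = _
    simp

/-- An error `e` that is small relative to `v` is small relative to `v - e`. -/
theorem norm_le_mul_of_relative_error {v e : ℂ} {r ε C K : ℝ} (hK : 0 < K)
    (hε : ε * (C * (1 + K)) ≤ K) (hr : r ≤ C * ‖v‖) (hr0 : 0 ≤ r) (he : ‖e‖ ≤ ε * r) :
    ‖e‖ ≤ K * ‖v - e‖ := by
  have h1 := norm_sub_norm_le v e
  rcases le_or_gt ε 0 with hε0 | hε0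
  · nlinarith [norm_nonneg e, norm_nonneg (v - e)]
  · have h2 : ‖e‖ ≤ ε * (C * ‖v‖) := he.trans (mul_le_mul_of_nonneg_left hr hε0.le)
    have h3 : ε * (C * (1 + K)) * ‖v‖ ≤ K * ‖v‖ := mul_le_mul_of_nonneg_right hε (norm_nonneg v)
    nlinarith [norm_nonneg v]

namespace IsPetalCurve

variable {γ : ℝ → ℂ} {o : ℂ} {p : ℕ} {t : ℤ → ℝ} {d : ℤ → ℂ} (h : IsPetalCurve γ o p t d)
include h

theorem apply_t_add_of_dvd {i j : ℤ} (hij : (p : ℤ) ∣ j - i) (s : ℝ) :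
    γ (t j + s) = γ (t i + s) := by
  obtain ⟨k, hk⟩ := hij
  have : t j = t i + k := by rw [← h.t_add_mul]; congr 1; linarith [mul_comm k (p : ℤ)]
  rw [this, add_right_comm]
  simpa using h.periodic.int_mul k (t i + s)

/-- The displacement from the strands to their tangents has a small Lipschitz constant. For points
on different strands this uses that the tangents are transversal. -/
theorem exists_lipschitz_tangent (hs : ∀ i, HasStrictDerivAt γ (d i) (t i)) {K : ℝ} (hK : 0 < K) :
    ∃ δ > 0, ∀ i j, ∀ s x : ℝ, |s| ≤ δ → |x| ≤ δ →
      ‖(s * d i - γ (t i + s)) - (x * d j - γ (t j + x))‖ ≤ K * ‖γ (t i + s) - γ (t j + x)‖ := by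
  have hstrict : ∀ i, ∀ ε > 0, ∃ δ > 0, ∀ s x : ℝ, |s| ≤ δ → |x| ≤ δ →
      ‖γ (t i + s) - γ (t i + x) - (s - x : ℝ) * d i‖ ≤ ε * |s - x| := by
    intro i ε hε
    have := (hasStrictFDerivAt_iff_isLittleO.1 (hs i).hasStrictFDerivAt).def hε
    obtain ⟨δ, hδ, hb⟩ := Metric.eventually_nhds_iff.1 this
    refine ⟨δ / 2, half_pos hδ, fun s x hs hx => ?_⟩
    have := hb (y := (t i + s, t i + x)) (by
      rw [Prod.dist_eq]
      refine max_lt ?_ ?_ <;> simp <;> linarith)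
    simpa using this
  have hpair : ∀ i j, ∃ δ > 0, ∀ s x : ℝ, |s| ≤ δ → |x| ≤ δ →
      ‖(s * d i - γ (t i + s)) - (x * d j - γ (t j + x))‖ ≤
        K * ‖γ (t i + s) - γ (t j + x)‖ := by
    intro i j
    by_cases hij : (p : ℤ) ∣ j - i
    · have hd : 0 < ‖d i‖ := norm_pos_iff.2 (h.d_ne_zero i)
      obtain ⟨δ, hδ, hb⟩ := hstrict i (K / (‖d i‖⁻¹ * (1 + K))) (by positivity)
      refine ⟨δ, hδ, fun s x hs hx => ?_⟩
      rw [h.apply_t_add_of_dvd hij, h.d_periodic.eq_of_dvd hij]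
      have h1 := norm_le_mul_of_relative_error (v := (s - x : ℝ) * d i) (r := |s - x|)
        (C := ‖d i‖⁻¹) (e := (s - x : ℝ) * d i - (γ (t i + s) - γ (t i + x)))
        hK (div_mul_cancel₀ K (by positivity)).le (by
          rw [norm_mul, Complex.norm_real, Real.norm_eq_abs, mul_comm |s - x|,
            inv_mul_cancel_left₀ hd.ne']) (abs_nonneg _)
        (by rw [norm_sub_rev]; exact hb s x hs hx)
      rw [sub_sub_cancel] at h1
      convert h1 using 2
      push_cast
      ring
    · have hD := h.transversal i j hij
      set D := (d i * (starRingEnd ℂ) (d j)).im with hDdef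
      have hD0 : 0 < |D| := abs_pos.2 hD
      have hdi : 0 < ‖d i‖ := norm_pos_iff.2 (h.d_ne_zero i)
      have hdj : 0 < ‖d j‖ := norm_pos_iff.2 (h.d_ne_zero j)
      set C := (‖d i‖ + ‖d j‖) / |D| with hC
      have hC0 : 0 < C := by positivity
      obtain ⟨δ₁, hδ₁, hb₁⟩ := hstrict i (K / (C * (1 + K))) (by positivity)
      obtain ⟨δ₂, hδ₂, hb₂⟩ := hstrict j (K / (C * (1 + K))) (by positivity)
      refine ⟨min δ₁ δ₂, lt_min hδ₁ hδ₂, fun s x hs hx => ?_⟩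
      have e1 := hb₁ s 0 (hs.trans (min_le_left _ _)) (by simpa using hδ₁.le)
      have e2 := hb₂ x 0 (hx.trans (min_le_right _ _)) (by simpa using hδ₂.le)
      rw [add_zero, h.apply_t, sub_zero] at e1 e2
      have hv : |s| + |x| ≤ C * ‖(s : ℂ) * d i - x * d j‖ := by
        set v := (s : ℂ) * d i - x * d j with hvdef
        have f1 : |s| * |D| ≤ ‖v‖ * ‖d j‖ := by
          have : s * D = (v * (starRingEnd ℂ) (d j)).im := by
            simp [hvdef, hDdef]; ring
          rw [← abs_mul, this, ← Complex.norm_conj (d j), ← norm_mul]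
          exact Complex.abs_im_le_norm _
        have f2 : |x| * |D| ≤ ‖v‖ * ‖d i‖ := by
          have : x * D = (v * (starRingEnd ℂ) (d i)).im := by
            simp [hvdef, hDdef]; ring
          rw [← abs_mul, this, ← Complex.norm_conj (d i), ← norm_mul]
          exact Complex.abs_im_le_norm _
        rw [hC, div_mul_eq_mul_div, le_div_iff₀ hD0]
        linarith
      have h1 := norm_le_mul_of_relative_error (v := (s : ℂ) * d i - x * d j) (r := |s| + |x|)
        (C := C)
        (e := ((s : ℂ) * d i - x * d j) - (γ (t i + s) - γ (t j + x)))
        hK (div_mul_cancel₀ K (by positivity)).le hv (by positivity) (by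
          have e3 : ((s : ℂ) * d i - x * d j) - (γ (t i + s) - γ (t j + x)) =
            (γ (t j + x) - o - (x : ℝ) * d j) - (γ (t i + s) - o - (s : ℝ) * d i) := by ring
          rw [e3, mul_add]
          refine (norm_sub_le _ _).trans ?_
          rw [add_comm]
          exact add_le_add e1 e2)
      rw [sub_sub_cancel] at h1
      convert h1 using 2
      ring
  choose δ hδ hb using hpair
  have hp := h.pos
  obtain ⟨δ₀, hδ₀, hle⟩ : ∃ δ₀ > 0, ∀ q ∈ Finset.Ico (0 : ℤ) p ×ˢ Finset.Ico (0 : ℤ) p,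
      δ₀ ≤ δ q.1 q.2 := by
    have hne : (Finset.Ico (0 : ℤ) p ×ˢ Finset.Ico (0 : ℤ) p).Nonempty :=
      ⟨(0, 0), by simp [hp]⟩
    exact ⟨_, (Finset.lt_inf'_iff hne).2 fun q _ => hδ q.1 q.2,
      fun q hq => Finset.inf'_le (fun q => δ q.1 q.2) hq⟩
  refine ⟨δ₀, hδ₀, fun i j s x hs hx => ?_⟩
  have hmod : ∀ k : ℤ, (p : ℤ) ∣ k - k % p := fun k => Int.dvd_self_sub_emod
  have hmem : ∀ k : ℤ, k % p ∈ Finset.Ico (0 : ℤ) p := fun k => by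
    rw [Finset.mem_Ico]
    exact ⟨Int.emod_nonneg _ (by omega), Int.emod_lt_of_pos _ (by omega)⟩
  have hq := hle (i % p, j % p) (Finset.mem_product.2 ⟨hmem i, hmem j⟩)
  rw [h.apply_t_add_of_dvd (hmod i), h.apply_t_add_of_dvd (hmod j),
    h.d_periodic.eq_of_dvd (hmod i), h.d_periodic.eq_of_dvd (hmod j)]
  exact hb _ _ s x (hs.trans hq) (hx.trans hq)

/-- An isotopy of the plane makes the strands straight near the crossing point. -/
theorem exists_straightening (hs : ∀ i, HasStrictDerivAt γ (d i) (t i)) :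
    ∃ H : unitInterval → (ℂ ≃ₜ ℂ), Continuous (fun p : unitInterval × ℂ => H p.1 p.2) ∧
      (∀ w, H 0 w = w) ∧ ∃ δ > 0, ∀ i, ∀ s : ℝ, |s| ≤ δ → H 1 (γ (t i + s)) = s * d i := by
  set L := lipschitzExtensionConstant ℂ with hL
  have hL0 : 0 < L := lipschitzExtensionConstant_pos ℂ
  obtain ⟨δ, hδ, hb⟩ := h.exists_lipschitz_tangent hs (K := (2 * L : NNReal)⁻¹) (by
    have : (0 : ℝ) < L := hL0
    push_cast
    positivity)
  let S : Set ℂ := {w | ∃ (i : ℤ) (s : ℝ), |s| ≤ δ ∧ γ (t i + s) = w}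
  choose! I s hsδ hsw using fun (w : ℂ) (hw : w ∈ S) => hw
  have hlip : LipschitzOnWith (2 * L)⁻¹ (fun w => s w * d (I w) - w) S := by
    refine LipschitzOnWith.of_dist_le_mul fun w hw w' hw' => ?_
    have := hb (I w) (I w') (s w) (s w') (hsδ w hw) (hsδ w' hw')
    rw [hsw w hw, hsw w' hw'] at this
    rwa [dist_eq_norm, dist_eq_norm]
  obtain ⟨f, hf, hfS⟩ := hlip.extend_finite_dimension
  obtain ⟨H, hH, hH0, hH1⟩ := exists_isotopy_of_lipschitzWith (k := L * (2 * L)⁻¹) (by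
    rw [mul_inv, mul_left_comm, mul_inv_cancel₀ hL0.ne', mul_one]
    rw [← NNReal.coe_lt_coe]
    push_cast
    norm_num) hf
  refine ⟨H, hH, hH0, δ, hδ, fun i x hx => ?_⟩
  have hw : γ (t i + x) ∈ S := ⟨i, x, hx, rfl⟩
  have h1 := hb (I (γ (t i + x))) i (s (γ (t i + x))) x (hsδ _ hw) hx
  rw [hsw _ hw, sub_self, norm_zero, mul_zero, norm_le_zero_iff] at h1
  rw [hH1, ← hfS hw]
  linear_combination h1

end IsPetalCurve

/-! ### The normal form of a petal curve -/

/-- The sequence `…, A 0, B 0, A 1, B 1, …`. -/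
def interleave {X : Type*} (A B : ℤ → X) (n : ℤ) : X := if n % 2 = 0 then A (n / 2) else B (n / 2)

section Interleave

variable {X : Type*} (A B : ℤ → X)

@[simp]
theorem interleave_two_mul (i : ℤ) : interleave A B (2 * i) = A i := by
  simp [interleave]

@[simp]
theorem interleave_two_mul_add_one (i : ℤ) : interleave A B (2 * i + 1) = B i := by
  have h1 : (2 * i + 1) % 2 = 1 := by omega
  have h2 : (2 * i + 1) / 2 = i := by omega
  simp [interleave, h1, h2]

@[simp]
theorem interleave_two_mul_add_two (i : ℤ) : interleave A B (2 * i + 1 + 1) = A (i + 1) := by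
  rw [← interleave_two_mul A B (i + 1)]
  congr 1
  ring

variable {A B}

theorem forall_int_of_interleave {P : ℤ → Prop} (h0 : ∀ i, P (2 * i)) (h1 : ∀ i, P (2 * i + 1))
    (n : ℤ) : P n := by
  obtain ⟨k, rfl | rfl⟩ := Int.even_or_odd' n
  · exact h0 k
  · exact h1 k

theorem interleave_add_two_mul {A' B' : ℤ → X} {k : ℤ} (hA : ∀ i, A (i + k) = A' i)
    (hB : ∀ i, B (i + k) = B' i) (n : ℤ) :
    interleave A B (n + 2 * k) = interleave A' B' n := by
  induction n using forall_int_of_interleave with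
  | h0 i => rw [← mul_add, interleave_two_mul, interleave_two_mul, hA]
  | h1 i =>
    have : 2 * i + 1 + 2 * k = 2 * (i + k) + 1 := by ring
    rw [this, interleave_two_mul_add_one, interleave_two_mul_add_one, hB]

end Interleave

/-- A planar curve with its only crossing at `0`, such that the `i`-th strand is the segment from
`-u i` to `u i`, parametrized by `[2i, 2i + 1]`, and the petal between the strands `i` and `i + 1`,
parametrized by `[2i + 1, 2i + 2]`, lies outside of the open unit disc. The directions `u i` are
unit vectors. -/
structure IsNormalPetalCurve (c : ℝ → ℂ) (p : ℕ) (u : ℤ → ℂ) : Prop where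
  continuous : Continuous c
  periodic : Function.Periodic c (2 * p : ℝ)
  pos : 0 < p
  norm_u : ∀ i, ‖u i‖ = 1
  u_periodic : Function.Periodic u p
  transversal : ∀ i j, ¬ (p : ℤ) ∣ j - i → (u i * (starRingEnd ℂ) (u j)).im ≠ 0
  strand : ∀ (i : ℤ), ∀ x ∈ Icc (2 * i : ℝ) (2 * i + 1), c x = (2 * x - 4 * i - 1 : ℝ) * u i
  petal : ∀ (i : ℤ), ∀ x ∈ Icc (2 * i + 1 : ℝ) (2 * i + 2), 1 ≤ ‖c x‖
  injective : ∀ s x, c s = c x → c s ≠ 0 → ∃ n : ℤ, x = s + n * (2 * p)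

theorem exists_pos_forall_le_of_periodic {f : ℤ → ℝ} {p : ℕ} (hp : 0 < p)
    (hf : Function.Periodic f p) (hpos : ∀ i, 0 < f i) : ∃ ε > 0, ∀ i, ε ≤ f i := by
  have hne : (Finset.Ico (0 : ℤ) p).Nonempty := ⟨0, by simp [hp]⟩
  refine ⟨_, (Finset.lt_inf'_iff hne).2 fun i _ => hpos i, fun i => ?_⟩
  rw [hf.eq_of_dvd (i := i % p) Int.dvd_self_sub_emod]
  refine Finset.inf'_le f ?_
  rw [Finset.mem_Ico]
  exact ⟨Int.emod_nonneg _ (by omega), Int.emod_lt_of_pos _ (by omega)⟩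

/-- Every petal curve can be brought into the normal form by an isotopy of the plane and a
reparametrization. -/
theorem IsPetalCurve.exists_normal_form {γ : ℝ → ℂ} {o : ℂ} {p : ℕ} {t : ℤ → ℝ} {d : ℤ → ℂ}
    (h : IsPetalCurve γ o p t d) (hs : ∀ i, HasStrictDerivAt γ (d i) (t i)) {z : ℝ → ℝ}
    (hz : Continuous z) (hzp : Function.Periodic z 1) :
    ∃ (c : ℝ → ℂ) (z' : ℝ → ℝ), IsNormalPetalCurve c p (fun i => d i / ‖d i‖) ∧ Continuous z' ∧
      Function.Periodic z' (2 * p : ℝ) ∧ (∀ i : ℤ, z' (2 * i + 1 / 2) = z (t i)) ∧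
        IsotopicSets (range fun x => (γ x, z x)) (range fun x => (c x, z' x)) := by
  obtain ⟨H, hH, hH0, δ, hδ, hHt⟩ := h.exists_straightening hs
  have hp := h.pos
  have hp' : (0 : ℝ) < p := by exact_mod_cast hp
  have hd : ∀ i, 0 < ‖d i‖ := fun i => norm_pos_iff.2 (h.d_ne_zero i)
  set γ₁ : ℝ → ℂ := fun x => H 1 (γ x) with hγ₁
  have hγ₁c : Continuous γ₁ := (H 1).continuous.comp h.continuous
  have hHo : H 1 o = 0 := by
    have := hHt 0 0 (by simpa using hδ.le)
    simpa [h.apply_t] using this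
  have hγ₁0 : ∀ x, γ₁ x = 0 ↔ γ x = o := fun x => by
    simp only [hγ₁]
    rw [← hHo, (H 1).injective.eq_iff]
  -- a lower bound for the distance to `0` away from the strands
  obtain ⟨r, hr, hrle⟩ : ∃ r > 0, ∀ x, (∀ i, δ ≤ |x - t i|) → r ≤ ‖γ₁ x‖ := by
    let A : Set ℝ := Icc 0 1 ∩ ⋂ i : ℤ, {x | δ ≤ |x - t i|}
    have hA : IsCompact A := isCompact_Icc.inter_right
      (isClosed_iInter fun i => isClosed_le continuous_const (by fun_prop))
    have hfr : ∀ x, (∀ i, δ ≤ |x - t i|) → Int.fract x ∈ A := fun x hx => by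
      refine ⟨⟨Int.fract_nonneg x, (Int.fract_lt_one x).le⟩, mem_iInter.2 fun i => ?_⟩
      have := hx (i + ⌊x⌋ * p)
      rw [h.t_add_mul] at this
      have e : Int.fract x - t i = x - (t i + ⌊x⌋) := by rw [Int.fract]; ring
      change δ ≤ |Int.fract x - t i|
      rwa [e]
    have hγfr : ∀ x, γ₁ (Int.fract x) = γ₁ x := fun x => by
      have := h.periodic.sub_int_mul_eq (x := x) ⌊x⌋
      rw [mul_one] at this
      simp only [hγ₁]
      rw [Int.fract, this]
    rcases A.eq_empty_or_nonempty with hAe | hAne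
    · exact ⟨1, one_pos, fun x hx => absurd (hfr x hx) (by simp [hAe])⟩
    · obtain ⟨y, hy, hmin⟩ := hA.exists_isMinOn hAne hγ₁c.norm.continuousOn
      refine ⟨‖γ₁ y‖, norm_pos_iff.2 fun h0 => ?_, fun x hx => ?_⟩
      · obtain ⟨i, hi⟩ := (h.eq_iff y).1 ((hγ₁0 y).1 h0)
        have := mem_iInter.1 hy.2 i
        rw [← hi] at this
        change δ ≤ |t i - t i| at this
        rw [sub_self, abs_zero] at this
        linarith
      · rw [← hγfr x]
        exact hmin (hfr x hx)
  -- the common length `ρ` of the half-strands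
  obtain ⟨ρ₁, hρ₁, hρ₁le⟩ := exists_pos_forall_le_of_periodic hp
    (f := fun i => min (δ * ‖d i‖) ((t (i + 1) - t i) / (‖d i‖⁻¹ + ‖d (i + 1)‖⁻¹))) (by
      intro i
      have h1 : t (i + p + 1) = t (i + 1) + 1 := by rw [add_right_comm, h.t_add]
      have h2 : d (i + p + 1) = d (i + 1) := by rw [add_right_comm, h.d_periodic]
      simp only [h1, h2, h.t_add, h.d_periodic i]
      congr 2
      ring) (fun i => by
      have h1 := hd i
      have h2 := hd (i + 1)
      have h3 := sub_pos.2 (h.strictMono (lt_add_one i))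
      positivity)
  obtain ⟨ρ, hρ, hρlt⟩ : ∃ ρ, 0 < ρ ∧ ρ < min ρ₁ r := exists_between (lt_min hρ₁ hr)
  have hρδ : ∀ i, ρ / ‖d i‖ ≤ δ := fun i => by
    rw [div_le_iff₀ (hd i)]
    exact (hρlt.le.trans (min_le_left _ _)).trans ((hρ₁le i).trans (min_le_left _ _))
  have hgap : ∀ i, t i + ρ / ‖d i‖ < t (i + 1) - ρ / ‖d (i + 1)‖ := fun i => by
    have h1 := (hρlt.trans_le (min_le_left _ _)).trans_le ((hρ₁le i).trans (min_le_right _ _))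
    have h2 := hd i
    have h3 := hd (i + 1)
    rw [lt_div_iff₀ (by positivity), mul_add] at h1
    rw [div_eq_mul_inv, div_eq_mul_inv]
    linarith
  have hρd : ∀ i, 0 < ρ / ‖d i‖ := fun i => div_pos hρ (hd i)
  -- the change of parameter
  let Φ : ℤ → ℝ := interleave (fun i => t i - ρ / ‖d i‖) (fun i => t i + ρ / ‖d i‖)
  have hΦ0 : ∀ i, Φ (2 * i) = t i - ρ / ‖d i‖ := fun i => interleave_two_mul _ _ i
  have hΦ1 : ∀ i, Φ (2 * i + 1) = t i + ρ / ‖d i‖ := fun i => interleave_two_mul_add_one _ _ i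
  have hΦ2 : ∀ i, Φ (2 * i + 1 + 1) = t (i + 1) - ρ / ‖d (i + 1)‖ :=
    fun i => interleave_two_mul_add_two _ _ i
  have hΦmono : StrictMono Φ := strictMono_int_of_lt_succ fun n => by
    induction n using forall_int_of_interleave with
    | h0 i => rw [hΦ0, hΦ1]; linarith [hρd i]
    | h1 i => rw [hΦ1, hΦ2]; exact hgap i
  let φ : ℝ → ℝ := polyline Φ
  have hφc : Continuous φ := continuous_polyline Φ
  have hφmono : StrictMono φ := strictMono_polyline hΦmono
  have hφstrand : ∀ (i : ℤ), ∀ x ∈ Icc (2 * i : ℝ) (2 * i + 1),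
      φ x = t i + (2 * x - 4 * i - 1) * (ρ / ‖d i‖) := fun i x hx => by
    have := polyline_apply Φ (n := 2 * i) (x := x) (by push_cast; exact hx)
    rw [hΦ0, hΦ1] at this
    simp only [φ, this, smul_eq_mul]
    push_cast
    ring
  have hφmid : ∀ i : ℤ, φ (2 * i + 1 / 2) = t i := fun i => by
    rw [hφstrand i _ ⟨by linarith, by linarith⟩]; ring
  have hφper : ∀ x, φ (x + 2 * p) = φ x + 1 := by
    intro x
    have hΦper : ∀ n, Φ (n + 2 * p) = Φ n + 1 := fun n => by
      induction n using forall_int_of_interleave with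
      | h0 i => rw [← mul_add, hΦ0, hΦ0, h.t_add, h.d_periodic]; ring
      | h1 i =>
        have : 2 * i + 1 + 2 * (p : ℤ) = 2 * (i + p) + 1 := by ring
        rw [this, hΦ1, hΦ1, h.t_add, h.d_periodic]; ring
    have := polyline_add_intCast hΦper x
    push_cast at this
    simp only [φ, this, polyline, smul_eq_mul]
    ring
  have hφper' : ∀ x, ∀ n : ℤ, φ (x + n * (2 * p)) = φ x + n := by
    intro x n
    induction n using Int.induction_on with
    | zero => simp
    | succ k ih =>
      have := hφper (x + k * (2 * p))
      push_cast at ih ⊢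
      rw [ih] at this
      rw [add_mul, one_mul, ← add_assoc, this]
      ring
    | pred k ih =>
      have := hφper (x + (-(k : ℝ) - 1) * (2 * p))
      push_cast at ih ⊢
      rw [add_assoc, ← add_one_mul, sub_add_cancel, ih] at this
      linarith
  have hφsurj : Function.Surjective φ := fun y => by
    apply mem_range_of_exists_le_of_exists_ge hφc
    · refine ⟨0 + (⌊y - φ 0⌋ : ℤ) * (2 * p), ?_⟩
      rw [hφper']
      linarith [Int.floor_le (y - φ 0)]
    · refine ⟨0 + (⌈y - φ 0⌉ : ℤ) * (2 * p), ?_⟩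
      rw [hφper']
      linarith [Int.le_ceil (y - φ 0)]
  have hγ₁per : Function.Periodic γ₁ 1 := fun x => by simp only [hγ₁]; rw [h.periodic]
  refine ⟨fun x => γ₁ (φ x) * ((ρ⁻¹ : ℝ) : ℂ), fun x => z (φ x), ?_, hz.comp hφc, ?_, ?_, ?_⟩
  · refine
      { continuous := (hγ₁c.comp hφc).mul continuous_const
        periodic := fun x => by simp only [hφper, hγ₁per _]
        pos := hp
        norm_u := fun i => by
          rw [norm_div, Complex.norm_real, norm_norm, div_self (hd i).ne']
        u_periodic := fun i => by simp only [h.d_periodic i]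
        transversal := fun i j hij => ?_
        strand := fun i x hx => ?_
        petal := fun i x hx => ?_
        injective := fun s x hsx hs0 => ?_ }
    · have e : d i / ‖d i‖ * (starRingEnd ℂ) (d j / ‖d j‖) =
          ((‖d i‖⁻¹ * ‖d j‖⁻¹ : ℝ) : ℂ) * (d i * (starRingEnd ℂ) (d j)) := by
        rw [map_div₀, Complex.conj_ofReal]
        push_cast
        ring
      rw [e, Complex.im_ofReal_mul]
      exact mul_ne_zero (mul_pos (inv_pos.2 (hd i)) (inv_pos.2 (hd j))).ne' (h.transversal i j hij)
    · have h1 : |(2 * x - 4 * i - 1) * (ρ / ‖d i‖)| ≤ δ := by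
        rw [abs_mul, abs_of_pos (hρd i)]
        refine (mul_le_of_le_one_left (hρd i).le ?_).trans (hρδ i)
        rw [abs_le]
        constructor <;> linarith [hx.1, hx.2]
      simp only [hφstrand i x hx, hγ₁]
      rw [hHt i _ h1]
      have : (ρ : ℂ) ≠ 0 := Complex.ofReal_ne_zero.2 hρ.ne'
      push_cast
      field_simp
    · rw [norm_mul, Complex.norm_real, Real.norm_of_nonneg (inv_pos.2 hρ).le, ← div_eq_mul_inv,
        one_le_div hρ]
      have hlo : t i + ρ / ‖d i‖ ≤ φ x := by
        have := hφmono.monotone hx.1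
        rw [hφstrand i _ ⟨by linarith, le_rfl⟩] at this
        linarith
      have hhi : φ x ≤ t (i + 1) - ρ / ‖d (i + 1)‖ := by
        have := hφmono.monotone hx.2
        have e := hφstrand (i + 1) (2 * i + 2) ⟨by push_cast; linarith, by push_cast; linarith⟩
        rw [e] at this
        push_cast at this
        linarith
      by_cases hfar : ∀ j, δ ≤ |φ x - t j|
      · exact (hρlt.le.trans (min_le_right _ _)).trans (hrle _ hfar)
      · push Not at hfar
        obtain ⟨j, hj⟩ := hfar
        have e : γ₁ (φ x) = ((φ x - t j : ℝ) : ℂ) * d j := by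
          rw [← hHt j (φ x - t j) hj.le, add_sub_cancel]
        rw [e, norm_mul, Complex.norm_real, Real.norm_eq_abs, ← div_le_iff₀ (hd j)]
        rcases le_or_gt j i with hji | hji
        · refine le_trans ?_ (le_abs_self _)
          rcases eq_or_lt_of_le hji with rfl | hlt
          · linarith
          · have := h.strictMono.monotone (show j + 1 ≤ i by omega)
            linarith [hgap j, hρd i, hρd (j + 1)]
        · refine le_trans ?_ (neg_le_abs _)
          rcases eq_or_lt_of_le (show i + 1 ≤ j by omega) with rfl | hlt
          · linarith
          · have := h.strictMono.monotone (show i + 1 ≤ j - 1 by omega)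
            have h2 := hgap (j - 1)
            rw [sub_add_cancel] at h2
            linarith [hρd (j - 1), hρd (i + 1)]
    · have hρ0 : ((ρ⁻¹ : ℝ) : ℂ) ≠ 0 := Complex.ofReal_ne_zero.2 (inv_pos.2 hρ).ne'
      have h1 := (H 1).injective (mul_right_cancel₀ hρ0 hsx)
      have h2 : γ (φ s) ≠ o := fun h => hs0 (by
        rw [(hγ₁0 _).2 h, zero_mul])
      obtain ⟨n, hn⟩ := h.injective _ _ h1 h2
      refine ⟨n, hφmono.injective ?_⟩
      rw [hφper', hn]
  · intro x
    simp only [hφper, hzp _]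
  · intro i
    simp only [hφmid]
  · have e1 := isotopicSets_of_planar_isotopy (γ := γ) (z := z) H hH hH0
    have e2 := isotopicSets_of_twist (γ := γ₁) (γ' := fun x => γ₁ x * ((ρ⁻¹ : ℝ) : ℂ)) (z := z)
      (Q := fun _ => 0) (Λ := fun _ => Complex.log ((ρ⁻¹ : ℝ) : ℂ)) continuous_const
      continuous_const (fun x => by
        rw [Complex.exp_log (Complex.ofReal_ne_zero.2 (inv_pos.2 hρ).ne')]
        ring)
    have e3 : (range fun x => (γ₁ (φ x) * ((ρ⁻¹ : ℝ) : ℂ), z (φ x))) =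
        range fun x => (γ₁ x * ((ρ⁻¹ : ℝ) : ℂ), z x) :=
      hφsurj.range_comp fun x => (γ₁ x * ((ρ⁻¹ : ℝ) : ℂ), z x)
    rw [e3]
    exact e1.trans e2

/-! ### Replacing the petals by straight segments -/

/-- If two convex plane cones have a common interior point and neither contains a boundary ray of
the other one in its interior, then they are equal. -/
theorem rays_eq_of_cones_meet {x y x' y' : ℂ} (hD : (x * (starRingEnd ℂ) y).im ≠ 0)
    (hx'0 : x' ≠ 0) (hy'0 : y' ≠ 0)
    (hx' : ∀ α β : ℝ, 0 < α → 0 < β → x' ≠ α * x + β * y)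
    (hy' : ∀ α β : ℝ, 0 < α → 0 < β → y' ≠ α * x + β * y)
    (hx : ∀ α β : ℝ, 0 < α → 0 < β → x ≠ α * x' + β * y')
    (hy : ∀ α β : ℝ, 0 < α → 0 < β → y ≠ α * x' + β * y')
    {α β α' β' : ℝ} (hα : 0 < α) (hβ : 0 < β) (hα' : 0 < α') (hβ' : 0 < β')
    (e : (α : ℂ) * x + β * y = α' * x' + β' * y') :
    (∃ a : ℝ, x' = a * x) ∧ (∃ a : ℝ, y' = a * y) ∨
      (∃ a : ℝ, x' = a * y) ∧ (∃ a : ℝ, y' = a * x) := by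
  have hcoord : ∀ w : ℂ, ∃ a b : ℝ, w = a * x + b * y := fun w => by
    have key : (((x * (starRingEnd ℂ) y).im : ℝ) : ℂ) * w =
        ((w * (starRingEnd ℂ) y).im : ℝ) * x - ((w * (starRingEnd ℂ) x).im : ℝ) * y := by
      apply Complex.ext <;> simp <;> ring
    have hD' : (((x * (starRingEnd ℂ) y).im : ℝ) : ℂ) ≠ 0 := Complex.ofReal_ne_zero.2 hD
    refine ⟨(w * (starRingEnd ℂ) y).im / (x * (starRingEnd ℂ) y).im,
      -(w * (starRingEnd ℂ) x).im / (x * (starRingEnd ℂ) y).im, ?_⟩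
    generalize (w * (starRingEnd ℂ) y).im = a at *
    generalize (w * (starRingEnd ℂ) x).im = b at *
    generalize (x * (starRingEnd ℂ) y).im = D at *
    push_cast
    field_simp
    linear_combination key
  obtain ⟨a, b, rfl⟩ := hcoord x'
  obtain ⟨c, d, rfl⟩ := hcoord y'
  obtain ⟨e1, e2⟩ := eq_zero_of_smul_add_smul_eq_zero hD
    (α := α' * a + β' * c - α) (β := α' * b + β' * d - β) (by push_cast; linear_combination -e)
  have hab : ¬ (0 < a ∧ 0 < b) := fun h => hx' a b h.1 h.2 rfl
  have hcd : ¬ (0 < c ∧ 0 < d) := fun h => hy' c d h.1 h.2 rfl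
  have hab0 : ¬ (a = 0 ∧ b = 0) := fun h => hx'0 (by simp [h.1, h.2])
  have hcd0 : ¬ (c = 0 ∧ d = 0) := fun h => hy'0 (by simp [h.1, h.2])
  -- `x` and `y` in the coordinates of the other cone
  have hxc : ∀ Δ : ℝ, Δ = a * d - b * c → Δ ≠ 0 →
      x = ((d / Δ : ℝ) : ℂ) * (a * x + b * y) + ((-b / Δ : ℝ) : ℂ) * (c * x + d * y) ∧
      y = ((-c / Δ : ℝ) : ℂ) * (a * x + b * y) + ((a / Δ : ℝ) : ℂ) * (c * x + d * y) := by
    intro Δ hΔ hΔ0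
    have h0 : (Δ : ℂ) ≠ 0 := Complex.ofReal_ne_zero.2 hΔ0
    have h1 : (Δ : ℂ) = a * d - b * c := by rw [hΔ]; push_cast; ring
    constructor
    · push_cast
      field_simp
      rw [h1]
      ring
    · push_cast
      field_simp
      rw [h1]
      ring
  have ha : 0 ≤ a := by
    by_contra! ha
    have hc : 0 < c := by nlinarith
    have hd : d ≤ 0 := by by_contra! hd; exact hcd ⟨hc, hd⟩
    have hb : 0 < b := by nlinarith
    have hΔ : a * d - b * c < 0 := by
      by_contra! h
      nlinarith [mul_pos hβ hc, mul_pos hα' hb, mul_nonneg hα'.le h, mul_nonneg hβ'.le h,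
        mul_pos hα hb, mul_pos_of_neg_of_neg ha (neg_lt_zero.2 hβ)]
    exact hy _ _ (div_pos_of_neg_of_neg (neg_lt_zero.2 hc) hΔ) (div_pos_of_neg_of_neg ha hΔ)
      (hxc _ rfl hΔ.ne).2
  have hb : 0 ≤ b := by
    by_contra! hb
    have hd : 0 < d := by nlinarith
    have hc : c ≤ 0 := by by_contra! hc; exact hcd ⟨hc, hd⟩
    have ha : 0 < a := by nlinarith
    have hΔ : 0 < a * d - b * c := by
      by_contra! h
      nlinarith [mul_pos hα hd, mul_pos hα' ha, mul_pos hβ ha,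
        mul_pos_of_neg_of_neg hb (neg_lt_zero.2 hα)]
    exact hx _ _ (div_pos hd hΔ) (div_pos (neg_pos.2 hb) hΔ) (hxc _ rfl hΔ.ne').1
  have hc : 0 ≤ c := by
    by_contra! hc
    have ha' : 0 < a := by nlinarith
    have hb' : b = 0 := by
      rcases eq_or_lt_of_le hb with h | h
      · exact h.symm
      · exact absurd ⟨ha', h⟩ hab
    have hd : 0 < d := by nlinarith
    have hΔ : 0 < a * d - b * c := by rw [hb']; nlinarith [mul_pos ha' hd]
    exact hy _ _ (div_pos (neg_pos.2 hc) hΔ) (div_pos ha' hΔ) (hxc _ rfl hΔ.ne').2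
  have hd : 0 ≤ d := by
    by_contra! hd
    have hb' : 0 < b := by nlinarith
    have ha' : a = 0 := by
      rcases eq_or_lt_of_le ha with h | h
      · exact h.symm
      · exact absurd ⟨h, hb'⟩ hab
    have hc' : 0 < c := by nlinarith
    have hΔ : a * d - b * c < 0 := by rw [ha']; nlinarith [mul_pos hb' hc']
    exact hx _ _ (div_pos_of_neg_of_neg hd hΔ) (div_pos_of_neg_of_neg (neg_lt_zero.2 hb') hΔ)
      (hxc _ rfl hΔ.ne).1
  rcases eq_or_lt_of_le ha with ha | ha
  · have hc' : 0 < c := by nlinarith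
    have hd' : d = 0 := by
      rcases eq_or_lt_of_le hd with h | h
      · exact h.symm
      · exact absurd ⟨hc', h⟩ hcd
    exact Or.inr ⟨⟨b, by simp [← ha]⟩, ⟨c, by simp [hd']⟩⟩
  · have hb' : b = 0 := by
      rcases eq_or_lt_of_le hb with h | h
      · exact h.symm
      · exact absurd ⟨ha, h⟩ hab
    have hd' : 0 < d := by nlinarith
    have hc' : c = 0 := by
      rcases eq_or_lt_of_le hc with h | h
      · exact h.symm
      · exact absurd ⟨h, hd'⟩ hcd
    exact Or.inl ⟨⟨a, by simp [hb']⟩, ⟨d, by simp [hc']⟩⟩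

theorem Function.Periodic.range_Icc {X : Type*} {f : ℝ → X} {m : ℝ} (hf : Function.Periodic f m)
    (hm : 0 < m) (a : ℝ) : (range fun t : Icc 0 m => f (t + a)) = range f := by
  rw [← hf.image_Icc hm a]
  ext y
  constructor
  · rintro ⟨⟨t, ht0, ht1⟩, rfl⟩
    exact ⟨t + a, ⟨by linarith, by linarith⟩, rfl⟩
  · rintro ⟨x, ⟨hx0, hx1⟩, rfl⟩
    exact ⟨⟨x - a, by linarith, by linarith⟩, by simp⟩

theorem exists_mem_strand_or_petal (x : ℝ) :
    ∃ i : ℤ, x ∈ Icc (2 * i : ℝ) (2 * i + 1) ∨ x ∈ Ioo (2 * i + 1 : ℝ) (2 * i + 2) := by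
  refine ⟨⌊x / 2⌋, ?_⟩
  have h1 := Int.floor_le (x / 2)
  have h2 := Int.lt_floor_add_one (x / 2)
  rcases le_or_gt x (2 * ⌊x / 2⌋ + 1) with h | h
  · exact Or.inl ⟨by linarith, h⟩
  · exact Or.inr ⟨h, by linarith⟩

/-- The closed polygon with the edges from `-u i` to `u i` and from `u i` to `-u (i + 1)`. -/
noncomputable def petalPolygon (u : ℤ → ℂ) : ℝ → ℂ := polyline (interleave (fun i => -u i) u)

theorem petalPolygon_strand (u : ℤ → ℂ) {i : ℤ} {x : ℝ} (hx : x ∈ Icc (2 * i : ℝ) (2 * i + 1)) :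
    petalPolygon u x = (2 * x - 4 * i - 1 : ℝ) * u i := by
  rw [petalPolygon, polyline_apply _ (n := 2 * i) (by push_cast; exact hx),
    interleave_two_mul, interleave_two_mul_add_one, Complex.real_smul]
  push_cast
  ring

theorem petalPolygon_petal (u : ℤ → ℂ) {i : ℤ} {x : ℝ}
    (hx : x ∈ Icc (2 * i + 1 : ℝ) (2 * i + 2)) :
    petalPolygon u x = (2 * i + 2 - x : ℝ) * u i + (x - 2 * i - 1 : ℝ) * -u (i + 1) := by
  rw [petalPolygon, polyline_apply _ (n := 2 * i + 1) (by
    push_cast; exact ⟨hx.1, by linarith [hx.2]⟩),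
    interleave_two_mul_add_two, interleave_two_mul_add_one, Complex.real_smul]
  push_cast
  ring

theorem not_dvd_add_one_sub {p : ℕ} (hp : 2 ≤ p) (i : ℤ) : ¬ (p : ℤ) ∣ i + 1 - i := by
  rw [add_sub_cancel_left]
  intro hdvd
  have := Int.le_of_dvd one_pos hdvd
  omega

theorem exists_eq_add_of_dvd {p : ℕ} {i j : ℤ} (hij : (p : ℤ) ∣ j - i) {s x : ℝ}
    (hsx : x - 2 * j = s - 2 * i) :
    ∃ n : ℤ, x = s + n * (2 * p) := by
  obtain ⟨k, hk⟩ := hij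
  refine ⟨k, ?_⟩
  have : (j : ℝ) - i = p * k := by exact_mod_cast hk
  linear_combination hsx + 2 * this

namespace IsNormalPetalCurve

variable {c : ℝ → ℂ} {p : ℕ} {u : ℤ → ℂ} (h : IsNormalPetalCurve c p u)
include h

theorem u_ne_zero (i : ℤ) : u i ≠ 0 := fun h0 => by
  have := h.norm_u i
  rw [h0, norm_zero] at this
  exact zero_ne_one this

theorem dvd_of_eq_mul {i j : ℤ} {a : ℝ} (e : u j = a * u i) : (p : ℤ) ∣ j - i := by
  by_contra hij
  apply h.transversal i j hij
  rw [e, map_mul, Complex.conj_ofReal, mul_left_comm, Complex.mul_conj, ← Complex.ofReal_mul,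
    Complex.ofReal_im]

theorem eq_of_apply_eq_zero {x : ℝ} (hx : c x = 0) : ∃ i : ℤ, x = 2 * i + 1 / 2 := by
  obtain ⟨i, hi | hi⟩ := exists_mem_strand_or_petal x
  · rw [h.strand i x hi, mul_eq_zero] at hx
    have := Complex.ofReal_eq_zero.1 (hx.resolve_right (h.u_ne_zero i))
    exact ⟨i, by linarith⟩
  · have := h.petal i x ⟨hi.1.le, hi.2.le⟩
    rw [hx, norm_zero] at this
    linarith

theorem petalPolygon_periodic : Function.Periodic (petalPolygon u) (2 * p : ℝ) := by
  have h1 : ∀ n, interleave (fun i => -u i) u (n + 2 * p) = interleave (fun i => -u i) u n :=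
    interleave_add_two_mul (fun i => by simp only [h.u_periodic i]) h.u_periodic
  intro x
  have := polyline_add_intCast h1 x
  push_cast at this
  exact this

theorem petalPolygon_eq_of_strand {i : ℤ} {x : ℝ} (hx : x ∈ Icc (2 * i : ℝ) (2 * i + 1)) :
    petalPolygon u x = c x := by
  rw [petalPolygon_strand u hx, h.strand i x hx]

theorem petalPolygon_eq_intCast (n : ℤ) : petalPolygon u n = c n := by
  induction n using forall_int_of_interleave with
  | h0 i => exact h.petalPolygon_eq_of_strand (i := i) (by push_cast; constructor <;> linarith)
  | h1 i => exact h.petalPolygon_eq_of_strand (i := i) (by push_cast; constructor <;> linarith)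

theorem im_ne_zero (hp : 2 ≤ p) (i : ℤ) : (u i * (starRingEnd ℂ) (-u (i + 1))).im ≠ 0 := by
  have := h.transversal i (i + 1) (not_dvd_add_one_sub hp i)
  rw [map_neg, mul_neg, Complex.neg_im]
  exact neg_ne_zero.2 this

theorem norm_petalPolygon_lt (hp : 2 ≤ p) {i : ℤ} {x : ℝ}
    (hx : x ∈ Ioo (2 * i + 1 : ℝ) (2 * i + 2)) : ‖petalPolygon u x‖ < 1 := by
  rw [petalPolygon_petal u ⟨hx.1.le, hx.2.le⟩, ← Complex.real_smul, ← Complex.real_smul]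
  refine norm_combo_lt_of_ne (h.norm_u i).le (by rw [norm_neg, h.norm_u]) (fun he => ?_)
    (by linarith [hx.2]) (by linarith [hx.1]) (by ring)
  refine not_dvd_add_one_sub hp i (h.dvd_of_eq_mul (a := -1) ?_)
  rw [he]; simp

theorem petalPolygon_eq_zero (hp : 2 ≤ p) {x : ℝ} (hx : petalPolygon u x = 0) :
    ∃ i : ℤ, x = 2 * i + 1 / 2 := by
  obtain ⟨i, hi | hi⟩ := exists_mem_strand_or_petal x
  · rw [h.petalPolygon_eq_of_strand hi] at hx
    exact h.eq_of_apply_eq_zero hx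
  · rw [petalPolygon_petal u ⟨hi.1.le, hi.2.le⟩] at hx
    have := (eq_zero_of_smul_add_smul_eq_zero (h.im_ne_zero hp i) hx).1
    linarith [hi.2]

section Adjacent

variable (hp : 3 ≤ p) (hadj : ∀ (i j : ℤ) (ε : ℝ), (ε = 1 ∨ ε = -1) → ∀ α β : ℝ, 0 < α → 0 < β →
  (ε : ℂ) * u j ≠ α * u i + β * -u (i + 1))
include hp hadj

/-- Two petals for which the cones between the ends, or a cone and the opposite of the other one,
have a common point are equal. For `p = 2` this fails, as the cones of the two petals are
opposite. -/
theorem dvd_of_cones_meet {i j : ℤ} {ε : ℝ} (hε : ε = 1 ∨ ε = -1) {α β α' β' : ℝ}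
    (hα : 0 < α) (hβ : 0 < β) (hα' : 0 < α') (hβ' : 0 < β')
    (e : (α : ℂ) * u i + β * -u (i + 1) = ε * (α' * u j + β' * -u (j + 1))) :
    (p : ℤ) ∣ j - i := by
  have hε0 : (ε : ℂ) ≠ 0 := by rcases hε with rfl | rfl <;> simp
  have hε2 : (ε : ℂ) * ε = 1 := by rcases hε with rfl | rfl <;> simp
  have hneg : -ε = 1 ∨ -ε = -1 := by rcases hε with rfl | rfl <;> simp
  have := rays_eq_of_cones_meet (x := u i) (y := -u (i + 1)) (x' := ε * u j)
    (y' := ((-ε : ℝ) : ℂ) * u (j + 1)) (h.im_ne_zero (by omega) i)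
    (mul_ne_zero hε0 (h.u_ne_zero j))
    (mul_ne_zero (by push_cast; exact neg_ne_zero.2 hε0) (h.u_ne_zero _))
    (hadj i j ε hε) (hadj i (j + 1) (-ε) hneg)
    (fun a b ha hb e' => hadj j i ε hε a b ha hb (by
      conv_lhs => rw [e']
      push_cast
      linear_combination (a * u j - b * u (j + 1)) * hε2))
    (fun a b ha hb e' => hadj j (i + 1) (-ε) hneg a b ha hb (by
      have : u (i + 1) = -(a * (ε * u j) + b * (((-ε : ℝ) : ℂ) * u (j + 1))) := by
        rw [← e', neg_neg]
      rw [this]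
      push_cast
      linear_combination (a * u j - b * u (j + 1)) * hε2))
    hα hβ hα' hβ' (by rw [e]; push_cast; ring)
  rcases this with ⟨⟨a, ha⟩, -⟩ | ⟨⟨a, ha⟩, ⟨b, hb⟩⟩
  · refine h.dvd_of_eq_mul (a := ε * a) ?_
    push_cast
    linear_combination (ε : ℂ) * ha - u j * hε2
  · exfalso
    have h1 : (p : ℤ) ∣ j - (i + 1) := h.dvd_of_eq_mul (a := -(ε * a)) (by
      push_cast
      linear_combination (ε : ℂ) * ha - u j * hε2)
    have h2 : (p : ℤ) ∣ j + 1 - i := h.dvd_of_eq_mul (a := -(ε * b)) (by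
      push_cast at hb ⊢
      linear_combination -(ε : ℂ) * hb - u (j + 1) * hε2)
    have h3 : (p : ℤ) ∣ 2 := by
      have := dvd_sub h2 h1
      have e2 : j + 1 - i - (j - (i + 1)) = 2 := by ring
      rwa [e2] at this
    have := Int.le_of_dvd two_pos h3
    omega

/-- The only crossing of the polygon is at `0`: by `hadj`, the ends of the strands are outside of
the open cones that contain the segments between the strands. -/
theorem petalPolygon_injective {s x : ℝ} (hsx : petalPolygon u s = petalPolygon u x) :
    petalPolygon u s = 0 ∨ ∃ n : ℤ, x = s + n * (2 * p) := by
  have key : ∀ {s x : ℝ} {i j : ℤ}, s ∈ Icc (2 * i : ℝ) (2 * i + 1) →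
      x ∈ Ioo (2 * j + 1 : ℝ) (2 * j + 2) → petalPolygon u s = petalPolygon u x →
        petalPolygon u s = 0 := by
    intro s x i j hs hx hsx
    rw [petalPolygon_strand u hs]
    rw [petalPolygon_strand u hs, petalPolygon_petal u ⟨hx.1.le, hx.2.le⟩] at hsx
    set a : ℝ := 2 * s - 4 * i - 1
    rcases lt_trichotomy a 0 with ha | ha | ha
    · exfalso
      refine hadj j i (-1) (Or.inr rfl) ((2 * j + 2 - x) / -a) ((x - 2 * j - 1) / -a)
        (div_pos (by linarith [hx.2]) (by linarith))
        (div_pos (by linarith [hx.1]) (by linarith)) ?_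
      have ha0 : (a : ℂ) ≠ 0 := Complex.ofReal_ne_zero.2 ha.ne
      push_cast at hsx ⊢
      field_simp
      linear_combination -hsx
    · rw [ha]; simp
    · exfalso
      refine hadj j i 1 (Or.inl rfl) ((2 * j + 2 - x) / a) ((x - 2 * j - 1) / a)
        (div_pos (by linarith [hx.2]) (by linarith))
        (div_pos (by linarith [hx.1]) (by linarith)) ?_
      have ha0 : (a : ℂ) ≠ 0 := Complex.ofReal_ne_zero.2 ha.ne'
      push_cast at hsx ⊢
      field_simp
      linear_combination hsx
  obtain ⟨i, hi | hi⟩ := exists_mem_strand_or_petal s <;>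
    obtain ⟨j, hj | hj⟩ := exists_mem_strand_or_petal x
  · rw [h.petalPolygon_eq_of_strand hi]
    rw [h.petalPolygon_eq_of_strand hi, h.petalPolygon_eq_of_strand hj] at hsx
    by_cases h0 : c s = 0
    · exact Or.inl h0
    · exact Or.inr (h.injective s x hsx h0)
  · exact Or.inl (key hi hj hsx)
  · exact Or.inl (hsx.trans (key hj hi hsx.symm))
  · right
    rw [petalPolygon_petal u ⟨hi.1.le, hi.2.le⟩, petalPolygon_petal u ⟨hj.1.le, hj.2.le⟩] at hsx
    have hij := h.dvd_of_cones_meet hp hadj (i := i) (j := j) (α := 2 * i + 2 - s)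
      (β := s - 2 * i - 1) (α' := 2 * j + 2 - x) (β' := x - 2 * j - 1) (Or.inl rfl)
      (by linarith [hi.2]) (by linarith [hi.1])
      (by linarith [hj.2]) (by linarith [hj.1]) (by rw [Complex.ofReal_one, one_mul]; exact hsx)
    have hij' : (p : ℤ) ∣ j + 1 - (i + 1) := by simpa using hij
    rw [h.u_periodic.eq_of_dvd hij, h.u_periodic.eq_of_dvd hij'] at hsx
    have := (eq_zero_of_smul_add_smul_eq_zero (h.im_ne_zero (by omega) i)
      (α := (2 * i + 2 - s) - (2 * j + 2 - x)) (β := (s - 2 * i - 1) - (x - 2 * j - 1))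
      (by push_cast at hsx ⊢; linear_combination hsx)).1
    exact exists_eq_add_of_dvd hij (by linarith)

/-- The segments of the polygon do not meet the petals, which are outside of the unit disc. -/
theorem petalPolygon_injective' {s x : ℝ} (hsx : petalPolygon u s = c x) :
    petalPolygon u s = 0 ∨ ∃ n : ℤ, x = s + n * (2 * p) := by
  obtain ⟨i, hi | hi⟩ := exists_mem_strand_or_petal s
  · rw [h.petalPolygon_eq_of_strand hi] at hsx ⊢
    by_cases h0 : c s = 0
    · exact Or.inl h0
    · exact Or.inr (h.injective s x hsx h0)
  obtain ⟨j, hj | hj⟩ := exists_mem_strand_or_petal x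
  · rw [← h.petalPolygon_eq_of_strand hj] at hsx
    exact h.petalPolygon_injective hp hadj hsx
  · have h1 := h.norm_petalPolygon_lt (by omega) hi
    have h2 := h.petal j x ⟨hj.1.le, hj.2.le⟩
    rw [hsx] at h1
    linarith

end Adjacent

end IsNormalPetalCurve

namespace IsNormalPetalCurve

/-- The curve `c` with the pieces `[n, n + 1]`, `n` congruent to one of `0, …, k - 1` modulo `2p`,
replaced by the straight segments of the polygon. -/
noncomputable def glued (c : ℝ → ℂ) (p : ℕ) (u : ℤ → ℂ) (k : ℕ) (x : ℝ) : ℂ :=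
  if ⌊x⌋ % (2 * p : ℤ) < k then petalPolygon u x else c x

theorem glued_eq_or (c : ℝ → ℂ) (p : ℕ) (u : ℤ → ℂ) (k : ℕ) (x : ℝ) :
    glued c p u k x = petalPolygon u x ∨ glued c p u k x = c x := by
  rw [glued]
  split_ifs
  exacts [Or.inl rfl, Or.inr rfl]

variable {c : ℝ → ℂ} {p : ℕ} {u : ℤ → ℂ} (h : IsNormalPetalCurve c p u)
include h

theorem continuous_glued (k : ℕ) : Continuous (glued c p u k) := by
  refine continuous_of_continuousOn_Icc_int fun n => ?_
  have hint : ∀ m : ℤ, glued c p u k m = petalPolygon u m ∧ glued c p u k m = c m := fun m => by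
    rcases glued_eq_or c p u k m with e | e <;> rw [e] <;> simp [h.petalPolygon_eq_intCast]
  have key : ∀ f : ℝ → ℂ, Continuous f → (∀ x ∈ Ico (n : ℝ) (n + 1), glued c p u k x = f x) →
      glued c p u k (n + 1) = f (n + 1) → ContinuousOn (glued c p u k) (Icc (n : ℝ) (n + 1)) := by
    intro f hf h1 h2
    refine hf.continuousOn.congr fun x hx => ?_
    rcases eq_or_lt_of_le hx.2 with rfl | hlt
    · exact h2
    · exact h1 x ⟨hx.1, hlt⟩
  have hn1 := hint (n + 1)
  push_cast at hn1
  by_cases hk : n % (2 * p : ℤ) < k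
  · refine key _ (continuous_polyline _) (fun x hx => ?_) hn1.1
    rw [glued, Int.floor_eq_iff.2 hx, if_pos hk]
    rfl
  · refine key _ h.continuous (fun x hx => ?_) hn1.2
    rw [glued, Int.floor_eq_iff.2 hx, if_neg hk]

theorem periodic_glued (k : ℕ) : Function.Periodic (glued c p u k) (2 * p : ℝ) := by
  intro x
  have : ⌊x + 2 * p⌋ = ⌊x⌋ + 2 * p := by
    have := Int.floor_add_intCast x (2 * p)
    push_cast at this
    exact this
  simp only [glued, this, Int.add_emod_right, h.periodic x, h.petalPolygon_periodic x]

section Adjacent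

variable (hp : 3 ≤ p) (hadj : ∀ (i j : ℤ) (ε : ℝ), (ε = 1 ∨ ε = -1) → ∀ α β : ℝ, 0 < α → 0 < β →
  (ε : ℂ) * u j ≠ α * u i + β * -u (i + 1))
include hp hadj

/-- No two of the curves, and none of them with itself, have crossings outside of the middles of the
strands. -/
theorem glued_injective (k l : ℕ) {s x : ℝ} (hsx : glued c p u k s = glued c p u l x) :
    (∃ i : ℤ, s = 2 * i + 1 / 2) ∨ ∃ n : ℤ, x = s + n * (2 * p) := by
  rcases glued_eq_or c p u k s with e | e <;> rcases glued_eq_or c p u l x with e' | e' <;>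
    rw [e, e'] at hsx
  · exact (h.petalPolygon_injective hp hadj hsx).imp_left (h.petalPolygon_eq_zero (by omega))
  · exact (h.petalPolygon_injective' hp hadj hsx).imp_left (h.petalPolygon_eq_zero (by omega))
  · rcases h.petalPolygon_injective' hp hadj hsx.symm with h0 | ⟨n, hn⟩
    · rw [← hsx] at h0
      exact Or.inl (h.eq_of_apply_eq_zero h0)
    · exact Or.inr ⟨-n, by push_cast; linarith⟩
  · by_cases h0 : c s = 0
    · exact Or.inl (h.eq_of_apply_eq_zero h0)
    · exact Or.inr (h.injective s x hsx h0)

/-- One petal is replaced by a straight segment; the crossings are at a distance of at least `1 / 2`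
from the parameters of the petal. -/
theorem isotopicSets_glued_succ {z : ℝ → ℝ} (hz : Continuous z)
    (hzp : Function.Periodic z (2 * p : ℝ)) (k : ℕ) :
    IsotopicSets (range fun x => (glued c p u k x, z x))
      (range fun x => (glued c p u (k + 1) x, z x)) := by
  have hdiff : ∀ x, ⌊x⌋ % (2 * p : ℤ) ≠ k → glued c p u (k + 1) x = glued c p u k x := by
    intro x hx
    have : ⌊x⌋ % (2 * p : ℤ) < (k + 1 : ℕ) ↔ ⌊x⌋ % (2 * p : ℤ) < k := by push_cast; omega
    simp only [glued, this]
  obtain ⟨l, hl | hl⟩ := Nat.even_or_odd' k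
  · -- on the strands, the two curves agree
    have : glued c p u (k + 1) = glued c p u k := by
      funext x
      by_cases hx : ⌊x⌋ % (2 * p : ℤ) = k
      · have hev : ∃ i : ℤ, ⌊x⌋ = 2 * i := by
          refine ⟨l + p * (⌊x⌋ / (2 * p)), ?_⟩
          have h1 := Int.emod_add_mul_ediv ⌊x⌋ (2 * p)
          have h2 : (k : ℤ) = 2 * l := by exact_mod_cast hl
          linear_combination -h1 + hx + h2
        obtain ⟨i, hi⟩ := hev
        have hfl := Int.floor_le x
        have hfl' := Int.lt_floor_add_one x
        have hi' : (⌊x⌋ : ℝ) = 2 * i := by exact_mod_cast hi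
        have e := h.petalPolygon_eq_of_strand (i := i) (x := x) ⟨by linarith, by linarith⟩
        rcases glued_eq_or c p u k x with e1 | e1 <;>
          rcases glued_eq_or c p u (k + 1) x with e2 | e2 <;> rw [e1, e2] <;> simp [e]
      · exact hdiff x hx
    rw [this]
    exact IsotopicSets.refl _
  · have hp0 : (0 : ℝ) < p := by exact_mod_cast h.pos
    have hp3 : (3 : ℝ) ≤ p := by exact_mod_cast hp
    have hper : ∀ n : ℕ, Function.Periodic (fun x => (glued c p u n x, z x)) (2 * p : ℝ) :=
      fun n x => by simp only [h.periodic_glued n x, hzp x]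
    rw [← (hper k).range_Icc (by linarith) k, ← (hper (k + 1)).range_Icc (by linarith) k]
    have hend : ∀ n : ℕ, glued c p u n (2 * p + k) = glued c p u n (0 + k) := fun n => by
      rw [zero_add, add_comm, h.periodic_glued n]
    have hcross : ∀ n : ℕ, ∀ s ∈ Ico (0 : ℝ) (2 * p), ∀ t ∈ Ico (0 : ℝ) (2 * p),
        glued c p u n (s + k) = glued c p u n (t + k) → s ≠ t →
          s ∈ Icc (3 / 2 : ℝ) (2 * p - 1 / 2) := by
      intro n s hs t ht hst hne
      rcases h.glued_injective hp hadj n n hst with ⟨i, hi⟩ | ⟨m, hm⟩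
      · have hkl : (k : ℝ) = 2 * l + 1 := by exact_mod_cast hl
        have h1 : (l : ℝ) < i := by linarith [hs.1]
        have h1' : (l : ℤ) < i := by exact_mod_cast h1
        have h2 : (i : ℝ) < l + p + 1 := by linarith [hs.2]
        have h2' : i < l + p + 1 := by exact_mod_cast h2
        have h3 : (l : ℝ) + 1 ≤ i := by exact_mod_cast h1'
        have h4 : (i : ℝ) ≤ l + p := by exact_mod_cast Int.lt_add_one_iff.1 h2'
        constructor <;> linarith
      · exfalso
        have h1 : t - s = m * (2 * p) := by linarith
        have h2 : |t - s| < 2 * p := by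
          rw [abs_lt]; constructor <;> linarith [hs.1, hs.2, ht.1, ht.2]
        rw [h1, abs_mul, abs_of_pos (by linarith : (0 : ℝ) < 2 * p)] at h2
        have h3 : |(m : ℝ)| < 1 := by
          by_contra! h'
          nlinarith
        have h4 : m = 0 := by
          rw [← Int.cast_abs] at h3
          have : |m| < 1 := by exact_mod_cast h3
          exact Int.abs_lt_one_iff.1 this
        rw [h4] at h1
        simp only [Int.cast_zero, zero_mul] at h1
        exact hne (by linarith)
    have hck := h.continuous_glued k
    have hck' := h.continuous_glued (k + 1)
    refine isotopicSets_of_replace_arc (γ := fun x => glued c p u k (x + k))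
      (γ' := fun x => glued c p u (k + 1) (x + k)) (z := fun x => z (x + k)) (m := 2 * p)
      (by linarith) (by fun_prop) (by fun_prop) (by fun_prop) (hend k) (hend (k + 1))
      (by rw [zero_add, add_comm, hzp]) (fun t ht => ?_) (hcross k) (hcross (k + 1))
    rcases eq_or_lt_of_le ht.2 with rfl | hlt
    · rw [hend, hend, zero_add]
      have e := h.petalPolygon_eq_intCast k
      push_cast at e
      rcases glued_eq_or c p u k k with e1 | e1 <;>
        rcases glued_eq_or c p u (k + 1) k with e2 | e2 <;> rw [e1, e2] <;> simp [e]
    · refine hdiff _ fun hmod => ?_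
      have h1 : (k : ℤ) + 1 ≤ ⌊t + k⌋ := Int.le_floor.2 (by push_cast; linarith [ht.1])
      have h2 : ⌊t + k⌋ < k + 2 * p := Int.floor_lt.2 (by push_cast; linarith)
      have h3 := Int.emod_add_mul_ediv ⌊t + k⌋ (2 * p)
      rw [hmod] at h3
      set q := ⌊t + k⌋ / (2 * p : ℤ)
      have h4 : 0 < 2 * (p : ℤ) * q := by omega
      have h5 : 2 * (p : ℤ) * q < 2 * p * 1 := by omega
      have h6 := pos_of_mul_pos_right h4 (by omega)
      have h7 := lt_of_mul_lt_mul_left h5 (by omega)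
      omega

/-- A knot with a petal curve in normal form as its projection is isotopic to a polygon; the vertex
at each end of the `i`-th strand has the height of the strand. -/
theorem isotopicSets_petalPolygon {z : ℝ → ℝ} (hz : Continuous z)
    (hzp : Function.Periodic z (2 * p : ℝ)) :
    IsotopicSets (range fun x => (c x, z x))
      (range fun x => (petalPolygon u x, polyline
        (interleave (fun i : ℤ => z (2 * i + 1 / 2)) fun i : ℤ => z (2 * i + 1 / 2)) x)) := by
  have hp0 : (0 : ℝ) < 2 * p := by have : (0 : ℝ) < p := by exact_mod_cast h.pos
                                   linarith
  have h0 : glued c p u 0 = c := by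
    funext x
    rw [glued, if_neg]
    push_cast
    exact not_lt.2 (Int.emod_nonneg _ (by omega))
  have hfull : glued c p u (2 * p) = petalPolygon u := by
    funext x
    rw [glued, if_pos]
    push_cast
    exact Int.emod_lt_of_pos _ (by omega)
  have hsteps : ∀ k ≤ 2 * p, IsotopicSets (range fun x => (c x, z x))
      (range fun x => (glued c p u k x, z x)) := by
    intro k hk
    induction k with
    | zero => rw [h0]; exact IsotopicSets.refl _
    | succ k ih => exact (ih (by omega)).trans (h.isotopicSets_glued_succ hp hadj hz hzp k)
  have h1 := hsteps (2 * p) le_rfl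
  rw [hfull] at h1
  refine h1.trans ?_
  set η : ℤ → ℝ := fun i => z (2 * i + 1 / 2) with hη
  have hηp : ∀ i, η (i + p) = η i := fun i => by
    have := hzp (2 * i + 1 / 2)
    simp only [hη]
    rw [← this]
    congr 1
    push_cast
    ring
  have hζ : ∀ i : ℤ, polyline (interleave η η) (2 * i + 1 / 2) = η i := fun i => by
    rw [polyline_apply _ (n := 2 * i) (by push_cast; constructor <;> linarith),
      interleave_two_mul, interleave_two_mul_add_one]
    simp
  have hζp : Function.Periodic (polyline (interleave η η)) (2 * p : ℝ) := fun x => by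
    have := polyline_add_intCast (interleave_add_two_mul hηp hηp) x
    push_cast at this
    exact this
  have hper1 : Function.Periodic (fun x => (petalPolygon u x, z x)) (2 * p : ℝ) := fun x => by
    simp only [h.petalPolygon_periodic x, hzp x]
  have hper2 : Function.Periodic (fun x => (petalPolygon u x, polyline (interleave η η) x))
      (2 * p : ℝ) := fun x => by
    simp only [h.petalPolygon_periodic x, hζp x]
  rw [← hper1.range_Icc hp0 0, ← hper2.range_Icc hp0 0]
  have hc1 : Continuous (petalPolygon u) := continuous_polyline _
  have hc2 := continuous_polyline (interleave η η)
  refine isotopicSets_of_forall_sub_eq (γ := fun t : Icc (0 : ℝ) (2 * p) => petalPolygon u (t + 0))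
    (by fun_prop) (by fun_prop) (by fun_prop) ?_
  rintro ⟨s, hs⟩ ⟨t, ht⟩ hst
  simp only [add_zero] at hst ⊢
  rcases h.petalPolygon_injective hp hadj hst with h' | ⟨n, rfl⟩
  · obtain ⟨i, rfl⟩ := h.petalPolygon_eq_zero (by omega) h'
    obtain ⟨j, rfl⟩ := h.petalPolygon_eq_zero (by omega) (hst ▸ h')
    rw [hζ, hζ]
    simp [hη]
  · rw [hζp.int_mul n s, hzp.int_mul n s]

end Adjacent

end IsNormalPetalCurve

/-! ### Counting local maxima -/

theorem IsClosed.isClosed_connectedComponentIn {X : Type*} [TopologicalSpace X] {A : Set X}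
    (hA : IsClosed A) (x : X) : IsClosed (connectedComponentIn A x) := by
  by_cases hx : x ∈ A
  · refine isClosed_of_closure_subset ?_
    exact isPreconnected_connectedComponentIn.closure.subset_connectedComponentIn
      (subset_closure (mem_connectedComponentIn hx))
      (closure_minimal (connectedComponentIn_subset _ _) hA)
  · rw [connectedComponentIn_eq_empty hx]
    exact isClosed_empty

/-- A path that starts in the plateau of a local maximum and does not descend stays in it. -/
theorem mem_of_forall_le {f : UnitAddCircle → ℝ} (hf : Continuous f) {C : Set UnitAddCircle}
    (hC : C ∈ localMaxima f) {g : ℝ → UnitAddCircle} (hg : Continuous g) {a b : ℝ} (hab : a ≤ b)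
    (ha : g a ∈ C) (hle : ∀ x ∈ Icc a b, f (g a) ≤ f (g x)) : g b ∈ C := by
  obtain ⟨t, hCt, hev⟩ := hC
  have hcl : IsClosed C := by
    rw [hCt]
    exact (isClosed_singleton.preimage hf).isClosed_connectedComponentIn t
  have hCf : ∀ q ∈ C, f q = f t := fun q hq => by
    rw [hCt] at hq
    have : q ∈ f ⁻¹' {f t} := connectedComponentIn_subset _ _ hq
    exact this
  have hsub : Icc a b ⊆ g ⁻¹' C := by
    refine IsClosed.Icc_subset_of_forall_mem_nhdsWithin
      ((hcl.preimage hg).inter isClosed_Icc) ha ?_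
    rintro x ⟨hx, hxab⟩
    have h1 : ∀ᶠ q in 𝓝 (g x), q ∉ C → f q < f t :=
      hev.filter_mono (nhds_le_nhdsSet (show g x ∈ C from hx))
    have h2 : ∀ᶠ y in 𝓝[>] x, g y ∉ C → f (g y) < f t :=
      (hg.continuousAt.eventually h1).filter_mono nhdsWithin_le_nhds
    filter_upwards [h2, Ioo_mem_nhdsGT hxab.2] with y hy hyI
    by_contra hyC
    have := hle y ⟨hxab.1.trans hyI.1.le, hyI.2.le⟩
    rw [hCf _ ha] at this
    exact absurd (hy hyC) (not_lt.2 this)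
  exact hsub ⟨hab, le_rfl⟩

/-- A function on the circle that is monotone on each of `m` arcs, increasing on the arcs with
`s n = true` and decreasing on the others, has at most as many local maxima as there are places
where an increasing arc is followed by a decreasing one. -/
theorem encard_localMaxima_le {m : ℕ} (hm : 0 < m) {F : ℝ → ℝ} {s : ℤ → Bool}
    (hs : Function.Periodic s m)
    (hup : ∀ n : ℤ, s n = true → MonotoneOn F (Icc (n : ℝ) (n + 1)))
    (hdown : ∀ n : ℤ, s n = false → AntitoneOn F (Icc (n : ℝ) (n + 1)))
    (htrue : ∃ n, s n = true) (hfalse : ∃ n, s n = false) {f : UnitAddCircle → ℝ}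
    (hf : Continuous f) (hfF : ∀ x : ℝ, f (x : UnitAddCircle) = F (m * x)) :
    (localMaxima f).encard ≤
      ((Finset.range m).filter fun n : ℕ => s n = true ∧ s (n + 1) = false).card := by
  have hm' : (0 : ℝ) < m := by exact_mod_cast hm
  let π : ℝ → UnitAddCircle := fun y => ((y / m : ℝ) : UnitAddCircle)
  have hπ : Continuous π := (AddCircle.continuous_mk' 1).comp (by fun_prop)
  have hfπ : ∀ y, f (π y) = F y := fun y => by
    rw [hfF]
    congr 1
    field_simp
  have hπper : ∀ (y : ℝ) (k : ℤ), π (y + k * m) = π y := fun y k => by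
    have : (y + k * m) / m = y / m + k • (1 : ℝ) := by
      rw [zsmul_eq_mul, mul_one]
      field_simp
    simp only [π, this]
    rw [AddCircle.coe_add, AddCircle.coe_zsmul, AddCircle.coe_period, smul_zero, add_zero]
  have hex : ∀ b : Bool, (∃ n, s n = b) → ∀ k : ℤ,
      (∃ j : ℕ, s (k + j) = b) ∧ ∃ j : ℕ, s (k - j) = b := by
    rintro b ⟨n, hn⟩ k
    have hmZ : (0 : ℤ) < m := by exact_mod_cast hm
    constructor
    · refine ⟨((n - k) % m).toNat, ?_⟩
      rw [Int.toNat_of_nonneg (Int.emod_nonneg _ hmZ.ne')]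
      rw [← hn]
      refine hs.eq_of_dvd ?_
      have : k + (n - k) % m - n = -((n - k) - (n - k) % m) := by ring
      rw [this]
      exact (Int.dvd_self_sub_emod).neg_right
    · refine ⟨((k - n) % m).toNat, ?_⟩
      rw [Int.toNat_of_nonneg (Int.emod_nonneg _ hmZ.ne')]
      rw [← hn]
      refine hs.eq_of_dvd ?_
      have : k - (k - n) % m - n = (k - n) - (k - n) % m := by ring
      rw [this]
      exact Int.dvd_self_sub_emod
  have hpeak : ∀ C ∈ localMaxima f, ∃ n : ℤ, s n = true ∧ s (n + 1) = false ∧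
      π (n + 1 : ℝ) ∈ C := by
    intro C hC
    have hclimb : ∀ (k : ℤ) (y : ℝ), y ∈ Icc (k : ℝ) (k + 1) → π y ∈ C → s k = true →
        π (k + 1) ∈ C := fun k y hy hyC hk => by
      refine mem_of_forall_le hf hC hπ hy.2 hyC fun x hx => ?_
      rw [hfπ, hfπ]
      exact hup k hk hy ⟨hy.1.trans hx.1, hx.2⟩ hx.1
    have hclimb' : ∀ (k : ℤ) (y : ℝ), y ∈ Icc (k : ℝ) (k + 1) → π y ∈ C → s k = false →
        π k ∈ C := fun k y hy hyC hk => by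
      have := mem_of_forall_le hf hC (g := fun x => π (-x)) (a := -y) (b := -k) (by fun_prop)
        (neg_le_neg hy.1) (by simpa using hyC) (fun x hx => by
          rw [hfπ, hfπ, neg_neg]
          exact hdown k hk ⟨by linarith [hx.2], by linarith [hx.1, hy.2]⟩ hy (by linarith [hx.1]))
      simpa using this
    obtain ⟨t, ht, -⟩ := id hC
    obtain ⟨y₀, rfl⟩ := QuotientAddGroup.mk_surjective t
    obtain ⟨y, hy⟩ : ∃ y, π y = (y₀ : UnitAddCircle) := ⟨m * y₀, by
      simp only [π]; rw [mul_div_cancel_left₀ _ hm'.ne']⟩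
    have hyC : π y ∈ C := by
      rw [hy, ht]
      exact mem_connectedComponentIn rfl
    set k := ⌊y⌋
    have hyk : y ∈ Icc (k : ℝ) (k + 1) := ⟨Int.floor_le y, (Int.lt_floor_add_one y).le⟩
    cases hk : s k with
    | true =>
      have hj := (hex false hfalse k).1
      classical
      let j := Nat.find hj
      have hj1 : s (k + j) = false := Nat.find_spec hj
      have hj2 : ∀ i < j, s (k + i) = true := fun i hi => by
        simpa using Nat.find_min hj hi
      have hj0 : j ≠ 0 := fun h0 => by
        rw [h0] at hj1
        simp [hk] at hj1
      have hall : ∀ i, i < j → π ((k + i : ℤ) + 1 : ℝ) ∈ C := by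
        intro i
        induction i with
        | zero => exact fun _ => by simpa using hclimb k y hyk hyC hk
        | succ i ih =>
          intro hi
          refine hclimb (k + (i + 1 : ℕ)) ((k + i : ℤ) + 1 : ℝ) ?_ (ih (by omega)) (hj2 _ hi)
          push_cast
          constructor <;> linarith
      refine ⟨k + (j - 1 : ℕ), hj2 _ (by omega), ?_, hall _ (by omega)⟩
      rw [← hj1]
      congr 1
      omega
    | false =>
      have hj := (hex true htrue k).2
      classical
      let j := Nat.find hj
      have hj1 : s (k - j) = true := Nat.find_spec hj
      have hj2 : ∀ i < j, s (k - i) = false := fun i hi => by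
        simpa using Nat.find_min hj hi
      have hj0 : j ≠ 0 := fun h0 => by
        rw [h0] at hj1
        simp [hk] at hj1
      have hall : ∀ i, i < j → π ((k - i : ℤ) : ℝ) ∈ C := by
        intro i
        induction i with
        | zero => exact fun _ => by simpa using hclimb' k y hyk hyC hk
        | succ i ih =>
          intro hi
          refine hclimb' (k - (i + 1 : ℕ)) ((k - i : ℤ) : ℝ) ?_ (ih (by omega)) (hj2 _ hi)
          push_cast
          constructor <;> linarith
      refine ⟨k - j, hj1, ?_, ?_⟩
      · rw [← hj2 (j - 1) (by omega)]
        congr 1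
        omega
      · have := hall (j - 1) (by omega)
        convert this using 2
        push_cast [Nat.cast_sub (show 1 ≤ j by omega)]
        ring
  have hsub : localMaxima f ⊆ (fun n : ℕ => connectedComponentIn (f ⁻¹' {f (π (n + 1))})
      (π (n + 1))) '' ((Finset.range m).filter fun n : ℕ => s n = true ∧ s (n + 1) = false) := by
    intro C hC
    obtain ⟨n, h1, h2, h3⟩ := hpeak C hC
    have hmZ : (0 : ℤ) < m := by exact_mod_cast hm
    have hr0 := Int.emod_nonneg n hmZ.ne'
    have hcast : (((n % m).toNat : ℕ) : ℤ) = n % m := Int.toNat_of_nonneg hr0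
    have hdvd : (m : ℤ) ∣ n % m - n := by
      have : n % m - n = -(n - n % m) := by ring
      rw [this]
      exact (Int.dvd_self_sub_emod).neg_right
    refine ⟨(n % m).toNat, ?_, ?_⟩
    · simp only [Finset.coe_filter, Finset.mem_range]
      refine ⟨?_, ?_, ?_⟩
      · have := Int.emod_lt_of_pos n hmZ
        omega
      · rw [hcast, hs.eq_of_dvd hdvd, h1]
      · rw [hcast, hs.eq_of_dvd (i := n + 1) (by simpa using hdvd), h2]
    · have hq : π (((n % m).toNat : ℕ) + 1 : ℝ) = π (n + 1) := by
        have e : (((n % m).toNat : ℕ) : ℝ) = (n % m : ℤ) := by exact_mod_cast hcast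
        have e2 : (n : ℝ) = (n % m : ℤ) + (n / m : ℤ) * m := by
          have := Int.emod_add_mul_ediv n m
          have : (n : ℤ) = n % m + n / m * m := by linarith [mul_comm (n / m) (m : ℤ)]
          exact_mod_cast this
        rw [e, e2, add_right_comm, hπper]
      dsimp only
      rw [hq]
      obtain ⟨t, ht, -⟩ := hC
      rw [ht] at h3 ⊢
      have hv' : π (n + 1) ∈ f ⁻¹' {f t} := connectedComponentIn_subset _ _ h3
      have hv : f (π (n + 1)) = f t := hv'
      rw [hv]
      exact (connectedComponentIn_eq h3).symm
  refine (encard_le_encard hsub).trans ((encard_image_le _ _).trans ?_)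
  rw [encard_coe_eq_coe_finsetCard]

/-! ### Polygonal knots -/

/-- The polygonal knot with the vertices `W n`, where `n` is an integer modulo `m`. -/
noncomputable def polylineKnot (W : ℤ → E3) (m : ℕ) (hm : 0 < m) (hW : Function.Periodic W m)
    (hinj : ∀ s x : ℝ, polyline W s = polyline W x → ∃ n : ℤ, x = s + n * m) : Knot where
  toFun := Function.Periodic.lift (f := fun x : ℝ => polyline W (m * x)) (c := 1) fun x => by
    have := periodic_polyline hW (m * x)
    push_cast at this
    dsimp only
    rw [mul_add, mul_one, this]
  continuous_toFun := by
    refine (QuotientAddGroup.isQuotientMap_mk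
      (N := AddSubgroup.zmultiples (1 : ℝ))).continuous_iff.2 ?_
    exact (continuous_polyline W).comp (continuous_const.mul continuous_id)
  injective_toFun := by
    rintro ⟨s⟩ ⟨x⟩ hsx
    obtain ⟨n, hn⟩ := hinj _ _ hsx
    have hm' : (m : ℝ) ≠ 0 := by exact_mod_cast hm.ne'
    have : x = s + n • (1 : ℝ) := by
      rw [zsmul_eq_mul, mul_one]
      apply mul_left_cancel₀ hm'
      linear_combination hn
    change ((s : ℝ) : UnitAddCircle) = ((x : ℝ) : UnitAddCircle)
    rw [this, AddCircle.coe_add, AddCircle.coe_zsmul, AddCircle.coe_period, smul_zero, add_zero]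
  smooth_or_polygonal := by
    right
    have hm' : (0 : ℝ) < m := by exact_mod_cast hm
    refine ⟨m, fun k => (k : ℝ) / m, fun i j hij => ?_, by simp, by simp [hm'.ne'], fun i => ?_⟩
    · have : ((i : ℕ) : ℝ) ≤ (j : ℕ) := by exact_mod_cast hij
      simp only
      gcongr
    · refine ⟨W i - (i : ℝ) • (W (i + 1) - W i), (m : ℝ) • (W (i + 1) - W i), fun t ht => ?_⟩
      simp only [Fin.val_castSucc, Fin.val_succ, Nat.cast_add, Nat.cast_one, mem_Icc,
        div_le_iff₀ hm', le_div_iff₀ hm'] at ht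
      change polyline W (m * t) = _
      rw [polyline_apply W (n := (i : ℕ)) (by
        push_cast; constructor <;> linarith [ht.1, ht.2, mul_comm t (m : ℝ)])]
      rw [smul_smul, sub_smul, mul_comm t]
      push_cast
      abel

section PolylineKnot

variable {W : ℤ → E3} {m : ℕ} {hm : 0 < m} {hW : Function.Periodic W m}
  {hinj : ∀ s x : ℝ, polyline W s = polyline W x → ∃ n : ℤ, x = s + n * m}

theorem polylineKnot_coe (x : ℝ) :
    (polylineKnot W m hm hW hinj).toFun (x : UnitAddCircle) = polyline W (m * x) := rfl

theorem range_polylineKnot :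
    range (polylineKnot W m hm hW hinj).toFun = range (polyline W) := by
  have hm' : (m : ℝ) ≠ 0 := by exact_mod_cast hm.ne'
  ext y
  constructor
  · rintro ⟨⟨x⟩, rfl⟩
    exact ⟨m * x, rfl⟩
  · rintro ⟨x, rfl⟩
    exact ⟨((x / m : ℝ) : UnitAddCircle), by rw [polylineKnot_coe, mul_div_cancel₀ _ hm']⟩

/-- The signs `s n` tell whether the polygon rises or falls along its edges. On an edge orthogonal
to `v` either sign may be chosen. -/
theorem numLocalMaxima_polylineKnot_le {v : E3} {s : ℤ → Bool} (hs : Function.Periodic s m)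
    (hup : ∀ n, s n = true → inner ℝ v (W n) ≤ inner ℝ v (W (n + 1)))
    (hdown : ∀ n, s n = false → inner ℝ v (W (n + 1)) ≤ inner ℝ v (W n))
    (htrue : ∃ n, s n = true) (hfalse : ∃ n, s n = false) :
    (polylineKnot W m hm hW hinj).numLocalMaxima v ≤
      ((Finset.range m).filter fun n : ℕ => s n = true ∧ s (n + 1) = false).card := by
  have hF : ∀ {n : ℤ} {x : ℝ}, x ∈ Icc (n : ℝ) (n + 1) → inner ℝ v (polyline W x) =
      inner ℝ v (W n) + (x - n) * (inner ℝ v (W (n + 1)) - inner ℝ v (W n)) := fun hx => by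
    rw [polyline_apply W hx, inner_add_right, inner_smul_right, inner_sub_right]
  refine encard_localMaxima_le hm (F := fun x => inner ℝ v (polyline W x)) hs ?_ ?_ htrue hfalse ?_
    fun x => rfl
  · intro n hn x hx y hy hxy
    simp only [hF hx, hF hy]
    have := hup n hn
    nlinarith
  · intro n hn x hx y hy hxy
    simp only [hF hx, hF hy]
    have := hdown n hn
    nlinarith
  · have := (polylineKnot W m hm hW hinj).continuous_toFun
    fun_prop

end PolylineKnot

/-- The point of `E3` over `w` at the height `ζ`, as a linear map. -/
noncomputable def pointOver : ℂ × ℝ →ₗ[ℝ] E3 where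
  toFun := planeHeight.symm
  map_add' x y := by
    apply PiLp.ext
    intro i
    fin_cases i <;> simp [planeHeight]
  map_smul' r x := by
    apply PiLp.ext
    intro i
    fin_cases i <;> simp [planeHeight]

theorem pointOver_apply (x : ℂ × ℝ) : pointOver x = planeHeight.symm x := rfl

theorem polyline_prodMk {E F : Type*} [AddCommGroup E] [Module ℝ E] [AddCommGroup F] [Module ℝ F]
    (V : ℤ → E) (W : ℤ → F) (x : ℝ) :
    polyline (fun n => (V n, W n)) x = (polyline V x, polyline W x) := by
  simp [polyline]

theorem planeHeight_image_range_polyline (V : ℤ → ℂ) (η : ℤ → ℝ) :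
    planeHeight '' range (polyline fun n => pointOver (V n, η n)) =
      range fun x => (polyline V x, polyline η x) := by
  rw [← range_comp]
  congr 1
  funext x
  rw [Function.comp_apply, ← map_polyline pointOver, pointOver_apply, Homeomorph.apply_symm_apply,
    polyline_prodMk]

/-- The horizontal part of a vector. -/
noncomputable def horizontal (v : E3) : ℂ := ⟨v 0, v 1⟩

theorem inner_pointOver (v : E3) (w : ℂ) (ζ : ℝ) :
    inner ℝ v (pointOver (w, ζ)) = ((starRingEnd ℂ) (horizontal v) * w).re + v 2 * ζ := by
  rw [pointOver_apply, PiLp.inner_apply, Fin.sum_univ_three]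
  simp [planeHeight, horizontal]
  ring

/-! ### The local maxima of the petal polygon -/

/-- A linear form on the plane can be perturbed so that it does not vanish on finitely many given
vectors, without changing its signs on the vectors where it does not vanish already. -/
theorem exists_re_conj_mul_ne_zero {u : ℤ → ℂ} {p : ℕ} (hp : 0 < p) (hu : Function.Periodic u p)
    (hu0 : ∀ i, u i ≠ 0) (q : ℂ) : ∃ q' : ℂ, ∀ i, ((starRingEnd ℂ) q' * u i).re ≠ 0 ∧
      (0 < ((starRingEnd ℂ) q * u i).re → 0 < ((starRingEnd ℂ) q' * u i).re) ∧
      (((starRingEnd ℂ) q * u i).re < 0 → ((starRingEnd ℂ) q' * u i).re < 0) := by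
  wlog hq : q ≠ 0 generalizing q
  · obtain ⟨q', hq'⟩ := this 1 one_ne_zero
    rw [not_not] at hq
    exact ⟨q', fun i => ⟨(hq' i).1, by simp [hq], by simp [hq]⟩⟩
  let f : ℤ → ℝ := fun i => if ((starRingEnd ℂ) q * u i).re = 0 then 1 else
    |((starRingEnd ℂ) q * u i).re| / (|((starRingEnd ℂ) q * u i).im| + 1)
  have hfper : Function.Periodic f p := fun i => by simp only [f, hu i]
  have hfpos : ∀ i, 0 < f i := fun i => by
    simp only [f]
    split_ifs with h0
    · exact one_pos
    · exact div_pos (abs_pos.2 h0) (by positivity)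
  obtain ⟨ε, hε, hεf⟩ := exists_pos_forall_le_of_periodic hp hfper hfpos
  refine ⟨(1 + ε * Complex.I) * q, fun i => ?_⟩
  have e : ((starRingEnd ℂ) ((1 + ε * Complex.I) * q) * u i).re =
      ((starRingEnd ℂ) q * u i).re + ε * ((starRingEnd ℂ) q * u i).im := by
    simp
    ring
  have hne : (starRingEnd ℂ) q * u i ≠ 0 := mul_ne_zero (by simpa using hq) (hu0 i)
  have hi := hεf i
  simp only [f] at hi
  rw [e]
  generalize (starRingEnd ℂ) q * u i = w at hne hi
  by_cases h0 : w.re = 0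
  · refine ⟨?_, fun h => absurd h0 h.ne', fun h => absurd h0 h.ne⟩
    rw [h0, zero_add]
    exact mul_ne_zero hε.ne' fun h1 => hne (Complex.ext h0 h1)
  · rw [if_neg h0, le_div_iff₀ (by positivity)] at hi
    have h1 : |ε * w.im| < |w.re| := by
      rw [abs_mul, abs_of_pos hε]
      linarith
    rcases lt_or_gt_of_ne h0 with h | h
    · rw [abs_of_neg h, abs_lt] at h1
      exact ⟨by linarith, fun _ => by linarith, fun _ => by linarith⟩
    · rw [abs_of_pos h, abs_lt] at h1
      exact ⟨by linarith, fun _ => by linarith, fun _ => by linarith⟩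

/-- If a linear form has the same sign at `u i` and `u (i + 1)`, then its kernel meets the open
cone between `u i` and `-u (i + 1)`. Since these cones and their opposites are disjoint, this
happens for at most one `i` modulo `p`. -/
theorem IsNormalPetalCurve.dvd_of_same_sign {c : ℝ → ℂ} {p : ℕ} {u : ℤ → ℂ}
    (h : IsNormalPetalCurve c p u) (hp : 3 ≤ p)
    (hadj : ∀ (i j : ℤ) (ε : ℝ), (ε = 1 ∨ ε = -1) → ∀ α β : ℝ, 0 < α → 0 < β →
      (ε : ℂ) * u j ≠ α * u i + β * -u (i + 1))
    {q : ℂ} (hq : ∀ i, ((starRingEnd ℂ) q * u i).re ≠ 0) {i j : ℤ}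
    (hi : 0 < ((starRingEnd ℂ) q * u i).re ↔ 0 < ((starRingEnd ℂ) q * u (i + 1)).re)
    (hj : 0 < ((starRingEnd ℂ) q * u j).re ↔ 0 < ((starRingEnd ℂ) q * u (j + 1)).re) :
    (p : ℤ) ∣ j - i := by
  have hq0 : (starRingEnd ℂ) q ≠ 0 := fun h0 => hq 0 (by simp [h0])
  -- the multiples of `I * q` in the open cones
  have key : ∀ k : ℤ,
      (0 < ((starRingEnd ℂ) q * u k).re ↔ 0 < ((starRingEnd ℂ) q * u (k + 1)).re) →
      ∃ α β τ : ℝ, 0 < α ∧ 0 < β ∧ τ ≠ 0 ∧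
        (starRingEnd ℂ) q * (α * u k + β * -u (k + 1)) = τ * Complex.I := by
    intro k hk
    have h1 := hq k
    have h2 := hq (k + 1)
    have hα : 0 < |((starRingEnd ℂ) q * u (k + 1)).re| := abs_pos.2 h2
    have hβ : 0 < |((starRingEnd ℂ) q * u k).re| := abs_pos.2 h1
    set w := (starRingEnd ℂ) q * (|((starRingEnd ℂ) q * u (k + 1)).re| * u k +
      |((starRingEnd ℂ) q * u k).re| * -u (k + 1)) with hw
    have hre : w.re = 0 := by
      have e : w = ((|((starRingEnd ℂ) q * u (k + 1)).re| : ℝ) : ℂ) * ((starRingEnd ℂ) q * u k) -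
          ((|((starRingEnd ℂ) q * u k).re| : ℝ) : ℂ) * ((starRingEnd ℂ) q * u (k + 1)) := by
        rw [hw]; ring
      rw [e, Complex.sub_re, Complex.re_ofReal_mul, Complex.re_ofReal_mul]
      rcases lt_or_gt_of_ne h1 with h1' | h1'
      · have h2' : ((starRingEnd ℂ) q * u (k + 1)).re < 0 :=
          lt_of_le_of_ne (not_lt.1 fun h3 => absurd (hk.2 h3) h1'.not_gt) h2
        rw [abs_of_neg h1', abs_of_neg h2']
        ring
      · rw [abs_of_pos h1', abs_of_pos (hk.1 h1')]
        ring
    have hw0 : w ≠ 0 := mul_ne_zero hq0 fun h0 =>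
      hα.ne' (eq_zero_of_smul_add_smul_eq_zero (h.im_ne_zero (by omega) k) h0).1
    refine ⟨_, _, w.im, hα, hβ, fun him => hw0 (Complex.ext hre him), ?_⟩
    rw [← hw]
    apply Complex.ext <;> simp [hre]
  obtain ⟨α, β, τ, hα, hβ, hτ, e1⟩ := key i hi
  obtain ⟨α', β', τ', hα', hβ', hτ', e2⟩ := key j hj
  have hsign : ∃ ε : ℝ, (ε = 1 ∨ ε = -1) ∧ |τ'| * τ = ε * (|τ| * τ') := by
    rcases lt_or_gt_of_ne hτ with h1 | h1 <;> rcases lt_or_gt_of_ne hτ' with h2 | h2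
    · exact ⟨1, Or.inl rfl, by rw [abs_of_neg h1, abs_of_neg h2]; ring⟩
    · exact ⟨-1, Or.inr rfl, by rw [abs_of_neg h1, abs_of_pos h2]; ring⟩
    · exact ⟨-1, Or.inr rfl, by rw [abs_of_pos h1, abs_of_neg h2]; ring⟩
    · exact ⟨1, Or.inl rfl, by rw [abs_of_pos h1, abs_of_pos h2]; ring⟩
  obtain ⟨ε, hε, e3⟩ := hsign
  have e3' : ((|τ'| : ℝ) : ℂ) * τ = ε * (((|τ| : ℝ) : ℂ) * τ') := by exact_mod_cast e3
  refine h.dvd_of_cones_meet hp hadj hε (mul_pos (abs_pos.2 hτ') hα) (mul_pos (abs_pos.2 hτ') hβ)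
    (mul_pos (abs_pos.2 hτ) hα') (mul_pos (abs_pos.2 hτ) hβ') ?_
  apply mul_left_cancel₀ hq0
  push_cast
  linear_combination ((|τ'| : ℝ) : ℂ) * e1 - ε * ((|τ| : ℝ) : ℂ) * e2 + Complex.I * e3'

/-- A cyclic sequence of length `2 * p`, in which at most one pair of neighbouring even positions
agrees, changes at most `(p + 1) / 2` times from `true` to `false`. -/
theorem two_mul_card_le {s : ℤ → Bool} {p : ℕ} (hs : s (2 * p) = s 0)
    (hsame : ∀ i j : ℤ, s (2 * i) = s (2 * i + 1 + 1) → s (2 * j) = s (2 * j + 1 + 1) →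
      (p : ℤ) ∣ j - i) :
    2 * ((Finset.range (2 * p)).filter fun n : ℕ => s n = true ∧ s (n + 1) = false).card ≤
      p + 1 := by
  have key : ∀ k : ℕ, 2 * (∑ n ∈ Finset.range (2 * k),
      if s (n : ℕ) = true ∧ s ((n : ℕ) + 1) = false then 1 else 0) + (s (2 * k)).toNat ≤
      k + (s 0).toNat + ∑ i ∈ Finset.range k,
        if s (2 * (i : ℕ)) = s (2 * (i : ℕ) + 1 + 1) then 1 else 0 := by
    intro k
    induction k with
    | zero => simp
    | succ k ih =>
      rw [mul_add, Finset.sum_range_succ, Finset.sum_range_succ, Finset.sum_range_succ _ k]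
      have e : (2 * ((k + 1 : ℕ) : ℤ)) = 2 * k + 1 + 1 := by push_cast; ring
      rw [e]
      push_cast
      generalize s (2 * (k : ℤ)) = x at *
      generalize s (2 * (k : ℤ) + 1) = y at *
      generalize s (2 * (k : ℤ) + 1 + 1) = w at *
      cases x <;> cases y <;> cases w <;> simp at ih ⊢ <;> omega
  have h1 := key p
  have h2 : (∑ i ∈ Finset.range p, if s (2 * (i : ℕ)) = s (2 * (i : ℕ) + 1 + 1) then 1 else 0) ≤
      1 := by
    rw [← Finset.card_filter, Finset.card_le_one]
    intro i hi j hj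
    rw [Finset.mem_filter, Finset.mem_range] at hi hj
    have hd := Int.eq_zero_of_abs_lt_dvd (hsame i j hi.2 hj.2) (by rw [abs_lt]; omega)
    omega
  rw [hs] at h1
  rw [Finset.card_filter]
  omega

/-- A knot in normal form with at least three petals is isotopic to the polygon over
`petalPolygon u` with horizontal strands, which has at most `(p + 1) / 2` local maxima in each
direction. -/
theorem IsNormalPetalCurve.exists_equivalent_numLocalMaxima_le {c : ℝ → ℂ} {p : ℕ} {u : ℤ → ℂ}
    (h : IsNormalPetalCurve c p u) (hp : 3 ≤ p)
    (hadj : ∀ (i j : ℤ) (ε : ℝ), (ε = 1 ∨ ε = -1) → ∀ α β : ℝ, 0 < α → 0 < β →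
      (ε : ℂ) * u j ≠ α * u i + β * -u (i + 1))
    {z : ℝ → ℝ} (hz : Continuous z) (hzp : Function.Periodic z (2 * p : ℝ))
    (hzne : ∀ i j : ℤ, z (2 * i + 1 / 2) = z (2 * j + 1 / 2) → (p : ℤ) ∣ j - i)
    {K : Knot} (hK : IsotopicSets (planeHeight '' range K.toFun) (range fun x => (c x, z x))) :
    ∃ L : Knot, K.Equivalent L ∧ ∀ v, 2 * L.numLocalMaxima v ≤ p + 1 := by
  set η : ℤ → ℝ := fun i => z (2 * i + 1 / 2) with hη
  have hηp : Function.Periodic η p := fun i => by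
    have := hzp (2 * i + 1 / 2)
    simp only [hη]
    rw [← this]
    push_cast
    ring_nf
  have hup : ∀ i : ℤ, -u (i + p) = -u i := fun i => by rw [h.u_periodic i]
  set V : ℤ → ℂ := interleave (fun i => -u i) u with hV
  set Z : ℤ → ℝ := interleave η η with hZ
  have hVp : ∀ n, V (n + 2 * p) = V n := interleave_add_two_mul hup h.u_periodic
  have hZp : ∀ n, Z (n + 2 * p) = Z n := interleave_add_two_mul hηp hηp
  set W : ℤ → E3 := fun n => pointOver (V n, Z n) with hW
  have hZs : ∀ i : ℤ, polyline Z (2 * i + 1 / 2) = η i := fun i => by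
    rw [polyline_apply Z (n := 2 * i) (by push_cast; constructor <;> linarith), hZ,
      interleave_two_mul, interleave_two_mul_add_one, sub_self, smul_zero, add_zero]
  have hpoly : ∀ x, planeHeight (polyline W x) = (petalPolygon u x, polyline Z x) := fun x => by
    rw [hW, ← map_polyline pointOver, pointOver_apply, Homeomorph.apply_symm_apply,
      polyline_prodMk]
    rfl
  have hinj : ∀ s x : ℝ, polyline W s = polyline W x →
      ∃ n : ℤ, x = s + n * ((2 * p : ℕ) : ℝ) := by
    intro s x hsx
    have := congrArg planeHeight hsx
    rw [hpoly, hpoly, Prod.mk.injEq] at this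
    obtain ⟨e1, e2⟩ := this
    push_cast
    rcases h.petalPolygon_injective hp hadj e1 with h0 | h0
    · obtain ⟨i, rfl⟩ := h.petalPolygon_eq_zero (by omega) h0
      obtain ⟨j, rfl⟩ := h.petalPolygon_eq_zero (by omega) (e1.symm.trans h0)
      rw [hZs, hZs] at e2
      exact exists_eq_add_of_dvd (hzne i j e2) (by ring)
    · exact h0
  have hWp : Function.Periodic W ((2 * p : ℕ) : ℤ) := fun n => by
    push_cast
    simp only [hW, hVp, hZp]
  refine ⟨polylineKnot W (2 * p) (by omega) hWp hinj, ?_, fun v => ?_⟩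
  · rw [Knot.Equivalent, ambientIsotopic_iff_isotopicSets, range_polylineKnot]
    refine hK.trans ((h.isotopicSets_petalPolygon hp hadj hz hzp).trans ?_)
    rw [hW, planeHeight_image_range_polyline]
    exact IsotopicSets.refl _
  · obtain ⟨q, hq⟩ := exists_re_conj_mul_ne_zero h.pos h.u_periodic h.u_ne_zero (horizontal v)
    set σ : ℤ → Bool := fun i => decide (0 < ((starRingEnd ℂ) q * u i).re) with hσ
    set ρ : ℤ → Bool := fun i =>
      decide (inner ℝ v (W (2 * i + 1)) ≤ inner ℝ v (W (2 * i + 1 + 1))) with hρ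
    set s : ℤ → Bool := interleave σ ρ with hs
    have hσp : ∀ i, σ (i + p) = σ i := fun i => by simp only [hσ, h.u_periodic i]
    have hρp : ∀ i, ρ (i + p) = ρ i := fun i => by
      have e1 : 2 * (i + p) + 1 = 2 * i + 1 + ((2 * p : ℕ) : ℤ) := by push_cast; ring
      have e2 : 2 * (i + p) + 1 + 1 = 2 * i + 1 + 1 + ((2 * p : ℕ) : ℤ) := by push_cast; ring
      simp only [hρ]
      rw [e2, hWp, e1, hWp]
    have hsp : ∀ n, s (n + 2 * p) = s n := interleave_add_two_mul hσp hρp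
    have hAB : ∀ i, inner ℝ v (W (2 * i + 1)) - inner ℝ v (W (2 * i)) =
        2 * ((starRingEnd ℂ) (horizontal v) * u i).re := fun i => by
      simp only [hW, hV, hZ, interleave_two_mul, interleave_two_mul_add_one, inner_pointOver,
        mul_neg, Complex.neg_re]
      ring
    have hsame : ∀ i j : ℤ, s (2 * i) = s (2 * i + 1 + 1) → s (2 * j) = s (2 * j + 1 + 1) →
        (p : ℤ) ∣ j - i := by
      intro i j hi hj
      simp only [hs, interleave_two_mul, interleave_two_mul_add_two, hσ, decide_eq_decide] at hi hj
      exact h.dvd_of_same_sign hp hadj (fun i => (hq i).1) hi hj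
    -- the strands `0`, `1`, `2` do not all have the same direction
    have hboth : ∀ b : Bool, ∃ n, s n = b := by
      intro b
      by_contra! hb
      have hb' : ∀ n m, s n = s m := fun n m => by
        have h1 := hb n
        have h2 := hb m
        revert h1 h2
        generalize s n = x
        generalize s m = y
        cases x <;> cases y <;> cases b <;> simp
      have := Int.le_of_dvd one_pos (by simpa using hsame 0 1 (hb' _ _) (hb' _ _))
      omega
    have hle := numLocalMaxima_polylineKnot_le (m := 2 * p) (hm := by omega) (hW := hWp)
      (hinj := hinj) (v := v) (s := s) (fun n => by push_cast; exact hsp n)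
      (fun n hn => ?_) (fun n hn => ?_) (hboth true) (hboth false)
    · have hcard := two_mul_card_le (s := s) (p := p) (by simpa using hsp 0) hsame
      refine (mul_le_mul_right hle 2).trans ?_
      exact_mod_cast hcard
    · induction n using forall_int_of_interleave with
      | h0 i =>
        rw [hs, interleave_two_mul, hσ, decide_eq_true_eq] at hn
        have h1 : 0 ≤ ((starRingEnd ℂ) (horizontal v) * u i).re := by
          by_contra! h1
          exact absurd ((hq i).2.2 h1) hn.not_gt
        linarith [hAB i]
      | h1 i =>
        rw [hs, interleave_two_mul_add_one, hρ, decide_eq_true_eq] at hn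
        exact hn
    · induction n using forall_int_of_interleave with
      | h0 i =>
        rw [hs, interleave_two_mul, hσ, decide_eq_false_iff_not] at hn
        have h1 : ((starRingEnd ℂ) (horizontal v) * u i).re ≤ 0 := by
          by_contra! h1
          exact hn ((hq i).2.1 h1)
        linarith [hAB i]
      | h1 i =>
        rw [hs, interleave_two_mul_add_one, hρ, decide_eq_false_iff_not] at hn
        exact (not_le.1 hn).le

/-! ### Curves with at most two petals -/

/-- The vertices `u`, `I * u`, `-u` of a triangle, and the midpoint of the side from `-u` to
`u`. -/
noncomputable def triangleVertex (u : ℂ) (n : ℤ) : ℂ :=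
  if n % 4 = 0 then u else if n % 4 = 1 then Complex.I * u else if n % 4 = 2 then -u else 0

theorem triangleVertex_add_four (u : ℂ) (n : ℤ) :
    triangleVertex u (n + 4) = triangleVertex u n := by
  simp [triangleVertex]

theorem polyline_triangleVertex (u : ℂ) {t : ℝ} (ht : t ∈ Icc (0 : ℝ) 4) :
    polyline (triangleVertex u) t =
      ((|t - 2| - 1 : ℝ) + (max 0 (1 - |t - 1|) : ℝ) * Complex.I) * u := by
  rcases le_total t 1 with h1 | h1
  · rw [polyline_apply _ (n := 0) (by push_cast; exact ⟨ht.1, by linarith⟩),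
      abs_of_nonpos (by linarith : t - 2 ≤ 0), abs_of_nonpos (by linarith : t - 1 ≤ 0),
      max_eq_right (by linarith [ht.1])]
    simp [triangleVertex]
    ring
  rcases le_total t 2 with h2 | h2
  · rw [polyline_apply _ (n := 1) (by push_cast; exact ⟨h1, by linarith⟩),
      abs_of_nonpos (by linarith : t - 2 ≤ 0), abs_of_nonneg (by linarith : 0 ≤ t - 1),
      max_eq_right (by linarith)]
    simp [triangleVertex]
    ring
  rw [abs_of_nonneg (by linarith : 0 ≤ t - 2), abs_of_nonneg (by linarith : 0 ≤ t - 1),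
    max_eq_left (by linarith)]
  rcases le_total t 3 with h3 | h3
  · rw [polyline_apply _ (n := 2) (by push_cast; exact ⟨h2, by linarith⟩)]
    simp [triangleVertex]
    ring
  · rw [polyline_apply _ (n := 3) (by push_cast; exact ⟨h3, by linarith [ht.2]⟩)]
    simp [triangleVertex]
    exact Or.inl (by ring)

theorem polyline_triangleVertex_injOn {u : ℂ} (hu : u ≠ 0) :
    InjOn (polyline (triangleVertex u)) (Ico (0 : ℝ) 4) := by
  intro s hs t ht h
  rw [polyline_triangleVertex u ⟨hs.1, hs.2.le⟩, polyline_triangleVertex u ⟨ht.1, ht.2.le⟩] at h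
  have h' := mul_right_cancel₀ hu h
  have hre := congrArg Complex.re h'
  have him := congrArg Complex.im h'
  simp only [Complex.add_re, Complex.ofReal_re, Complex.re_ofReal_mul, Complex.I_re, mul_zero,
    add_zero, Complex.add_im, Complex.ofReal_im, Complex.im_ofReal_mul, Complex.I_im, mul_one,
    zero_add] at hre him
  obtain ⟨hs0, hs4⟩ := hs
  obtain ⟨ht0, ht4⟩ := ht
  rcases abs_cases (s - 2) with ⟨e1, _⟩ | ⟨e1, _⟩ <;>
    rcases abs_cases (t - 2) with ⟨e2, _⟩ | ⟨e2, _⟩ <;> rw [e1, e2] at hre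
  · linarith
  · rw [max_eq_left (by rw [abs_of_nonneg] <;> linarith)] at him
    have : 0 < 1 - |t - 1| := by
      rw [sub_pos, abs_lt]; constructor <;> linarith
    rw [max_eq_right this.le] at him
    linarith
  · rw [max_comm, max_comm 0, max_eq_right (a := 1 - |t - 1|)
      (by rw [abs_of_nonneg] <;> linarith)] at him
    have : 0 < 1 - |s - 1| := by
      rw [sub_pos, abs_lt]; constructor <;> linarith
    rw [max_eq_left this.le] at him
    linarith
  · linarith

theorem polyline_triangleVertex_injective {u : ℂ} (hu : u ≠ 0) {s x : ℝ}
    (h : polyline (triangleVertex u) s = polyline (triangleVertex u) x) :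
    ∃ n : ℤ, x = s + n * 4 := by
  have hper : ∀ y : ℝ, ∃ n : ℤ, y - n * 4 ∈ Ico (0 : ℝ) 4 ∧
      polyline (triangleVertex u) (y - n * 4) = polyline (triangleVertex u) y := fun y => by
    refine ⟨⌊y / 4⌋, ⟨?_, ?_⟩, ?_⟩
    · linarith [Int.floor_le (y / 4)]
    · linarith [Int.lt_floor_add_one (y / 4)]
    · have hp := periodic_polyline (V := triangleVertex u) (m := 4) (triangleVertex_add_four u)
      push_cast at hp
      exact hp.sub_int_mul_eq _
  obtain ⟨n, hn, en⟩ := hper s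
  obtain ⟨k, hk, ek⟩ := hper x
  have := polyline_triangleVertex_injOn hu hn hk (by rw [en, ek, h])
  refine ⟨k - n, ?_⟩
  push_cast
  linarith

theorem pointOver_triangleVertex_periodic (u : ℂ) :
    Function.Periodic (fun n => pointOver (triangleVertex u n, 0)) ((4 : ℕ) : ℤ) := fun n => by
  push_cast
  rw [triangleVertex_add_four]

theorem polyline_pointOver_triangleVertex_injective {u : ℂ} (hu : u ≠ 0) (s x : ℝ)
    (hsx : polyline (fun n => pointOver (triangleVertex u n, 0)) s =
      polyline (fun n => pointOver (triangleVertex u n, 0)) x) :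
    ∃ n : ℤ, x = s + n * ((4 : ℕ) : ℝ) := by
  have := congrArg planeHeight hsx
  rw [← map_polyline pointOver, ← map_polyline pointOver, pointOver_apply, pointOver_apply,
    Homeomorph.apply_symm_apply, Homeomorph.apply_symm_apply, polyline_prodMk,
    polyline_prodMk, Prod.mk.injEq] at this
  exact_mod_cast polyline_triangleVertex_injective hu this.1

/-- The triangle, seen as a polygon with four vertices, one of them on a side. -/
noncomputable def triangleKnot {u : ℂ} (hu : u ≠ 0) : Knot :=
  polylineKnot (fun n => pointOver (triangleVertex u n, 0)) 4 (by norm_num)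
    (pointOver_triangleVertex_periodic u) (polyline_pointOver_triangleVertex_injective hu)

theorem planeHeight_image_range_triangleKnot {u : ℂ} (hu : u ≠ 0) :
    planeHeight '' range (triangleKnot hu).toFun =
      range fun x => (polyline (triangleVertex u) x, (0 : ℝ)) := by
  rw [triangleKnot, range_polylineKnot,
    planeHeight_image_range_polyline (triangleVertex u) fun _ => 0]
  congr 1
  funext x
  simp [polyline]

/-- The triangle has only one local maximum in each direction. -/
theorem numLocalMaxima_triangleKnot_le {u : ℂ} (hu : u ≠ 0) (v : E3) :
    (triangleKnot hu).numLocalMaxima v ≤ 1 := by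
  set a : ℝ := ((starRingEnd ℂ) (horizontal v) * u).re with ha
  set b : ℝ := ((starRingEnd ℂ) (horizontal v) * (Complex.I * u)).re with hb
  have hin : ∀ w : ℂ, inner ℝ v (pointOver (w, 0)) = ((starRingEnd ℂ) (horizontal v) * w).re :=
    fun w => by rw [inner_pointOver, mul_zero, add_zero]
  set s : ℤ → Bool := fun n => if n % 4 = 0 then decide (a ≤ b) else
    if n % 4 = 1 then decide (b < -a) else decide (0 ≤ a) with hs
  have hcases : ∀ {P : ℤ → Prop}, (∀ n, P (4 * n)) → (∀ n, P (4 * n + 1)) →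
      (∀ n, P (4 * n + 2)) → (∀ n, P (4 * n + 3)) → ∀ n, P n := fun h0 h1 h2 h3 n => by
    have h4 : n = 4 * (n / 4) ∨ n = 4 * (n / 4) + 1 ∨ n = 4 * (n / 4) + 2 ∨
      n = 4 * (n / 4) + 3 := by omega
    rcases h4 with h | h | h | h <;> rw [h]
    exacts [h0 _, h1 _, h2 _, h3 _]
  have hmod : ∀ n : ℤ, (4 * n) % 4 = 0 ∧ (4 * n + 1) % 4 = 1 ∧ (4 * n + 1 + 1) % 4 = 2 ∧
      (4 * n + 2) % 4 = 2 ∧ (4 * n + 2 + 1) % 4 = 3 ∧ (4 * n + 3) % 4 = 3 ∧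
      (4 * n + 3 + 1) % 4 = 0 := fun n => by omega
  have hV : ∀ n : ℤ, triangleVertex u (4 * n) = u ∧ triangleVertex u (4 * n + 1) = Complex.I * u ∧
      triangleVertex u (4 * n + 1 + 1) = -u ∧ triangleVertex u (4 * n + 2) = -u ∧
      triangleVertex u (4 * n + 2 + 1) = 0 ∧ triangleVertex u (4 * n + 3) = 0 ∧
      triangleVertex u (4 * n + 3 + 1) = u := fun n => by simp [triangleVertex, hmod n]
  have hsV : ∀ n : ℤ, s (4 * n) = decide (a ≤ b) ∧ s (4 * n + 1) = decide (b < -a) ∧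
      s (4 * n + 2) = decide (0 ≤ a) ∧ s (4 * n + 3) = decide (0 ≤ a) := fun n => by
    simp [hs, hmod n]
  have hneg : ((starRingEnd ℂ) (horizontal v) * -u).re = -a := by
    rw [mul_neg, Complex.neg_re]
  have hzero : ((starRingEnd ℂ) (horizontal v) * 0).re = 0 := by
    rw [mul_zero, Complex.zero_re]
  have hle := numLocalMaxima_polylineKnot_le (W := fun n => pointOver (triangleVertex u n, 0))
    (m := 4) (hm := by norm_num) (hW := pointOver_triangleVertex_periodic u)
    (hinj := polyline_pointOver_triangleVertex_injective hu)
    (v := v) (s := s) (fun n => by simp [hs]) ?_ ?_ ?_ ?_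
  · refine hle.trans ?_
    have hcount : ∀ x y w : Bool, ((Finset.range 4).filter fun n : ℕ =>
        (if (n : ℤ) % 4 = 0 then x else if (n : ℤ) % 4 = 1 then y else w) = true ∧
        (if ((n : ℤ) + 1) % 4 = 0 then x else if ((n : ℤ) + 1) % 4 = 1 then y else w) =
          false).card ≤ 1 := by
      decide
    exact_mod_cast hcount _ _ _
  · refine hcases (fun n => ?_) (fun n => ?_) (fun n => ?_) fun n => ?_ <;>
      simp only [hsV n, hin, hV n, ← ha, ← hb, hneg, hzero, decide_eq_true_eq] <;>
        intro h <;> linarith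
  · refine hcases (fun n => ?_) (fun n => ?_) (fun n => ?_) fun n => ?_ <;>
      simp only [hsV n, hin, hV n, ← ha, ← hb, hneg, hzero, decide_eq_false_iff_not] <;>
        intro h <;> linarith
  · by_contra! h
    have h0 := h 0
    have h1 := h 1
    have h2 := h 2
    simp [hs] at h0 h1 h2
    linarith
  · by_contra! h
    have h0 := h 0
    have h1 := h 1
    have h2 := h 2
    simp [hs] at h0 h1 h2
    linarith

/-- A curve with at most two petals is isotopic to a triangle: all of it but the lower strand can
be contracted above the lower strand. -/
theorem IsNormalPetalCurve.exists_equivalent_of_le_two {c : ℝ → ℂ} {p : ℕ} {u : ℤ → ℂ}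
    (h : IsNormalPetalCurve c p u) (hp : p ≤ 2)
    {z : ℝ → ℝ} (hz : Continuous z) (hzp : Function.Periodic z (2 * p : ℝ))
    (hzne : ∀ i j : ℤ, z (2 * i + 1 / 2) = z (2 * j + 1 / 2) → (p : ℤ) ∣ j - i)
    {K : Knot} (hK : IsotopicSets (planeHeight '' range K.toFun) (range fun x => (c x, z x))) :
    ∃ L : Knot, K.Equivalent L ∧ ∀ v, 2 * L.numLocalMaxima v ≤ p + 1 := by
  have hp0 := h.pos
  have hp1 : (1 : ℝ) ≤ p := by exact_mod_cast hp0
  -- the strand `k` is the lower one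
  obtain ⟨k, hk⟩ : ∃ k : ℤ, p = 2 → z (9 / 2 + 2 * k) < z (5 / 2 + 2 * k) := by
    by_cases hp2 : p = 2
    · subst hp2
      have hne : z (5 / 2) ≠ z (9 / 2) := fun he => by
        have h2 := hzne 1 2 (by norm_num; exact he)
        norm_num at h2
      rcases lt_or_gt_of_ne hne with hlt | hlt
      · refine ⟨1, fun _ => ?_⟩
        have := hzp (5 / 2)
        norm_num at this ⊢
        rw [this]
        exact hlt
      · exact ⟨0, fun _ => by simpa using hlt⟩
    · exact ⟨0, fun h2 => absurd h2 hp2⟩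
  -- `φ` maps `[1, 2]` to the lower strand and `[0, 1]` to the rest of the curve
  set φ : ℝ → ℝ := fun t => min (1 + (2 * p - 1) * t) (t + (2 * p - 1)) with hφ
  have hφc : Continuous φ := by fun_prop
  have hφ1 : ∀ t ≤ 1, φ t = 1 + (2 * p - 1) * t := fun t ht => min_eq_left (by nlinarith)
  have hφ2 : ∀ t, 1 ≤ t → φ t = t + (2 * p - 1) := fun t ht => min_eq_right (by nlinarith)
  have hφm : StrictMono φ := fun s t hst => by
    refine lt_min ((min_le_left _ _).trans_lt ?_) ((min_le_right _ _).trans_lt ?_)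
    · nlinarith
    · linarith
  have hφ00 : φ 0 = 1 := by rw [hφ1 0 zero_le_one]; ring
  have hφ22 : φ 2 = 1 + 2 * p := by rw [hφ2 2 one_le_two]; ring
  have hφI : ∀ t ∈ Ico (0 : ℝ) 2, φ t ∈ Ico (1 : ℝ) (1 + 2 * p) := fun t ht =>
    ⟨hφ00 ▸ hφm.monotone ht.1, hφ22 ▸ hφm ht.2⟩
  have hrange : (range fun x => (c x, z x)) =
      range fun t : Icc (0 : ℝ) 2 => (c (φ t + 2 * k), z (φ t + 2 * k)) := by
    have hper : Function.Periodic (fun x => (c x, z x)) (2 * p : ℝ) := fun x => by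
      simp only [h.periodic x, hzp x]
    apply Subset.antisymm
    · rw [← hper.image_Icc (by linarith) (1 + 2 * k)]
      rintro _ ⟨x, hx, rfl⟩
      obtain ⟨t, ht, htx⟩ := intermediate_value_Icc zero_le_two hφc.continuousOn
        (show x - 2 * k ∈ Icc (φ 0) (φ 2) by
          rw [hφ00, hφ22]; exact ⟨by linarith [hx.1], by linarith [hx.2]⟩)
      exact ⟨⟨t, ht⟩, by simp only [htx, sub_add_cancel]⟩
    · rintro _ ⟨t, rfl⟩
      exact ⟨φ t + 2 * k, rfl⟩
  have hzero : ∀ t ∈ Ico (0 : ℝ) 2, c (φ t + 2 * k) = 0 → t = 3 / 2 ∨ (p = 2 ∧ t = 1 / 2) := by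
    intro t ht h0
    obtain ⟨i, hi⟩ := h.eq_of_apply_eq_zero h0
    have hI := hφI t ht
    have hi' : φ t = 2 * ((i - k : ℤ) : ℝ) + 1 / 2 := by push_cast; linarith
    generalize i - k = l at hi'
    have hl0 : 0 < l := by
      have : (0 : ℝ) < l := by linarith [hI.1]
      exact_mod_cast this
    have hl1 : l ≤ p := by
      have : (l : ℝ) < p + 1 := by linarith [hI.2]
      have : l < p + 1 := by exact_mod_cast this
      omega
    have h32 : φ (3 / 2) = 2 * p + 1 / 2 := by rw [hφ2 _ (by norm_num)]; ring
    by_cases hlp : l = p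
    · left
      apply hφm.injective
      rw [hi', h32, hlp]
      simp
    · right
      have hp2 : p = 2 := by omega
      have hl : l = 1 := by omega
      refine ⟨hp2, hφm.injective ?_⟩
      rw [hi', hl, hφ1 _ (by norm_num), hp2]
      norm_num
  have hu := h.u_ne_zero k
  refine ⟨triangleKnot hu, ?_, fun v => ?_⟩
  · rw [Knot.Equivalent, ambientIsotopic_iff_isotopicSets,
      planeHeight_image_range_triangleKnot hu]
    refine hK.trans ?_
    have hVper : Function.Periodic (polyline (triangleVertex (u k))) 4 := by
      have := periodic_polyline (V := triangleVertex (u k)) (m := 4)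
        (triangleVertex_add_four (u k))
      exact_mod_cast this
    have htri : (range fun x => (polyline (triangleVertex (u k)) x, (0 : ℝ))) =
        range fun t : Icc (0 : ℝ) 2 => (polyline (triangleVertex (u k)) (2 * t), (0 : ℝ)) := by
      apply Subset.antisymm
      · have hper : Function.Periodic (fun x => (polyline (triangleVertex (u k)) x, (0 : ℝ))) 4 :=
          fun x => by simp only [hVper x]
        rw [← hper.image_Icc (by norm_num) 0]
        rintro _ ⟨x, hx, rfl⟩
        refine ⟨⟨x / 2, by linarith [hx.1], by linarith [hx.2]⟩, ?_⟩
        simp only [mul_div_cancel₀ x two_ne_zero]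
      · rintro _ ⟨t, rfl⟩
        exact ⟨2 * t, rfl⟩
    rw [hrange, htri]
    have hφ20 : φ 2 = φ 0 + 2 * p := by rw [hφ00, hφ22]
    refine isotopicSets_planar_of_over (γ := fun t => c (φ t + 2 * k))
      (γ' := fun t => polyline (triangleVertex (u k)) (2 * t)) (z := fun t => z (φ t + 2 * k))
      (h.continuous.comp (by fun_prop)) ((continuous_polyline _).comp (by fun_prop))
      (hz.comp (by fun_prop)) ?_ ?_ ?_ ?_ (1 / 2) ⟨by norm_num, by norm_num⟩ ?_ ?_
    · rw [hφ20, add_right_comm, h.periodic]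
    · have := hVper (2 * 0)
      norm_num at this ⊢
      exact this
    · rw [hφ20, add_right_comm, hzp]
    · intro t ht
      have e : φ t + 2 * k = (t - 1 + 2 * k) + 2 * p := by rw [hφ2 t ht.1]; ring
      rw [polyline_triangleVertex _ ⟨by linarith [ht.1], by linarith [ht.2]⟩, e, h.periodic,
        h.strand k _ ⟨by linarith [ht.1], by linarith [ht.2]⟩, abs_of_nonneg (by linarith [ht.1]),
        abs_of_nonneg (by linarith [ht.1]), max_eq_left (by linarith [ht.1])]
      push_cast
      ring
    · intro s hs t ht hst hlt
      by_cases h0 : c (φ s + 2 * k) = 0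
      · have ht0 := hzero t ht (hst ▸ h0)
        rcases hzero s hs h0 with rfl | ⟨hp2, rfl⟩
        · rcases ht0 with rfl | ⟨-, rfl⟩
          · exact absurd hlt (lt_irrefl _)
          · norm_num at hlt
        · rcases ht0 with rfl | ⟨-, rfl⟩
          · refine ⟨rfl, rfl, ?_⟩
            have := hk hp2
            rw [hφ2 _ (by norm_num), hφ1 _ (by norm_num), hp2]
            norm_num at this ⊢
            exact this
          · exact absurd hlt (lt_irrefl _)
      · exfalso
        obtain ⟨n, hn⟩ := h.injective _ _ hst h0
        have h1 := hφI s hs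
        have h2 := hφI t ht
        have h3 := hφm hlt
        have h4 : φ t = φ s + n * (2 * p) := by linarith
        have h5 : (0 : ℝ) < n := by
          by_contra! hn0
          nlinarith
        have h6 : (1 : ℝ) ≤ n := by exact_mod_cast Int.add_one_le_iff.2 (Int.cast_pos.1 h5)
        nlinarith [h1.1, h2.2]
    · intro s hs t ht hst
      have := polyline_triangleVertex_injOn hu ⟨by linarith [hs.1], by linarith [hs.2]⟩
        ⟨by linarith [ht.1], by linarith [ht.2]⟩ hst
      linarith
  · have h1 := mul_le_mul_right (numLocalMaxima_triangleKnot_le hu v) 2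
    refine h1.trans ?_
    have : 2 * 1 ≤ p + 1 := by omega
    exact_mod_cast this

/-! ### The petal curve of a petal projection -/

/-- A function that is affine on both sides of a point and differentiable there is affine near the
point. -/
theorem hasStrictDerivAt_of_affine_left_right {E : Type*} [NormedAddCommGroup E] [NormedSpace ℝ E]
    {f : ℝ → E} {a b a' b' d : E} {t ε : ℝ} (hε : 0 < ε)
    (hr : ∀ s ∈ Icc t (t + ε), f s = a + s • b) (hl : ∀ s ∈ Icc (t - ε) t, f s = a' + s • b')
    (hd : HasDerivAt f d t) : HasStrictDerivAt f d t := by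
  have haff : ∀ a b : E, HasDerivAt (fun s : ℝ => a + s • b) b t := fun a b => by
    simpa using ((hasDerivAt_id t).smul_const b).const_add a
  have hb : b = d := by
    have h1 : HasDerivWithinAt f b (Icc t (t + ε)) t :=
      ((haff a b).hasDerivWithinAt).congr hr (hr t ⟨le_rfl, by linarith⟩)
    exact (uniqueDiffOn_Icc (by linarith) t ⟨le_rfl, by linarith⟩).eq_deriv _ h1
      hd.hasDerivWithinAt
  have hb' : b' = d := by
    have h1 : HasDerivWithinAt f b' (Icc (t - ε) t) t :=
      ((haff a' b').hasDerivWithinAt).congr hl (hl t ⟨by linarith, le_rfl⟩)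
    exact (uniqueDiffOn_Icc (by linarith) t ⟨by linarith, le_rfl⟩).eq_deriv _ h1
      hd.hasDerivWithinAt
  subst hb hb'
  have ha : a' = a := by
    have h1 := hl t ⟨by linarith, le_rfl⟩
    rw [hr t ⟨le_rfl, by linarith⟩] at h1
    exact (add_right_cancel h1).symm
  have hstrict : HasStrictDerivAt (fun s : ℝ => a + s • b') b' t := by
    simpa using ((hasStrictDerivAt_id t).smul_const b').const_add a
  refine hstrict.congr_of_eventuallyEq ?_
  filter_upwards [Icc_mem_nhds (by linarith : t - ε < t) (by linarith : t < t + ε)] with s hs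
  rcases le_total s t with h | h
  · rw [hl s ⟨hs.1, h⟩, ha]
  · rw [hr s ⟨h, hs.2⟩]

theorem coe_unitAddCircle_eq_iff {s x : ℝ} :
    (s : UnitAddCircle) = (x : UnitAddCircle) ↔ ∃ n : ℤ, x = s + n := by
  rw [eq_comm, ← sub_eq_zero, ← AddCircle.coe_sub, AddCircle.coe_eq_zero_iff]
  simp only [zsmul_eq_mul, mul_one]
  exact exists_congr fun n => ⟨fun h => by linarith, fun h => by linarith⟩

/-- A polygonal curve is affine to the right and to the left of each parameter. -/
theorem IsPolygonalCurve.exists_affine {f : UnitAddCircle → E3} (hf : IsPolygonalCurve f) (t : ℝ) :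
    ∃ ε > 0, ∃ a b a' b' : E3, (∀ s ∈ Icc t (t + ε), f (s : UnitAddCircle) = a + s • b) ∧
      ∀ s ∈ Icc (t - ε) t, f (s : UnitAddCircle) = a' + s • b' := by
  obtain ⟨n, τ, -, h0, h1, hτ⟩ := hf
  have hshift : ∀ (k : ℤ) (s : ℝ) (a b : E3),
      f ((s - k : ℝ) : UnitAddCircle) = a + (s - k) • b →
        f (s : UnitAddCircle) = (a - (k : ℝ) • b) + s • b := fun k s a b h => by
    have e : (s : UnitAddCircle) = ((s - k : ℝ) : UnitAddCircle) :=
      coe_unitAddCircle_eq_iff.2 ⟨-k, by push_cast; ring⟩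
    rw [e, h, sub_smul]
    abel
  have hright : ∃ i : Fin n, τ i.castSucc ≤ t - ⌊t⌋ ∧ t - ⌊t⌋ < τ i.succ := by
    by_contra! h
    have hall : ∀ i, τ i ≤ t - ⌊t⌋ := fun i => by
      induction i using Fin.induction with
      | zero => rw [h0]; linarith [Int.floor_le t]
      | succ i ih => exact h i ih
    linarith [hall (Fin.last n), Int.lt_floor_add_one t]
  have hleft : ∃ i : Fin n, τ i.castSucc < t - (⌈t⌉ - 1 : ℤ) ∧ t - (⌈t⌉ - 1 : ℤ) ≤ τ i.succ := by
    by_contra! h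
    have hall : ∀ i, τ i < t - (⌈t⌉ - 1 : ℤ) := fun i => by
      induction i using Fin.induction with
      | zero => rw [h0]; push_cast; linarith [Int.ceil_lt_add_one t]
      | succ i ih => exact h i ih
    have := hall (Fin.last n)
    push_cast at this
    linarith [Int.le_ceil t]
  obtain ⟨i, hi1, hi2⟩ := hright
  obtain ⟨j, hj1, hj2⟩ := hleft
  obtain ⟨a, b, hab⟩ := hτ i
  obtain ⟨a', b', hab'⟩ := hτ j
  refine ⟨min (τ i.succ - (t - ⌊t⌋)) (t - (⌈t⌉ - 1 : ℤ) - τ j.castSucc),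
    lt_min (by linarith) (by linarith), a - (⌊t⌋ : ℝ) • b, b, a' - ((⌈t⌉ - 1 : ℤ) : ℝ) • b', b',
    fun s hs => hshift _ _ _ _ (hab _ ⟨?_, ?_⟩), fun s hs => hshift _ _ _ _ (hab' _ ⟨?_, ?_⟩)⟩
  · linarith [hs.1]
  · linarith [hs.2, min_le_left (τ i.succ - (t - ⌊t⌋)) (t - (⌈t⌉ - 1 : ℤ) - τ j.castSucc)]
  · linarith [hs.1, min_le_right (τ i.succ - (t - ⌊t⌋)) (t - (⌈t⌉ - 1 : ℤ) - τ j.castSucc)]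
  · linarith [hs.2]

namespace Knot

variable (L : Knot)

/-- The height above the `xy`-plane. -/
def height (x : ℝ) : ℝ := L.toFun (x : UnitAddCircle) 2

theorem planeHeight_apply (x : ℝ) : planeHeight (L.toFun (x : UnitAddCircle)) =
    (L.proj x, L.height x) := rfl

theorem planeHeight_image_range :
    planeHeight '' range L.toFun = range fun x => (L.proj x, L.height x) := by
  rw [← range_comp]
  ext y
  constructor
  · rintro ⟨⟨x⟩, rfl⟩
    exact ⟨x, rfl⟩
  · rintro ⟨x, rfl⟩
    exact ⟨(x : UnitAddCircle), rfl⟩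

theorem continuous_proj_height : Continuous fun x => (L.proj x, L.height x) :=
  planeHeight.continuous.comp (L.continuous_toFun.comp (AddCircle.continuous_mk' 1))

theorem periodic_proj : Function.Periodic L.proj 1 := fun x => by
  simp [proj]

theorem periodic_height : Function.Periodic L.height 1 := fun x => by
  simp [height]

theorem exists_eq_add_of_proj_height {s x : ℝ} (h1 : L.proj s = L.proj x)
    (h2 : L.height s = L.height x) : ∃ n : ℤ, x = s + n :=
  coe_unitAddCircle_eq_iff.1 <| L.injective_toFun <| planeHeight.injective <| by
    rw [planeHeight_apply, planeHeight_apply, h1, h2]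

/-- The projection of a knot is strictly differentiable wherever it is differentiable. -/
theorem hasStrictDerivAt_proj {t : ℝ} (ht : DifferentiableAt ℝ L.proj t) :
    HasStrictDerivAt L.proj (deriv L.proj t) t := by
  rcases L.smooth_or_polygonal with hs | hp
  · have h0 : ∀ i : Fin 3, ContDiff ℝ (⊤ : ℕ∞) fun x : ℝ => L.toFun (x : UnitAddCircle) i :=
      fun i => (contDiff_euclidean.1 hs.1) i
    have h1 : ContDiff ℝ (⊤ : ℕ∞) L.proj := by
      have e : L.proj = fun x : ℝ => ((L.toFun (x : UnitAddCircle) 0 : ℝ) : ℂ) +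
          (L.toFun (x : UnitAddCircle) 1 : ℝ) * Complex.I :=
        funext fun x => Complex.mk_eq_add_mul_I _ _
      rw [e]
      exact (Complex.ofRealCLM.contDiff.comp (h0 0)).add
        ((Complex.ofRealCLM.contDiff.comp (h0 1)).mul contDiff_const)
    exact h1.contDiffAt.hasStrictDerivAt (by simp)
  · obtain ⟨ε, hε, a, b, a', b', hr, hl⟩ := hp.exists_affine t
    have key : ∀ (a b : E3) (s : ℝ), L.toFun (s : UnitAddCircle) = a + s • b →
        L.proj s = (⟨a 0, a 1⟩ : ℂ) + s • (⟨b 0, b 1⟩ : ℂ) := fun a b s h => by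
      apply Complex.ext <;> simp [proj, h]
    exact hasStrictDerivAt_of_affine_left_right hε (fun s hs => key a b s (hr s hs))
      (fun s hs => key a' b' s (hl s hs)) ht.hasDerivAt

variable {L} {o : ℂ}

/-- The passages through the crossing point make the projection a petal curve. -/
theorem IsPetalProjection.exists_isPetalCurve (h : L.IsPetalProjection o) :
    ∃ (p : ℕ) (t : ℤ → ℝ), IsPetalCurve L.proj o p t fun i => deriv L.proj (t i) := by
  have hc : Continuous L.proj := L.continuous_proj_height.fst
  obtain ⟨t, p, hp, hmono, hiff, hadd⟩ := exists_strictMono_enumeration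
    (Z := {x | L.proj x = o}) (by obtain ⟨x, hx⟩ := h.mem_range; exact ⟨x, hx⟩)
    (fun a b => by
      by_contra hinf
      obtain ⟨x, -, hx⟩ := Set.Infinite.exists_accPt_of_subset_isCompact hinf isCompact_Icc
        inter_subset_right
      rw [accPt_iff_frequently_nhdsNE] at hx
      have hxo : L.proj x = o := by
        have hcl : IsClosed {x | L.proj x = o} := isClosed_eq hc continuous_const
        refine hcl.closure_subset (mem_closure_iff_frequently.2 ?_)
        exact (hx.filter_mono nhdsWithin_le_nhds).mono fun y hy => hy.1
      obtain ⟨h1, h2⟩ := h.strand x hxo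
      exact hx ((h1.hasDerivAt.eventually_ne h2).mono fun y hy hy' => hy hy'.1))
    (fun x => by rw [mem_ofPred_eq, mem_ofPred_eq, L.periodic_proj x])
  have hto : ∀ i, L.proj (t i) = o := fun i => (hiff _).2 ⟨i, rfl⟩
  refine ⟨p, t, hc, L.periodic_proj, hp, hmono, hiff, hadd,
    fun s x hsx hs => coe_unitAddCircle_eq_iff.1 (h.single_crossing s x hsx hs),
    fun i => (h.strand _ (hto i)).1.hasDerivAt, fun i => (h.strand _ (hto i)).2, fun i => ?_,
    fun i j hij him => ?_⟩
  · have e : (fun x => L.proj (x + 1)) = L.proj := funext L.periodic_proj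
    simp only [hadd]
    rw [← deriv_comp_add_const, e]
  · have hne : (t i : UnitAddCircle) ≠ (t j : UnitAddCircle) := fun he => by
      obtain ⟨n, hn⟩ := coe_unitAddCircle_eq_iff.1 he
      have ht : ∀ (n : ℕ) (i : ℤ), t (i + n * p) = t i + n := fun n => by
        induction n with
        | zero => simp
        | succ n ih =>
          intro i
          have e : i + ((n + 1 : ℕ) : ℤ) * p = i + n * p + p := by push_cast; ring
          rw [e, hadd, ih]
          push_cast
          ring
      obtain ⟨k, rfl | rfl⟩ := n.eq_nat_or_neg
      · have := ht k i
        have : t j = t (i + k * p) := by rw [this, hn]; simp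
        have := hmono.injective this
        exact hij ⟨k, by rw [this]; ring⟩
      · have := ht k j
        have : t i = t (j + k * p) := by rw [this, hn]; push_cast; ring
        have := hmono.injective this
        exact hij ⟨-k, by rw [this]; ring⟩
    have hli := LinearIndependent.pair_iff.1 (h.transversal _ _ (hto i) (hto j) hne)
    set x := deriv L.proj (t i)
    set y := deriv L.proj (t j)
    have := (hli (Complex.normSq y) (-(x * (starRingEnd ℂ) y).re) (by
      have e : (((x * (starRingEnd ℂ) y).re : ℝ) : ℂ) = x * (starRingEnd ℂ) y := by
        apply Complex.ext
        · simp
        · rw [him, Complex.ofReal_im]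
      rw [Complex.real_smul, Complex.real_smul, Complex.ofReal_neg, e, ← Complex.mul_conj]
      ring)).1
    exact (h.strand _ (hto j)).2 (Complex.normSq_eq_zero.1 this)

variable {p : ℕ} {t : ℤ → ℝ} {d : ℤ → ℂ}

theorem mem_loops (hc : IsPetalCurve L.proj o p t d) (i : ℤ) :
    L.proj '' Icc (t i) (t (i + 1)) ∈ L.loops o :=
  ⟨t i, t (i + 1), hc.strictMono (lt_add_one i), hc.apply_t i, hc.apply_t _,
    fun _ hx => hc.apply_ne hx, rfl⟩

/-- Different passages give different loops, as sets. -/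
theorem image_Icc_ne (hc : IsPetalCurve L.proj o p t d) {i j : ℤ} (hij : ¬ (p : ℤ) ∣ j - i) :
    L.proj '' Icc (t j) (t (j + 1)) ≠ L.proj '' Icc (t i) (t (i + 1)) := fun he => by
  have hlt := hc.strictMono (lt_add_one j)
  refine hc.apply_notMem_loop hij (x := (t j + t (j + 1)) / 2)
    ⟨by linarith, by linarith⟩ ?_
  rw [← he]
  exact mem_image_of_mem _ ⟨by linarith, by linarith⟩

theorem le_encard_loops (hc : IsPetalCurve L.proj o p t d) : (p : ℕ∞) ≤ (L.loops o).encard := by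
  have hinj : InjOn (fun i : ℕ => L.proj '' Icc (t i) (t (i + 1))) (Finset.range p : Set ℕ) := by
    intro i hi j hj hij
    simp only [Finset.coe_range, mem_Iio] at hi hj
    by_contra hne
    refine image_Icc_ne hc (i := i) (j := j) (fun hdvd => hne ?_) hij.symm
    have := Int.eq_zero_of_abs_lt_dvd hdvd (by rw [abs_lt]; omega)
    omega
  calc (p : ℕ∞) = ((Finset.range p : Finset ℕ) : Set ℕ).encard := by
        rw [encard_coe_eq_coe_finsetCard, Finset.card_range]
    _ = _ := hinj.encard_image.symm
    _ ≤ _ := encard_le_encard (by rintro _ ⟨i, -, rfl⟩; exact mem_loops hc i)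

/-- A knot with a petal projection is isotopic to a polygon with few local maxima. -/
theorem IsPetalProjection.exists_equivalent_numLocalMaxima_le (h : L.IsPetalProjection o) :
    ∃ L' : Knot, L.Equivalent L' ∧ ∀ v, 2 * L'.numLocalMaxima v ≤ (L.loops o).encard + 1 := by
  obtain ⟨p, t, hc⟩ := h.exists_isPetalCurve
  obtain ⟨c, z, hn, hz, hzp, hzt, hiso⟩ := hc.exists_normal_form
    (fun i => L.hasStrictDerivAt_proj (h.strand _ (hc.apply_t i)).1)
    L.continuous_proj_height.snd L.periodic_height
  rw [← L.planeHeight_image_range] at hiso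
  have hzne : ∀ i j : ℤ, z (2 * i + 1 / 2) = z (2 * j + 1 / 2) → (p : ℤ) ∣ j - i := by
    intro i j hij
    rw [hzt, hzt] at hij
    obtain ⟨n, hn⟩ := L.exists_eq_add_of_proj_height
      ((hc.apply_t i).trans (hc.apply_t j).symm) hij
    rw [← hc.t_add_mul] at hn
    have := hc.strictMono.injective hn
    exact ⟨n, by rw [this]; ring⟩
  suffices hL' : ∃ L' : Knot, L.Equivalent L' ∧ ∀ v, 2 * L'.numLocalMaxima v ≤ p + 1 by
    obtain ⟨L', h1, h2⟩ := hL'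
    exact ⟨L', h1, fun v => (h2 v).trans (by gcongr; exact le_encard_loops hc)⟩
  rcases le_or_gt p 2 with hp | hp
  · exact hn.exists_equivalent_of_le_two hp hz hzp hzne hiso
  · refine hn.exists_equivalent_numLocalMaxima_le hp ?_ hz hzp hzne hiso
    intro i j ε hε α β hα hβ he
    have hd : ∀ i, 0 < ‖deriv L.proj (t i)‖ := fun i => norm_pos_iff.2 (hc.d_ne_zero i)
    refine hc.ne_add_of_not_nested (by omega) (fun i j hij => h.not_nested _ (mem_loops hc i) _
      (mem_loops hc j) (image_Icc_ne hc hij)) i j hε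
      (mul_pos (hd j) (div_pos hα (hd i))) (mul_pos (hd j) (div_pos hβ (hd (i + 1)))) ?_
    have h0 : ∀ i, ((‖deriv L.proj (t i)‖ : ℝ) : ℂ) ≠ 0 := fun i =>
      Complex.ofReal_ne_zero.2 (hd i).ne'
    have h1 := h0 i
    have h2 := h0 j
    have h3 := h0 (i + 1)
    push_cast
    calc (ε : ℂ) * deriv L.proj (t j) = (‖deriv L.proj (t j)‖ : ℂ) *
          (ε * (deriv L.proj (t j) / ‖deriv L.proj (t j)‖)) := by field_simp
      _ = _ := by rw [he]; ring

end Knot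

theorem theorem2 (K : Knot) (hK : ¬ K.IsTrivial) :
    2 * K.superbridgeIndex ≤ K.petalNumber + 1 := by
  -- the petal number is an infimum, so it has to stand alone on the right
  rw [← tsub_le_iff_right, Knot.petalNumber]
  refine le_iInf fun L => le_iInf fun hL => le_iInf fun o => le_iInf fun h => ?_
  rw [tsub_le_iff_right]
  obtain ⟨L', hL', hle⟩ := h.exists_equivalent_numLocalMaxima_le
  have hKL' : K.Equivalent L' := by
    rw [Knot.Equivalent, ambientIsotopic_iff_isotopicSets] at *
    exact hL.trans hL'
  have h1 : K.superbridgeIndex ≤ ⨆ v ∈ Metric.sphere (0 : E3) 1, L'.numLocalMaxima v :=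
    iInf₂_le L' hKL'
  refine (mul_le_mul_right h1 2).trans ?_
  rw [ENat.mul_iSup]
  refine iSup_le fun v => ?_
  rw [ENat.mul_iSup]
  exact iSup_le fun _ => hle v
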